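/- Let $\Bbbk$ be an algebraically closed field of characteristic $0$ and let $X$ be a $\mathbb{Q}$-Fano variety over $\Bbbk$ of dimension $n$, i.e. a (normal) projective log terminal variety such that $-K_X$ is an ample $\mathbb{Q}$-Cartier divisor. Let $\mathcal{O}_X=I_0\supset I_1\supset\cdots\supset I_M$ be coherent ideal sheaves, and let $$\mathcal{I}=I_M+I_{M-1}t+\cdots+I_1t^{M-1}+(t^M)\subset\mathcal{O}_{X\times\mathbb{A}^1_t}$$ be the corresponding flag ideal. Let $s\in\mathbb{Q}_{>0}$, let $\Pi\colon\mathcal{B}\to X\times\mathbb{A}^1$ be the blowing up along $\mathcal{I}$, let $\mathcal{O}_{\mathcal{B}}(-E)=\mathcal{I}\mathcal{O}_{\mathcal{B}}$ and $\mathcal{L}=\Pi^*p_1^*(-K_X)-sE$. Assume that $(\mathcal{B},\mathcal{L})/\mathbb{A}^1$ is a normal $\mathbb{Q}$-semi test configuration of $(X,-K_X)$, i.e. that $\mathcal{B}$ is normal, $\Pi$ is not an isomorphism, and $\mathcal{L}$ is semiample over $\mathbb{A}^1$. For a sufficiently divisible positive integer $k$, let $N=h^0(X,\mathcal{O}_X(-kK_X))$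 and let $w(k)$ be the total weight of the $\mathbb{G}_m$-action on the fibre at $0\in\mathbb{A}^1$ of $\pi_*\mathcal{O}_{\mathcal{B}}(k\mathcal{L})$, where $\pi\colon\mathcal{B}\to\mathbb{A}^1$ and the action is induced by $(a,t)\mapsto at$ on $\mathbb{A}^1$, a function $f$ being sent by $a$ to $x\mapsto f(a^{-1}x)$ (so that $t$ has weight $-1$). Then there is a positive integer $k_0$ such that for every positive multiple $k$ of $k_0$ the divisor $-kK_X$ is Cartier and globally generated, $ks$ is an integer, $N$ is finite, and the following hold. (1) For $0\le j\le Mks$ put $$\tilde I_j=\sum_{\substack{j_1+\cdots+j_{ks}=j\\ 0\le j_1,\dots,j_{ks}\le M}}I_{j_1}\cdots I_{j_{ks}}\subset\mathcal{O}_X .$$ Then $\mathcal{I}^{ks}=\tilde I_{Mks}+\tilde I_{Mks-1}t+\cdots+\tilde I_1t^{Mks-1}+(t^{Mks})$. The subspaces $\mathcal{F}_j=H^0(X,\mathcal{O}_X(-kK_X)\cdot\tilde I_j)$ form a filtration $$H^0(X,\mathcal{O}_X(-kK_X))=\mathcal{F}_0\supset\mathcal{F}_1\supset\cdots\supset\mathcal{F}_{Mks}\supset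 0,$$ and $m:=\sum_{j=1}^{Mks}\dim\mathcal{F}_j$ satisfies $m=NMks+w(k)$. (2) Let $p_i\colon X^N\to X$ be the projections and put $$J_j=\sum_{\substack{j_1+\cdots+j_N=j\\ 0\le j_1,\dots,j_N\le Mks}}p_1^{-1}\tilde I_{j_1}\cdots p_N^{-1}\tilde I_{j_N}\subset\mathcal{O}_{X^N}\qquad(0\le j\le NMks),$$ where $p_i^{-1}$ denotes the inverse image ideal sheaf. Let $D_k\subset X^N$ be the determinant divisor, i.e. the pull-back of the divisor $\{\det(x_{ij})_{1\le i,j\le N}=0\}\subset(\mathbb{P}^{N-1})^N$ under the $N$-th power of the morphism $X\to\mathbb{P}^{N-1}$ defined by a basis of $H^0(X,\mathcal{O}_X(-kK_X))$ (it does not depend on the basis). Then $\mathcal{O}_{X^N}(-D_k)\subset J_m$. -/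

import Mathlib

open AlgebraicGeometry CategoryTheory CategoryTheory.Limits
open scoped KaehlerDifferential

universe u

noncomputable section

namespace FlagIdeal

/-! ### Function fields -/

section FunctionField

variable {K : Type u} [Field K]

/-- The inclusion of the ground field in the local ring at `x`. -/
def constStalk (X : Scheme.{u}) [X.Over (Spec (.of K))] (x : X) : K →+* X.presheaf.stalk x :=
  ((X.presheaf.germ ⊤ x (TopologicalSpace.Opens.mem_top x)).hom.comp (X ↘ Spec (.of K)).appTop.hom).comp
    (Scheme.ΓSpecIso (.of K)).inv.hom

/-- The function field of a variety over `K` as a field extension of `K`. -/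
instance functionFieldAlgebra (X : Scheme.{u}) [X.Over (Spec (.of K))] [IsIntegral X] :
    Algebra K X.functionField :=
  (constStalk X (genericPoint X)).toAlgebra

lemma algebraMap_constStalk (X : Scheme.{u}) [X.Over (Spec (.of K))] [IsIntegral X] (x : X)
    (c : K) : algebraMap (X.presheaf.stalk x) X.functionField (constStalk X x c) =
      algebraMap K X.functionField c := by
  have : Nonempty (⊤ : X.Opens) := ⟨⟨x, TopologicalSpace.Opens.mem_top x⟩⟩
  exact Scheme.algebraMap_germ_eq_germToFunctionField X (U := ⊤) (x := x)
    (TopologicalSpace.Opens.mem_top x)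
    ((X ↘ Spec (.of K)).appTop ((Scheme.ΓSpecIso (.of K)).inv c))

lemma specializes_genericPoint {X Y : Scheme.{u}} [IsIntegral X] [IsIntegral Y] (f : Y ⟶ X)
    [IsDominant f] : f (genericPoint Y) ⤳ genericPoint X := by
  have h : IsGenericPoint (f (genericPoint Y)) (Set.univ : Set X) := by
    have h1 := (genericPoint_spec Y).image f.continuous
    rwa [Set.image_univ, f.denseRange.closure_range] at h1
  rw [h.eq (genericPoint_spec X)]

/-- Pull-back of rational functions along a dominant morphism. -/
def pullFun {X Y : Scheme.{u}} [IsIntegral X] [IsIntegral Y] (f : Y ⟶ X) [IsDominant f] :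
    X.functionField →+* Y.functionField :=
  (X.presheaf.stalkSpecializes (specializes_genericPoint f) ≫ f.stalkMap (genericPoint Y)).hom

lemma pullFun_algebraMap {X Y : Scheme.{u}} [IsIntegral X] [IsIntegral Y] (f : Y ⟶ X)
    [IsDominant f] (y : Y) (a : X.presheaf.stalk (f y)) :
    pullFun f (algebraMap (X.presheaf.stalk (f y)) X.functionField a) =
      algebraMap (Y.presheaf.stalk y) Y.functionField (f.stalkMap y a) := by
  have hy : genericPoint Y ⤳ y := (genericPoint_spec Y).specializes trivial
  have h := Scheme.Hom.stalkSpecializes_stalkMap f (genericPoint Y) y hy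
  have h1 : X.presheaf.stalkSpecializes ((genericPoint_spec X).specializes trivial) ≫
      X.presheaf.stalkSpecializes (specializes_genericPoint f) =
      X.presheaf.stalkSpecializes (hy.map f.continuous) :=
    TopCat.Presheaf.stalkSpecializes_comp _ _ _
  have h2 := congr_arg (fun g => g ≫ f.stalkMap (genericPoint Y)) h1
  simp only [Category.assoc] at h2
  rw [h] at h2
  exact congr_arg (fun g => g.hom a) h2

end FunctionField

/-! ### Ideal sheaves, and subsheaves of the sheaf of rational functions given by their stalks -/

section Sheaves

/-- The stalk at `x` of an ideal sheaf. -/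
def stalkIdeal {X : Scheme.{u}} (I : X.IdealSheafData) (x : X) : Ideal (X.presheaf.stalk x) :=
  ⨆ (U : X.affineOpens) (h : x ∈ U.1), (I.ideal U).map (X.presheaf.germ U.1 x h).hom

/-- The stalk at `x` of an ideal sheaf, inside the function field. -/
def fracStalk {X : Scheme.{u}} [IsIntegral X] (I : X.IdealSheafData) (x : X) :
    Submodule (X.presheaf.stalk x) X.functionField :=
  Submodule.map (Algebra.linearMap (X.presheaf.stalk x) X.functionField) (stalkIdeal I x)

/-- Global sections of a subsheaf of the constant sheaf `K(X)`: the rational functions that lie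
in all the stalks. -/
def globalSections (K : Type u) [Field K] {X : Scheme.{u}} [X.Over (Spec (.of K))] [IsIntegral X]
    (L : ∀ x : X, Submodule (X.presheaf.stalk x) X.functionField) :
    Submodule K X.functionField where
  carrier := {f | ∀ x, f ∈ L x}
  add_mem' hf hg x := (L x).add_mem (hf x) (hg x)
  zero_mem' x := (L x).zero_mem
  smul_mem' c f hf x := by
    rw [Algebra.smul_def, ← algebraMap_constStalk X x c, ← Algebra.smul_def]
    exact (L x).smul_mem _ (hf x)

/-- An ideal sheaf is invertible if it is locally generated by one nonzerodivisor. -/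
def IsInvertible {X : Scheme.{u}} (I : X.IdealSheafData) : Prop :=
  ∀ x : X, ∃ U : X.affineOpens, x ∈ U.1 ∧
    ∃ f ∈ nonZeroDivisors Γ(X, U.1), I.ideal U = Ideal.span {f}

/-- `p : B ⟶ Y` is the blowing up of `Y` along `I`: it is universal among the morphisms for which
the inverse image ideal sheaf of `I` is invertible. -/
structure IsBlowup {B Y : Scheme.{u}} (p : B ⟶ Y) (I : Y.IdealSheafData) : Prop where
  invertible : IsInvertible (I.comap p)
  existsUnique_lift : ∀ (Z : Scheme.{u}) (g : Z ⟶ Y), IsInvertible (I.comap g) →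
    ∃! h : Z ⟶ B, h ≫ p = g

/-- A scheme all of whose local rings are integrally closed. -/
def IsNormal (X : Scheme.{u}) : Prop := ∀ x : X, IsIntegrallyClosed (X.presheaf.stalk x)

end Sheaves

/-! ### The canonical divisor and `ℚ`-Fano varieties -/

section Canonical

variable {K : Type u} [Field K] {X : Scheme.{u}} [X.Over (Spec (.of K))] [IsIntegral X]

variable (K X) in
/-- Rational differential forms of degree `n`. -/
abbrev RatForm (n : ℕ) : Type u := ⋀[X.functionField]^n Ω[X.functionField⁄K]

/-- The image of `⋀ⁿ Ω_{R/K}` in the rational `n`-forms: the `R`-span of the forms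
`dx₁ ∧ ⋯ ∧ dxₙ` with `xᵢ ∈ R`. -/
def formLattice (n : ℕ) (R : Subring X.functionField) : Submodule R (RatForm K X n) :=
  Submodule.span R {η | ∃ x : Fin n → R, η = exteriorPower.ιMulti X.functionField n
    (fun i => KaehlerDifferential.D K X.functionField (x i : X.functionField))}

/-- `R ω = g · (image of ⋀ⁿ Ω_{R/K})`. If `R` is the local ring of a prime divisor `E` on a normal
model of `X`, so that `⋀ⁿ Ω_{R/K}` is free of rank one, this says that `ω` is `g` times
a generator, i.e. that `ord_E ω = ord_E g`. -/
def IsOrderOf {n : ℕ} (ω : RatForm K X n) (R : Subring X.functionField) (g : X.functionField) :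
    Prop :=
  (Submodule.span R {ω} : Set (RatForm K X n)) = (fun η => g • η) '' formLattice (K := K) n R

variable (X) in
/-- The local ring at `y` as a subring of the function field. -/
def localRing (y : X) : Subring X.functionField :=
  (algebraMap (X.presheaf.stalk y) X.functionField).range

/-- The stalk at `x` of `𝒪_X(-k K_X)`, where `K_X = div ω`: the rational functions `f` with
`ord_y f ≥ k ord_y ω` at the generic point `y` of each prime divisor through `x`.
(On a normal variety these `y` are the points whose local ring is a discrete valuation ring.) -/
def antiCan {n : ℕ} (ω : RatForm K X n) (k : ℕ) (x : X) :
    Submodule (X.presheaf.stalk x) X.functionField where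
  carrier := {f | ∀ y : X, y ⤳ x → IsDiscreteValuationRing (X.presheaf.stalk y) →
    ∀ g, IsOrderOf ω (localRing X y) g → ∃ a ∈ localRing X y, f = a * g ^ k}
  add_mem' {f f'} hf hf' y hy hD g hg := by
    obtain ⟨a, ha, rfl⟩ := hf y hy hD g hg
    obtain ⟨a', ha', rfl⟩ := hf' y hy hD g hg
    exact ⟨a + a', add_mem ha ha', by ring⟩
  zero_mem' y _ _ g _ := ⟨0, zero_mem _, by simp⟩
  smul_mem' c f hf y hy hD g hg := by
    obtain ⟨a, ha, rfl⟩ := hf y hy hD g hg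
    refine ⟨algebraMap (X.presheaf.stalk x) X.functionField c * a, mul_mem ?_ ha, ?_⟩
    · refine ⟨X.presheaf.stalkSpecializes hy c, ?_⟩
      simp only [RingHom.algebraMap_toAlgebra]
      rw [← CommRingCat.comp_apply, TopCat.Presheaf.stalkSpecializes_comp]
    · rw [Algebra.smul_def, mul_assoc]

/-- `H⁰(X, 𝒪_X(-k K_X))`. -/
def antiSections {n : ℕ} (ω : RatForm K X n) (k : ℕ) : Submodule K X.functionField :=
  globalSections K (antiCan ω k)

/-- `-k K_X` is Cartier: `𝒪_X(-k K_X)` is locally principal. -/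
def IsCartier {n : ℕ} (ω : RatForm K X n) (k : ℕ) : Prop :=
  ∀ x : X, ∃ g : X.functionField, g ≠ 0 ∧ antiCan ω k x = Submodule.span _ {g}

/-- `𝒪_X(-k K_X)` is generated by global sections (for `-k K_X` Cartier). -/
def IsGloballyGenerated {n : ℕ} (ω : RatForm K X n) (k : ℕ) : Prop :=
  ∀ x : X, ∃ f ∈ antiSections ω k, antiCan ω k x = Submodule.span _ {f}

/-- `-K_X` is an ample `ℚ`-Cartier divisor: for some `m > 0` the divisor `-m K_X` is Cartier and
the line bundle `𝒪_X(-m K_X)` is ample, i.e. each point lies in an affine open set of the form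
`X_f = {y | f generates the stalk at y}` with `f` a section of a positive power. -/
def IsAmpleQCartier {n : ℕ} (ω : RatForm K X n) : Prop :=
  ∃ m : ℕ, 0 < m ∧ IsCartier ω m ∧ ∀ x : X, ∃ l : ℕ, 0 < l ∧ ∃ f ∈ antiSections ω (l * m),
    ∃ U : X.Opens, IsAffineOpen U ∧ x ∈ U ∧
      ∀ y : X, y ∈ U ↔ antiCan ω (l * m) y = Submodule.span _ {f}

/-- `X` is log terminal (for `K_X` `ℚ`-Cartier): every divisor over `X` has discrepancy `> -1`.
A divisor `E` over `X` is given by its local ring `R`, a discrete valuation ring of `K(X)/K`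
essentially of finite type over `K` and dominating the local ring of a point `x` of `X`. If `h`
generates `𝒪_X(-m K_X)` at `x`, so that `div h = m K_X` there, and `π` is a uniformizer of `R`, then
the discrepancy is `ord_E ω - (1/m) ord_E h`, and it is `> -1` if and only if
`ord_E ((g π) ^ m / h) > 0`, where `ord_E g = ord_E ω`. -/
def IsLogTerminal {n : ℕ} (ω : RatForm K X n) : Prop :=
  ∀ (R : Subalgebra K X.functionField) [IsDiscreteValuationRing R],
    IsFractionRing R X.functionField → Algebra.EssFiniteType K R →
    ∀ x : X, (∀ a : X.presheaf.stalk x, ∃ r : R, (r : X.functionField) = algebraMap _ _ a ∧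
      (IsUnit r ↔ IsUnit a)) →
    ∀ g, IsOrderOf ω R.toSubring g → ∀ π : R, Irreducible π →
    ∀ m : ℕ, 0 < m → ∀ h, h ≠ 0 → antiCan ω m x = Submodule.span _ {h} →
      ∃ r ∈ IsLocalRing.maximalIdeal R, (g * (π : X.functionField)) ^ m = r * h

variable (K X) in
/-- `X` is a `ℚ`-Fano variety of dimension `n`, with canonical divisor `K_X = div ω` for a nonzero
rational `n`-form `ω`. (A proper variety with an ample line bundle is projective.) -/
structure IsQFano (n : ℕ) (ω : RatForm K X n) : Prop where
  proper : IsProper (X ↘ Spec (.of K))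
  normal : IsNormal X
  dim : topologicalKrullDim X = n
  ne_zero : ω ≠ 0
  ample : IsAmpleQCartier ω
  logTerminal : IsLogTerminal ω

end Canonical

/-! ### The product `X × 𝔸¹` and flag ideals -/

section Cylinder

variable (X : Scheme.{u})

/-- `X × 𝔸¹`. -/
def Cyl : Scheme.{u} := 𝔸(PUnit.{u + 1}; X)

/-- The first projection `X × 𝔸¹ ⟶ X`. -/
def Cyl.proj : Cyl X ⟶ X := 𝔸(PUnit.{u + 1}; X) ↘ X

/-- The coordinate `t`, as a function on `X × 𝔸¹`. -/
def Cyl.t : Γ(Cyl X, ⊤) := AffineSpace.coord X PUnit.unit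

instance [IsIntegral X] : IsIntegral (Cyl X) := inferInstanceAs (IsIntegral 𝔸(PUnit.{u + 1}; X))

instance : Surjective (Cyl.proj X) := inferInstanceAs (Surjective (𝔸(PUnit.{u + 1}; X) ↘ X))

instance {K : Type u} [Field K] [X.Over (Spec (.of K))] : (Cyl X).Over (Spec (.of K)) :=
  ⟨Cyl.proj X ≫ X ↘ Spec (.of K)⟩

/-- The constant functions on `X × 𝔸¹`. -/
def Cyl.const {K : Type u} [Field K] [X.Over (Spec (.of K))] : K →+* Γ(Cyl X, ⊤) :=
  (Cyl X ↘ Spec (.of K)).appTop.hom.comp (Scheme.ΓSpecIso (.of K)).inv.hom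

/-- The action of `a` on `X × 𝔸¹`, `(x, t) ↦ (x, a t)`. -/
def Cyl.act {K : Type u} [Field K] [X.Over (Spec (.of K))] (a : Kˣ) : Cyl X ⟶ Cyl X :=
  AffineSpace.homOfVector (Cyl.proj X) (fun _ => Cyl.const X (a : K) * Cyl.t X)

lemma Cyl.act_proj {K : Type u} [Field K] [X.Over (Spec (.of K))] (a : Kˣ) :
    Cyl.act X a ≫ Cyl.proj X = Cyl.proj X :=
  AffineSpace.homOfVector_over _ _

lemma Cyl.act_t {K : Type u} [Field K] [X.Over (Spec (.of K))] (a : Kˣ) :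
    (Cyl.act X a).appTop (Cyl.t X) = Cyl.const X (a : K) * Cyl.t X :=
  AffineSpace.homOfVector_appTop_coord _ _ _

lemma Cyl.act_const {K : Type u} [Field K] [X.Over (Spec (.of K))] (a : Kˣ) (c : K) :
    (Cyl.act X a).appTop (Cyl.const X c) = Cyl.const X c := by
  have h : Cyl.act X a ≫ (Cyl X ↘ Spec (.of K)) = Cyl X ↘ Spec (.of K) := by
    change Cyl.act X a ≫ Cyl.proj X ≫ _ = Cyl.proj X ≫ _
    rw [← Category.assoc, Cyl.act_proj]
  have h2 := congr_arg (fun f => f.appTop ((Scheme.ΓSpecIso (.of K)).inv c)) h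
  rw [Scheme.Hom.comp_appTop] at h2
  exact h2

lemma Cyl.act_comp {K : Type u} [Field K] [X.Over (Spec (.of K))] (a b : Kˣ) :
    Cyl.act X a ≫ Cyl.act X b = Cyl.act X (a * b) := by
  refine AffineSpace.hom_ext ?_ fun _ => ?_
  · change (Cyl.act X a ≫ Cyl.act X b) ≫ Cyl.proj X = Cyl.act X (a * b) ≫ Cyl.proj X
    rw [Category.assoc, Cyl.act_proj, Cyl.act_proj, Cyl.act_proj]
  · change (Cyl.act X a).appTop ((Cyl.act X b).appTop (Cyl.t X)) =
      (Cyl.act X (a * b)).appTop (Cyl.t X)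
    rw [Cyl.act_t, Cyl.act_t, map_mul, Cyl.act_t, Cyl.act_const, Units.val_mul, map_mul]
    ring

lemma Cyl.act_one {K : Type u} [Field K] [X.Over (Spec (.of K))] :
    Cyl.act X (1 : Kˣ) = 𝟙 (Cyl X) := by
  refine AffineSpace.hom_ext ?_ fun _ => ?_
  · change Cyl.act X (1 : Kˣ) ≫ Cyl.proj X = 𝟙 (Cyl X) ≫ Cyl.proj X
    rw [Cyl.act_proj, Category.id_comp]
  · change (Cyl.act X (1 : Kˣ)).appTop (Cyl.t X) = (𝟙 (Cyl X) : Cyl X ⟶ Cyl X).appTop (Cyl.t X)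
    rw [Cyl.act_t]
    simp

instance {K : Type u} [Field K] [X.Over (Spec (.of K))] (a : Kˣ) : IsIso (Cyl.act X a) :=
  ⟨Cyl.act X a⁻¹, by rw [Cyl.act_comp, mul_inv_cancel, Cyl.act_one],
    by rw [Cyl.act_comp, inv_mul_cancel, Cyl.act_one]⟩

/-- The ideal sheaf `(t)` on `X × 𝔸¹`. -/
def tIdeal : (Cyl X).IdealSheafData := .ofIdealTop (Ideal.span {Cyl.t X})

variable {X}

/-- `I_M + I_{M-1} t + ⋯ + I_1 t^{M-1} + I_0 t^M`, an ideal sheaf on `X × 𝔸¹`. -/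
def tExpansion (M : ℕ) (I : ℕ → X.IdealSheafData) : (Cyl X).IdealSheafData :=
  ∑ j ∈ Finset.range (M + 1), (I j).comap (Cyl.proj X) * tIdeal X ^ (M - j)

/-- The data of a flag ideal: `𝒪_X = I_0 ⊇ I_1 ⊇ ⋯ ⊇ I_M`. The flag ideal is `tExpansion M I`. -/
structure IsFlag (M : ℕ) (I : ℕ → X.IdealSheafData) : Prop where
  zero : I 0 = ⊤
  anti : ∀ j < M, I (j + 1) ≤ I j

/-- `Ĩ_j`, the sum of the products `I_{j_1} ⋯ I_{j_r}` with `j_1 + ⋯ + j_r = j`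
and `0 ≤ j_i ≤ M`. -/
def tilde (M : ℕ) (I : ℕ → X.IdealSheafData) (r j : ℕ) : X.IdealSheafData :=
  ∑ a : Fin r → Fin (M + 1) with ∑ i, (a i : ℕ) = j, ∏ i, I (a i)

end Cylinder

/-! ### Semi test configurations -/

section TestConfiguration

lemma comap_eq_top {Y Z : Scheme.{u}} (I : Y.IdealSheafData) (g : Z ⟶ Y)
    (h : ∀ z, g z ∉ I.support) : I.comap g = ⊤ := by
  rw [← Scheme.IdealSheafData.support_eq_bot_iff, Scheme.IdealSheafData.support_comap]
  ext z
  simpa using h z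

lemma isInvertible_top (X : Scheme.{u}) : IsInvertible (⊤ : X.IdealSheafData) := by
  intro x
  obtain ⟨_, ⟨U, hU, rfl⟩, hx, -⟩ :=
    X.isBasis_affineOpens.exists_subset_of_mem_open (Set.mem_univ x) isOpen_univ
  exact ⟨⟨U, hU⟩, hx, 1, one_mem _, by simp⟩

/-- The blowing up of an integral scheme along a nonzero ideal sheaf is dominant. -/
lemma IsBlowup.isDominant {B Y : Scheme.{u}} [IsIntegral Y] {p : B ⟶ Y} {I : Y.IdealSheafData}
    (h : IsBlowup p I) (y : Y) (hy : y ∉ I.support) : IsDominant p := by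
  let U : Y.Opens := ⟨(I.support : Set Y)ᶜ, I.support.isClosed.isOpen_compl⟩
  have hU : Dense (U : Set Y) := U.isOpen.dense ⟨y, hy⟩
  obtain ⟨q, hq, -⟩ := h.existsUnique_lift U.toScheme U.ι (by
    rw [comap_eq_top I U.ι fun z => z.2]
    exact isInvertible_top _)
  have : IsDominant U.ι := Opens.isDominant_ι hU
  have : IsDominant (q ≫ p) := hq ▸ this
  exact IsDominant.of_comp q p

/-- The zero set of a flag ideal is not all of `X × 𝔸¹`. -/
lemma exists_notMem_support {X : Scheme.{u}} [IsIntegral X] {M : ℕ} {I : ℕ → X.IdealSheafData}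
    (hI : IsFlag M I) : ∃ y, y ∉ (tExpansion M I).support := by
  let σ : X ⟶ Cyl X := AffineSpace.homOfVector (𝟙 X) (fun _ => 1)
  have hσ : σ.appTop (Cyl.t X) = 1 := AffineSpace.homOfVector_appTop_coord _ _ _
  let y := σ (genericPoint X)
  have hy : y ∈ (Cyl X).basicOpen (Cyl.t X) := by
    change genericPoint X ∈ σ ⁻¹ᵁ (Cyl X).basicOpen (Cyl.t X)
    rw [Scheme.preimage_basicOpen_top, hσ]
    simp
  have ht : y ∉ (tIdeal X).support := by
    intro h
    have h' : y ∈ ((tIdeal X).support : Set (Cyl X)) := h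
    rw [tIdeal, Scheme.IdealSheafData.coe_support_ofIdealTop, Scheme.zeroLocus_span] at h'
    exact (Scheme.mem_zeroLocus_iff _ _ _).1 h' _ rfl hy
  have ht' : y ∉ (tIdeal X ^ M).support := by
    rcases Nat.eq_zero_or_pos M with rfl | hM
    · rw [pow_zero, Scheme.IdealSheafData.one_eq_top, Scheme.IdealSheafData.support_top]
      exact fun h => h
    · rwa [Scheme.IdealSheafData.support_pow _ _ hM.ne']
  refine ⟨y, fun h => ht' ?_⟩
  refine Scheme.IdealSheafData.support_antitone ?_ h
  have h0 : (I 0).comap (Cyl.proj X) * tIdeal X ^ (M - 0) = tIdeal X ^ M := by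
    rw [hI.zero, Scheme.IdealSheafData.comap_top, Scheme.IdealSheafData.top_mul, Nat.sub_zero]
  rw [← h0, tExpansion]
  exact Finset.single_le_sum (f := fun j => (I j).comap (Cyl.proj X) * tIdeal X ^ (M - j))
    (fun _ _ => bot_le) (Finset.mem_range.2 (Nat.succ_pos M))

variable {K : Type u} [Field K] {X : Scheme.{u}} [X.Over (Spec (.of K))] [IsIntegral X]

/-- The stalk at `b` of `𝒪_B(k Π^*p_1^*(-K_X) - r E)` inside the function field of `B`, where `E` is
the divisor with `𝒪_B(-E) = 𝓘 𝒪_B`: the product of the pull-back of `𝒪_X(-k K_X)`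
with the `r`-th power of `𝓘 𝒪_B`. -/
def bundleStalk {n : ℕ} (ω : RatForm K X n) (𝓘 : (Cyl X).IdealSheafData) {B : Scheme.{u}}
    [IsIntegral B] (p : B ⟶ Cyl X) [IsDominant p] (k r : ℕ) (b : B) :
    Submodule (B.presheaf.stalk b) B.functionField :=
  Submodule.span _ (pullFun (p ≫ Cyl.proj X) '' antiCan ω k ((p ≫ Cyl.proj X) b)) *
    fracStalk (𝓘.comap p) b ^ r

/-- `H⁰(B, 𝒪_B(k Π^*p_1^*(-K_X) - r E))`, regarded (the blowing up being birational) as a space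
of rational functions on `X × 𝔸¹`. -/
def bundleSections {n : ℕ} (ω : RatForm K X n) (𝓘 : (Cyl X).IdealSheafData) {B : Scheme.{u}}
    [IsIntegral B] (p : B ⟶ Cyl X) [IsDominant p] (k r : ℕ) :
    Submodule K (Cyl X).functionField where
  carrier := {f | ∀ b, pullFun p f ∈ bundleStalk ω 𝓘 p k r b}
  add_mem' hf hg b := by
    rw [map_add]
    exact Submodule.add_mem _ (hf b) (hg b)
  zero_mem' b := by
    rw [map_zero]
    exact Submodule.zero_mem _
  smul_mem' c f hf b := by
    rw [Algebra.smul_def, map_mul, ← algebraMap_constStalk (Cyl X) (p b) c, pullFun_algebraMap,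
      ← Algebra.smul_def]
    exact Submodule.smul_mem _ _ (hf b)

/-- The blowing up of `X × 𝔸¹` along the flag ideal given by `I`, when it is a variety. -/
structure FlagBlowup (M : ℕ) (I : ℕ → X.IdealSheafData) where
  isFlag : IsFlag M I
  B : Scheme.{u}
  isIntegral : IsIntegral B
  p : B ⟶ Cyl X
  isBlowup : IsBlowup p (tExpansion M I)

namespace FlagBlowup

variable {M : ℕ} {I : ℕ → X.IdealSheafData} (T : FlagBlowup M I)

instance : IsIntegral T.B := T.isIntegral

instance : IsDominant T.p :=
  let h := exists_notMem_support T.isFlag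
  T.isBlowup.isDominant h.choose h.choose_spec

/-- `H⁰(B, 𝒪_B(k Π^*p_1^*(-K_X) - r E))`; for `r = k s` this is `H⁰(B, 𝒪_B(k 𝓛))`. -/
def sections {n : ℕ} (ω : RatForm K X n) (k r : ℕ) : Submodule K (Cyl X).functionField :=
  bundleSections ω (tExpansion M I) T.p k r

/-- `𝓛 = Π^*p_1^*(-K_X) - s E` is semiample over `𝔸¹`: for some `k > 0` the divisor `k 𝓛` is Cartier
and `𝒪_B(k 𝓛)` is generated by its global sections (`𝔸¹` being affine). -/
def IsSemiample {n : ℕ} (ω : RatForm K X n) (s : ℚ) : Prop :=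
  ∃ k r : ℕ, 0 < k ∧ (r : ℚ) = k * s ∧ IsCartier ω k ∧ ∀ b : T.B, ∃ f ∈ T.sections ω k r,
    bundleStalk ω (tExpansion M I) T.p k r b = Submodule.span _ {pullFun T.p f}

/-- `(B, 𝓛)/𝔸¹` is a normal `ℚ`-semi test configuration of `(X, -K_X)`. -/
structure IsSemiTestConfiguration {n : ℕ} (ω : RatForm K X n) (s : ℚ) : Prop where
  s_pos : 0 < s
  normal : IsNormal T.B
  not_isIso : ¬ IsIso T.p
  semiample : T.IsSemiample ω s

end FlagBlowup

/-! ### Total weights -/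

variable (X) in
/-- The coordinate `t` as a rational function on `X × 𝔸¹`. -/
def tFun : (Cyl X).functionField := 
  (Cyl X).presheaf.germ ⊤ (genericPoint (Cyl X)) (TopologicalSpace.Opens.mem_top _) (Cyl.t X)

/-- The action of `a ∈ 𝔾_m` on rational functions on `X × 𝔸¹`, `(a · f)(x, t) = f(x, a⁻¹ t)`. -/
def rot (a : Kˣ) : (Cyl X).functionField →+* (Cyl X).functionField := pullFun (Cyl.act X a⁻¹)

/-- Multiplication by `t`. -/
def tMul (H : Submodule K (Cyl X).functionField) : Submodule K (Cyl X).functionField :=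
  H.map (LinearMap.mulLeft K (tFun X))

/-- Let `H` be a `𝔾_m`-invariant space of rational functions on `X × 𝔸¹` that is a `K[t]`-module.
The action of `𝔾_m` on the fibre `H / t H` at `0` has total weight `w`: there is a finite basis of
eigenvectors, on which `a` acts by `a ^ (l i)`, and `w` is the sum of the weights `l i`. -/
def HasTotalWeight (H : Submodule K (Cyl X).functionField) (w : ℤ) : Prop :=
  ∃ (d : ℕ) (e : Module.Basis (Fin d) K (H ⧸ (tMul H).submoduleOf H)) (l : Fin d → ℤ),
    (∀ i, ∃ f : H, Submodule.Quotient.mk f = e i ∧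
      ∀ a : Kˣ, rot a (f : (Cyl X).functionField) - ((a ^ l i : Kˣ) : K) • f.1 ∈ tMul H) ∧
    ∑ i, l i = w

end TestConfiguration

/-! ### The filtration, the determinant divisor, and the ideals `J_j` -/

section Filtration

variable {K : Type u} [Field K] {X : Scheme.{u}} [X.Over (Spec (.of K))] [IsIntegral X]

/-- `𝓕_j = H⁰(X, 𝒪_X(-k K_X) · Ĩ_j)`. -/
def filt {n : ℕ} (ω : RatForm K X n) (k M : ℕ) (I : ℕ → X.IdealSheafData) (r j : ℕ) :
    Submodule K X.functionField :=
  globalSections K fun x => antiCan ω k x * fracStalk (tilde M I r j) x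

variable (K X) in
/-- The product `X^N` over `K`. -/
abbrev PowVar (N : ℕ) : Scheme.{u} :=
  widePullback (Spec (.of K)) (fun _ : Fin N => X) (fun _ => X ↘ Spec (.of K))

variable (K X) in
/-- The `i`-th projection `X^N ⟶ X`. -/
abbrev PowVar.proj (N : ℕ) (i : Fin N) : PowVar K X N ⟶ X :=
  WidePullback.π (fun _ : Fin N => X ↘ Spec (.of K)) i

/-- `h` is a local equation at `z ∈ X^N` of the determinant divisor of the basis `σ_1, …, σ_N` of
`H⁰(X, 𝒪_X(-k K_X))`, i.e. of the pull-back of the divisor `det (x_{ij}) = 0` on `(ℙ^{N-1})^N` under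
the `N`-th power of the morphism `(σ_1 : ⋯ : σ_N)`: if `g_i` generates `𝒪_X(-k K_X)` at the point
`z_i = p_i(z)`, then `h = det (p_i^* (σ_j / g_i))`. -/
def IsDetEquation {n N : ℕ} (ω : RatForm K X n) (k : ℕ)
    (σ : Module.Basis (Fin N) K (antiSections ω k)) (z : PowVar K X N)
    (h : (PowVar K X N).presheaf.stalk z) : Prop :=
  ∃ (g : Fin N → X.functionField)
    (c : ∀ i : Fin N, Fin N → X.presheaf.stalk (PowVar.proj K X N i z)),
    (∀ i, g i ≠ 0 ∧ antiCan ω k (PowVar.proj K X N i z) = Submodule.span _ {g i}) ∧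
    (∀ i j, (σ j : X.functionField) = algebraMap _ X.functionField (c i j) * g i) ∧
    h = Matrix.det (Matrix.of fun i j => (PowVar.proj K X N i).stalkMap z (c i j))

/-- The stalk at `z` of the ideal sheaf `𝒪_{X^N}(-D_k)` of the determinant divisor. -/
def detIdeal {n N : ℕ} (ω : RatForm K X n) (k : ℕ)
    (σ : Module.Basis (Fin N) K (antiSections ω k)) (z : PowVar K X N) :
    Ideal ((PowVar K X N).presheaf.stalk z) :=
  Ideal.span {h | IsDetEquation ω k σ z h}

variable (K) in
/-- `J_j`, the sum of the products `p_1⁻¹ Ĩ_{j_1} ⋯ p_N⁻¹ Ĩ_{j_N}` with `j_1 + ⋯ + j_N = j` and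
`0 ≤ j_i ≤ M r`. -/
def prodSum (N M : ℕ) (I : ℕ → X.IdealSheafData) (r j : ℕ) : (PowVar K X N).IdealSheafData :=
  ∑ a : Fin N → Fin (M * r + 1) with ∑ i, (a i : ℕ) = j,
    ∏ i, (tilde M I r (a i)).comap (PowVar.proj K X N i)

end Filtration

end FlagIdeal

end

/-! Write `r = ks`. Everything rests on one identification: for `r` large, `H⁰(B, k𝓛)` consists of
the polynomials `∑ f_i t^i` with `f_i ∈ 𝓕_{Mr-i}`, where `Mr-i` is read as `0` once `i ≥ Mr`
(`FlagBlowup.mem_sections_iff`). Since `𝓘^r = ∑ Ĩ_j t^{Mr-j}` (`tExpansion_pow`), the point is that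
a rational function lying in `𝓘^r 𝒪_B` everywhere on `B` already lies in `𝓘^r`.

Over an affine chart with ring `R` and ideal `I`, the universal property of the blowing up puts such
a function `x` in `f^r R[I/f]` for every `f ∈ I` (`IsBlowup.exists_mul_pow_eq`), and a pigeonhole
argument gives `x I^E ⊆ I^{E+r}` for some `E` (`isPowMultiplier_of_forall`). Then `x T^r` is
integral over the Rees algebra of `I`. By finiteness of integral closure in characteristic zero, all
such elements span a finitely generated module over it, and past a bound read off from the
generators they satisfy `x ∈ I^r` (`exists_forall_isPowMultiplier`). Finitely many charts cover `X`,
so one bound suffices; `k₀` is chosen to exceed it.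

Now take a basis `β_1, …, β_N` of `𝓕_0` adapted to the filtration, with jumps `v_i`; then `m = ∑ dim
𝓕_j = ∑ v_i`. The classes of `β_i t^{Mr-v_i}` form a basis of `H/tH`, of weights `-(Mr-v_i)`, whence
`w = m - NMr` (`hasTotalWeight_of_isAdapted`). The determinant of any basis of sections is a
constant multiple of that of `β`, and each Leibniz term `∏ p_i^* β_{π(i)}` of the latter lies in `∏
p_i⁻¹ Ĩ_{v_{π(i)}}`, whose indices add up to `m` (`detIdeal_le_of_isAdapted`).

Two facts about `-kK_X` are also needed. Powers of finitely many sections generate all multiples of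
a suitable `-k₁K_X` (`IsQFano.exists_generating_cover`), by regularity in codimension one. The
sections form a finite-dimensional space (`finite_antiSections`): along every valuation a section is
an integral multiple of one of the generators, and finiteness of integral closure applies again. -/

noncomputable section

namespace FlagIdeal

/-! ### Finiteness of integral closure in finitely generated fields -/

section FieldExtensions

open Polynomial

open IntermediateField in
open scoped IntermediateField.algebraAdjoinAdjoin in
/-- The algebraic closure of a field in a finitely generated extension is finite. -/
theorem finiteDimensional_algebraicClosure (F L : Type*) [Field F] [Field L] [Algebra F L]
    [Algebra.EssFiniteType F L] : FiniteDimensional F (algebraicClosure F L) := by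
  obtain ⟨s, hs⟩ := exists_isTranscendenceBasis F L
  have halg : Algebra.IsAlgebraic (adjoin F s) L := by
    have := hs.isAlgebraic_field
    rwa [Subtype.range_coe] at this
  have : Algebra.EssFiniteType (adjoin F s) L := .of_comp F _ L
  have hfd : FiniteDimensional (adjoin F s) L := by
    have h := fg_top (adjoin F s) L
    obtain ⟨t, ht⟩ := h
    have : FiniteDimensional (adjoin F s) (adjoin (adjoin F s) (t : Set L)) :=
      finiteDimensional_adjoin fun x _ => (halg.isAlgebraic x).isIntegral
    rw [ht] at this
    exact Module.Finite.equiv (topEquiv (F := adjoin F s) (E := L)).toLinearEquiv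
  have hind := hs.1.algebraicClosure
  -- linear independence over `F` implies linear independence over `F(s)`
  have key : ∀ (n : ℕ) (v : Fin n → algebraicClosure F L), LinearIndependent F v →
      LinearIndependent (adjoin F s) fun i => (v i : L) := by
    intro n v hv
    have h1 : LinearIndependent (Algebra.adjoin F s) fun i => (v i : L) := by
      rw [Fintype.linearIndependent_iff]
      intro c hc i
      have hq : ∀ i, ∃ q : MvPolynomial s F, MvPolynomial.aeval ((↑) : s → L) q = (c i : L) := by
        intro i
        have h : (c i : L) ∈ (MvPolynomial.aeval (R := F) ((↑) : s → L)).range := by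
          rw [← Algebra.adjoin_range_eq_range_aeval, Subtype.range_coe]
          exact (c i).2
        exact h
      choose q hq using hq
      -- The transcendence basis `s` stays algebraically independent over the algebraic closure of
      -- `F` in `L`. So a relation with polynomial coefficients in `s` vanishes monomial by
      -- monomial, and each monomial gives an `F`-linear relation among the `v i`.
      have h0 : ∑ i, MvPolynomial.C (v i) *
          MvPolynomial.map (algebraMap F (algebraicClosure F L)) (q i) = 0 := by
        apply hind.eq_zero_of_aeval_eq_zero
        rw [map_sum, ← hc]
        refine Finset.sum_congr rfl fun j _ => ?_
        rw [map_mul, MvPolynomial.aeval_C, MvPolynomial.aeval_map_algebraMap, hq, Algebra.smul_def,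
          mul_comm]
        rfl
      have hz : q i = 0 := by
        ext m
        have h2 := congr_arg (MvPolynomial.coeff m) h0
        simp only [MvPolynomial.coeff_sum, MvPolynomial.coeff_C_mul, MvPolynomial.coeff_map,
          MvPolynomial.coeff_zero] at h2
        refine Fintype.linearIndependent_iff.mp hv (fun i => (q i).coeff m) ?_ i
        rw [← h2]
        exact Finset.sum_congr rfl fun j _ => by rw [Algebra.smul_def, mul_comm]
      ext
      rw [← hq i, hz, map_zero]
      rfl
    exact h1.localization (adjoin F s) (nonZeroDivisors _)
  let b := Module.Basis.ofVectorSpace F (algebraicClosure F L)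
  by_cases hfin : Finite (Module.Basis.ofVectorSpaceIndex F (algebraicClosure F L))
  · exact Module.Finite.of_basis b
  · rw [not_finite_iff_infinite] at hfin
    let e := Infinite.natEmbedding (Module.Basis.ofVectorSpaceIndex F (algebraicClosure F L))
    -- One vector more than the degree of `L` over `F(s)` allows.
    let n := Module.finrank (adjoin F s) L + 1
    have h := key n (fun i => b (e i)) (b.linearIndependent.comp (fun i : Fin n => e i)
      (e.injective.comp Fin.val_injective))
    have := h.fintype_card_le_finrank
    simp [n] at this

/-- The integral closure of a finitely generated domain over a field of characteristic zero in a
finitely generated field is finite. -/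
theorem finite_integralClosure (K A L : Type*) [Field K] [CharZero K] [CommRing A] [IsDomain A]
    [Algebra K A] [Algebra.FiniteType K A] [Field L] [Algebra K L] [Algebra A L]
    [IsScalarTower K A L] [FaithfulSMul A L] [Algebra.EssFiniteType K L] :
    Module.Finite A (integralClosure A L) := by
  obtain ⟨s, g, hinj, hfin⟩ := exists_finite_inj_algHom_of_fg K A
  let P := MvPolynomial (Fin s) K
  let : Algebra P A := g.toRingHom.toAlgebra
  let : Algebra P L := ((algebraMap A L).comp g.toRingHom).toAlgebra
  have : IsScalarTower P A L := .of_algebraMap_eq fun _ => rfl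
  have : Module.Finite P A := hfin
  have hPL : Function.Injective (algebraMap P L) :=
    (FaithfulSMul.algebraMap_injective A L).comp hinj
  have : FaithfulSMul P L := (faithfulSMul_iff_algebraMap_injective P L).mpr hPL
  have : IsScalarTower K P L := .of_algebraMap_eq fun x => by
    change _ = algebraMap A L (g (algebraMap K P x))
    rw [AlgHom.commutes, ← IsScalarTower.algebraMap_apply]
  let F := FractionRing P
  let : Algebra F L := FractionRing.liftAlgebra P L
  have : IsScalarTower P F L := FractionRing.isScalarTower_liftAlgebra P L
  have : IsScalarTower K F L := .of_algebraMap_eq fun x => by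
    rw [IsScalarTower.algebraMap_apply K P L, IsScalarTower.algebraMap_apply P F L,
      ← IsScalarTower.algebraMap_apply K P F]
  have : Algebra.EssFiniteType F L := .of_comp K F L
  have := finiteDimensional_algebraicClosure F L
  -- `L` may be transcendental over `F`, but elements integral over `A` are integral over `P`, hence
  -- lie in `L'`, which is finite over `F` and separable in characteristic zero.
  let L' := algebraicClosure F L
  have : CharZero F := charZero_of_injective_algebraMap (algebraMap K F).injective
  have hnoeth : IsNoetherian P (integralClosure P L') :=
    IsIntegralClosure.isNoetherian P F L' (integralClosure P L')
  have hmem : ∀ x : integralClosure A L, (x : L) ∈ L' ∧ IsIntegral P (x : L) := fun x => by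
    have h : IsIntegral P (x : L) := isIntegral_trans (R := P) (A := A) _ x.2
    exact ⟨mem_algebraicClosure_iff.mpr h.tower_top.isAlgebraic, h⟩
  let φ : integralClosure A L →ₗ[P] integralClosure P L' :=
    { toFun x := ⟨⟨x, (hmem x).1⟩, (isIntegral_algHom_iff (L'.val.restrictScalars P)
        Subtype.val_injective).mp (hmem x).2⟩
      map_add' _ _ := rfl
      map_smul' c x := by
        ext
        change ((c • x : integralClosure A L) : L) = ((c • _ : L') : L)
        rw [Algebra.smul_def c (⟨x, _⟩ : L')]
        rw [← IsScalarTower.algebraMap_smul A c x]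
        change algebraMap P A c • (x : L) = _
        rw [IsScalarTower.algebraMap_smul, Algebra.smul_def]
        rfl }
  have hφ : Function.Injective φ := fun x y h => by
    ext
    exact congr_arg (fun z : integralClosure P L' => ((z : L') : L)) h
  have : Module.Finite P (integralClosure A L) := Module.Finite.of_injective φ hφ
  exact Module.Finite.of_restrictScalars_finite P A _

end FieldExtensions

/-- A set of integral elements generates a finite module. -/
theorem fg_span_of_isIntegral (K : Type*) {A D : Type*} [Field K] [CharZero K] [CommRing A]
    [IsDomain A] [Algebra K A] [Algebra.FiniteType K A] [CommRing D] [IsDomain D] [Algebra K D]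
    [Algebra A D] [IsScalarTower K A D] [FaithfulSMul A D] [Algebra.EssFiniteType K D] {S : Set D}
    (hS : ∀ x ∈ S, IsIntegral A x) : (Submodule.span A S).FG := by
  let F := FractionRing D
  have : Algebra.EssFiniteType K F := .comp K D F
  have : FaithfulSMul A F := .trans A D F
  have := finite_integralClosure K A F
  have : IsNoetherianRing A := Algebra.FiniteType.isNoetherianRing K A
  have hnoeth : IsNoetherian A (integralClosure A F) :=
    isNoetherian_of_isNoetherianRing_of_finite _ _
  let φ : D →ₗ[A] F := (IsScalarTower.toAlgHom A D F).toLinearMap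
  refine Submodule.fg_of_fg_map_injective φ (IsFractionRing.injective D F) ?_
  refine (isNoetherian_submodule (N := Subalgebra.toSubmodule (integralClosure A F))).mp hnoeth _ ?_
  rw [Submodule.map_span_le]
  exact fun x hx => (hS x hx).algebraMap

/-! ### Multipliers of powers of an ideal (Ratliff-Rush closure) -/

section RatliffRush
open Polynomial

variable {R L : Type*} [CommRing R] [Field L] [Algebra R L]

/-- Some power `I ^ E` satisfies `x I ^ E ⊆ I ^ (E + r)`. -/
def IsPowMultiplier (I : Ideal R) (r : ℕ) (x : L) : Prop :=
  ∃ E : ℕ, ∀ a ∈ I ^ E, ∃ b ∈ I ^ (E + r), x * algebraMap R L a = algebraMap R L b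

lemma IsPowMultiplier.exists_forall {I : Ideal R} {r : ℕ} {x : L} (h : IsPowMultiplier I r x) :
    ∃ E₀, ∀ E ≥ E₀, ∀ a ∈ I ^ E, ∃ b ∈ I ^ (E + r), x * algebraMap R L a = algebraMap R L b := by
  obtain ⟨E₀, hE⟩ := h
  refine ⟨E₀, fun E hEE a ha => ?_⟩
  obtain ⟨d, rfl⟩ := Nat.exists_eq_add_of_le hEE
  rw [pow_add] at ha
  refine Submodule.mul_induction_on ha (fun a ha c hc => ?_) ?_
  · obtain ⟨b, hb, h⟩ := hE a ha
    refine ⟨b * c, ?_, by rw [map_mul, ← mul_assoc, h, map_mul]⟩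
    rw [add_right_comm, pow_add]
    exact Ideal.mul_mem_mul hb hc
  · rintro a c ⟨b, hb, h⟩ ⟨b', hb', h'⟩
    exact ⟨b + b', add_mem hb hb', by rw [map_add, mul_add, h, h', map_add]⟩

variable [FaithfulSMul R L]

/-- Determinant trick: let `N` be the ideal of the Rees algebra generated by `I^E T^E`.
Multiplication by `x T^r` sends it into itself, because `x I^E ⊆ I^{E+r} = I^E I^r`; and `N` is
finitely generated and nonzero. -/
lemma IsPowMultiplier.isIntegral [IsNoetherianRing R] {I : Ideal R} (hI : I ≠ ⊥) {r : ℕ} {x : L}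
    (h : IsPowMultiplier I r x) : letI := (Polynomial.mapRingHom (algebraMap R L)).toAlgebra
    IsIntegral (reesAlgebra I) (monomial r x : L[X]) := by
  let := (Polynomial.mapRingHom (algebraMap R L)).toAlgebra
  obtain ⟨E, hE⟩ := h
  obtain ⟨a₀, ha₀, hne⟩ := Submodule.exists_mem_ne_zero_of_ne_bot hI
  have hinj : Function.Injective (algebraMap R L) := FaithfulSMul.algebraMap_injective R L
  have halg : ∀ u : reesAlgebra I,
      algebraMap (reesAlgebra I) L[X] u = (u : R[X]).map (algebraMap R L) := fun _ => rfl
  have : FaithfulSMul (reesAlgebra I) L[X] := (faithfulSMul_iff_algebraMap_injective _ _).mpr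
    fun u v h => Subtype.ext (Polynomial.map_injective _ hinj h)
  have : Algebra.FiniteType R (reesAlgebra I) :=
    (reesAlgebra I).fg_iff_finiteType.mp (reesAlgebra.fg (IsNoetherian.noetherian I))
  have : IsNoetherianRing (reesAlgebra I) := Algebra.FiniteType.isNoetherianRing R _
  let N : Ideal (reesAlgebra I) := Ideal.span
    {u | ∃ a ∈ I ^ E, (u : R[X]) = monomial E a}
  refine isIntegral_of_smul_mem_submodule (M := L[X])
    (Submodule.map (Algebra.linearMap (reesAlgebra I) L[X]) N) ?_ ?_ _ ?_
  · rw [Submodule.ne_bot_iff]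
    let u : reesAlgebra I := ⟨monomial E (a₀ ^ E),
      reesAlgebra.monomial_mem.mpr (Ideal.pow_mem_pow ha₀ E)⟩
    refine ⟨_, ⟨u, Ideal.subset_span ⟨_, Ideal.pow_mem_pow ha₀ E, rfl⟩, rfl⟩, ?_⟩
    rw [Algebra.linearMap_apply, halg]
    simp [u, hne]
  · exact (IsNoetherian.noetherian N).map _
  · rintro _ ⟨u, hu, rfl⟩
    rw [Algebra.linearMap_apply]
    induction hu using Submodule.span_induction with
    | mem u hu =>
      obtain ⟨a, ha, hu⟩ := hu
      obtain ⟨b, hb, h⟩ := hE a ha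
      rw [halg, hu, smul_eq_mul, map_monomial, monomial_mul_monomial, h, add_comm r E]
      clear h
      rw [pow_add] at hb
      refine Submodule.mul_induction_on hb (fun a ha c hc => ?_) ?_
      · let v : reesAlgebra I := ⟨monomial E a, reesAlgebra.monomial_mem.mpr ha⟩
        let w : reesAlgebra I := ⟨monomial r c, reesAlgebra.monomial_mem.mpr hc⟩
        refine ⟨v * w, N.mul_mem_right _ (Ideal.subset_span ⟨a, ha, rfl⟩), ?_⟩
        rw [Algebra.linearMap_apply, halg]
        simp [v, w, monomial_mul_monomial]
      · intro a b ha hb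
        rw [map_add, map_add]
        exact add_mem ha hb
    | zero => simp
    | add u v _ _ hu hv =>
      rw [map_add, smul_add]
      exact add_mem hu hv
    | smul c u _ hu =>
      rw [smul_eq_mul c u, map_mul, ← Algebra.smul_def, smul_comm]
      exact Submodule.smul_mem _ _ hu

/-- For large `r`, the multipliers of powers of `I` into `r` steps higher powers
form `I ^ r`. -/
theorem exists_forall_isPowMultiplier [IsDomain R] (K : Type*) [Field K] [CharZero K] [Algebra K R]
    [Algebra.FiniteType K R] [Algebra K L] [IsScalarTower K R L] [Algebra.EssFiniteType K L]
    {I : Ideal R} (hI : I ≠ ⊥) : ∃ r₀, ∀ r ≥ r₀, ∀ x : L, IsPowMultiplier I r x →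
      ∃ b ∈ I ^ r, x = algebraMap R L b := by
  let := (Polynomial.mapRingHom (algebraMap R L)).toAlgebra
  have hinj : Function.Injective (algebraMap R L) := FaithfulSMul.algebraMap_injective R L
  have halg : ∀ u : reesAlgebra I,
      algebraMap (reesAlgebra I) L[X] u = (u : R[X]).map (algebraMap R L) := fun _ => rfl
  have hfaith : Function.Injective (algebraMap (reesAlgebra I) L[X]) :=
    fun u v h => Subtype.ext (Polynomial.map_injective _ hinj h)
  have : FaithfulSMul (reesAlgebra I) L[X] :=
    (faithfulSMul_iff_algebraMap_injective _ _).mpr hfaith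
  have : IsNoetherianRing R := Algebra.FiniteType.isNoetherianRing K R
  have : Algebra.FiniteType R (reesAlgebra I) :=
    (reesAlgebra I).fg_iff_finiteType.mp (reesAlgebra.fg (IsNoetherian.noetherian I))
  have : Algebra.FiniteType K (reesAlgebra I) := .trans (S := R) inferInstance inferInstance
  have : IsScalarTower K (reesAlgebra I) L[X] := .of_algebraMap_eq fun x => by
    rw [halg]
    change C (algebraMap K L x) = Polynomial.map _ (C (algebraMap K R x))
    rw [map_C, ← IsScalarTower.algebraMap_apply]
  have : Algebra.EssFiniteType L L[X] := inferInstance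
  have : Algebra.EssFiniteType K L[X] := .comp K L L[X]
  let S : Set L[X] := {p | ∃ r x, IsPowMultiplier I r x ∧ p = monomial r x}
  have hS : (Submodule.span (reesAlgebra I) S).FG := by
    refine fg_span_of_isIntegral K ?_
    rintro _ ⟨r, x, h, rfl⟩
    exact h.isIntegral hI
  obtain ⟨t, htS, ht⟩ := (Submodule.fg_span_iff_fg_span_finset_subset S).mp hS
  have h1 : ∀ p ∈ t, ∃ D, ∃ r ≤ D, ∃ x, p = monomial r x ∧ ∀ E, D ≤ E + r → ∀ a ∈ I ^ E,
      ∃ b ∈ I ^ (E + r), x * algebraMap R L a = algebraMap R L b := by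
    intro p hp
    obtain ⟨r, x, h, rfl⟩ := htS hp
    obtain ⟨E₀, hE⟩ := h.exists_forall
    exact ⟨E₀ + r, r, by omega, x, rfl, fun E h => hE E (by omega)⟩
  choose! D hD using h1
  refine ⟨t.sup D, fun r hr x hx => ?_⟩
  have hmem : (monomial r x : L[X]) ∈ Submodule.span (reesAlgebra I) (t : Set L[X]) := by
    rw [← ht]
    exact Submodule.subset_span ⟨r, x, hx, rfl⟩
  obtain ⟨c, hc⟩ := Submodule.mem_span_finset.mp hmem
  have hcoeff : ∀ p ∈ t, ∃ b ∈ I ^ r, (c p • p).coeff r = algebraMap R L b := by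
    intro p hp
    obtain ⟨d, hd, y, hpy, h⟩ := hD p hp
    have hDr : D p ≤ r := (Finset.le_sup hp).trans hr
    obtain ⟨e, rfl⟩ := Nat.exists_eq_add_of_le (hd.trans hDr)
    obtain ⟨b, hb, hb'⟩ := h e (by omega) ((c p : R[X]).coeff e)
      ((mem_reesAlgebra_iff I _).mp (c p).2 e)
    refine ⟨b, by rwa [add_comm], ?_⟩
    rw [Algebra.smul_def, halg, ← hb', hpy, add_comm d e, coeff_mul_monomial, coeff_map, mul_comm]
  have h2 : x = ∑ p ∈ t, (c p • p).coeff r := by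
    rw [← finsetSum_coeff, hc.2, coeff_monomial, if_pos rfl]
  choose! b hb using hcoeff
  refine ⟨∑ p ∈ t, b p, sum_mem fun p hp => (hb p hp).1, ?_⟩
  rw [h2, map_sum]
  exact Finset.sum_congr rfl fun p hp => (hb p hp).2

end RatliffRush

/-! ### Affine charts of a blowing up -/

section Chart

variable {R L : Type*} [CommRing R] [Field L] [Algebra R L]

variable (L) in
/-- The affine chart `R[I/f]` of the blowing up of `Spec R` along `I`. -/
def blowupChart (I : Ideal R) {f : R} (hf : f ∈ I) : Subalgebra R L where
  carrier := {c | ∃ E : ℕ, ∃ b ∈ I ^ E, c * algebraMap R L f ^ E = algebraMap R L b}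
  mul_mem' := by
    rintro c c' ⟨E, b, hb, h⟩ ⟨E', b', hb', h'⟩
    refine ⟨E + E', b * b', pow_add I E E' ▸ Ideal.mul_mem_mul hb hb', ?_⟩
    rw [map_mul, ← h, ← h', pow_add]
    ring
  add_mem' := by
    rintro c c' ⟨E, b, hb, h⟩ ⟨E', b', hb', h'⟩
    refine ⟨E + E', b * f ^ E' + f ^ E * b', add_mem ?_ ?_, ?_⟩
    · exact pow_add I E E' ▸ Ideal.mul_mem_mul hb (Ideal.pow_mem_pow hf E')
    · exact pow_add I E E' ▸ Ideal.mul_mem_mul (Ideal.pow_mem_pow hf E) hb'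
    · rw [map_add, map_mul, map_mul, ← h, ← h', pow_add, map_pow, map_pow]
      ring
  algebraMap_mem' r := ⟨0, r, by simp, by simp⟩

/-- For `a ∈ I` the quotient `a/f` belongs to the chart, and `a = (a/f) f`. -/
lemma map_blowupChart (I : Ideal R) {f : R} (hf : f ∈ I) (hf0 : algebraMap R L f ≠ 0) :
    I.map (algebraMap R (blowupChart L I hf)) = Ideal.span {algebraMap R (blowupChart L I hf) f} := by
  refine le_antisymm (Ideal.map_le_iff_le_comap.mpr fun a ha => ?_) ?_
  · have hc : algebraMap R L a / algebraMap R L f ∈ blowupChart L I hf :=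
      ⟨1, a, by simpa using ha, by rw [pow_one, div_mul_cancel₀ _ hf0]⟩
    refine Ideal.mem_span_singleton'.mpr ⟨⟨_, hc⟩, Subtype.ext ?_⟩
    exact div_mul_cancel₀ _ hf0
  · rw [Ideal.span_singleton_le_iff_mem]
    exact Ideal.mem_map_of_mem _ hf

/-- Membership in a principal ideal can be checked locally. -/
lemma exists_eq_mul_of_forall_prime {C : Type*} [CommRing C] [Algebra C L] (f : C) (x : L)
    (h : ∀ P : Ideal C, P.IsPrime → ∃ s ∉ P, ∃ c, algebraMap C L s * x = algebraMap C L (f * c)) :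
    ∃ c, x = algebraMap C L (f * c) := by
  let J : Ideal C := (Submodule.map (Algebra.linearMap C L) (Ideal.span {f})).comap
    (LinearMap.toSpanSingleton C L x)
  -- `J` is the ideal of those `s` with `s x ∈ f C`; by hypothesis no maximal ideal contains it.
  have hJ : J = ⊤ := by
    by_contra hne
    obtain ⟨P, hP, hle⟩ := Ideal.exists_le_maximal J hne
    obtain ⟨s, hs, c, hc⟩ := h P hP.isPrime
    refine hs (hle ⟨f * c, Ideal.mul_mem_right _ _ (Ideal.mem_span_singleton_self f), ?_⟩)
    rw [Algebra.linearMap_apply, ← hc, LinearMap.toSpanSingleton_apply, Algebra.smul_def]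
  obtain ⟨y, hy, h1⟩ := (Ideal.eq_top_iff_one J).mp hJ
  obtain ⟨c, rfl⟩ := Ideal.mem_span_singleton'.mp hy
  refine ⟨c, ?_⟩
  rw [LinearMap.toSpanSingleton_apply, one_smul] at h1
  rw [← h1, mul_comm, Algebra.linearMap_apply]

/-- Pigeonhole: take an exponent `e` that works for all of finitely many generators. A monomial of
degree `card * e + 1` in them contains some `f ^ e`, and `x` carries this factor into `I ^ (e + r)`.
-/
lemma isPowMultiplier_of_forall {I : Ideal R} (hI : I.FG) {r : ℕ} {x : L}
    (h : ∀ f ∈ I, ∃ E, ∃ b ∈ I ^ (E + r), x * algebraMap R L f ^ E = algebraMap R L b) :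
    IsPowMultiplier I r x := by
  classical
  obtain ⟨t, ht⟩ := hI
  have htI : ∀ f ∈ t, f ∈ I := fun f hf => ht ▸ Ideal.subset_span hf
  choose! E hE using fun f hf => h f (htI f hf)
  let e := t.sup E + 1
  have he : ∀ f ∈ t, ∃ b ∈ I ^ (e + r), x * algebraMap R L f ^ e = algebraMap R L b := by
    intro f hf
    obtain ⟨b, hb, h⟩ := hE f hf
    obtain ⟨d, hd⟩ := Nat.exists_eq_add_of_le
      ((Finset.le_sup (f := E) hf).trans (Nat.le_succ _) : E f ≤ e)
    refine ⟨b * f ^ d, ?_, ?_⟩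
    · rw [hd, add_right_comm, pow_add I _ d]
      exact Ideal.mul_mem_mul hb (Ideal.pow_mem_pow (htI f hf) d)
    · rw [hd, pow_add, ← mul_assoc, h, map_mul, map_pow]
  let n := t.card * e + 1
  let Q : Ideal R := (Submodule.map (Algebra.linearMap R L) (I ^ (n + r))).comap
    (LinearMap.toSpanSingleton R L x)
  have hQ : ∀ a, a ∈ Q ↔ ∃ b ∈ I ^ (n + r), x * algebraMap R L a = algebraMap R L b := fun a => by
    simp only [Q, Submodule.mem_comap, Submodule.mem_map, LinearMap.toSpanSingleton_apply,
      Algebra.smul_def, Algebra.linearMap_apply, mul_comm x]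
    exact exists_congr fun b => and_congr_right fun _ => eq_comm
  suffices hle : I ^ n ≤ Q from ⟨n, fun a ha => (hQ a).mp (hle ha)⟩
  have hsum : I = ∑ f ∈ t, Ideal.span {f} := by
    rw [← ht, Ideal.sum_eq_sup, Finset.sup_eq_iSup]
    exact (Submodule.span_eq_iSup_of_singleton_spans _).trans (by simp)
  conv_lhs => rw [hsum, Finset.sum_pow_eq_sum_piAntidiag]
  rw [Ideal.sum_eq_sup]
  refine Finset.sup_le fun k hk => Ideal.mul_le_right.trans ?_
  rw [Finset.prod_congr rfl fun i _ => Ideal.span_singleton_pow i (k i),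
    Ideal.prod_span_singleton, Ideal.span_singleton_le_iff_mem, hQ]
  obtain ⟨hk, -⟩ := Finset.mem_piAntidiag.mp hk
  obtain ⟨f, hf, hlt⟩ : ∃ f ∈ t, e ≤ k f := by
    by_contra! hcon
    have := Finset.sum_le_card_nsmul t k e fun f hf => (hcon f hf).le
    simp only [smul_eq_mul] at this
    omega
  obtain ⟨b, hb, h⟩ := he f hf
  obtain ⟨d, hd⟩ := Nat.exists_eq_add_of_le hlt
  refine ⟨b * (f ^ d * ∏ f' ∈ t.erase f, f' ^ k f'), ?_, ?_⟩
  · have hn : n + r = (e + r) + (d + ∑ f' ∈ t.erase f, k f') := by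
      rw [← hk, ← Finset.add_sum_erase t k hf, hd]
      ring
    rw [hn, pow_add I (e + r), pow_add I d, ← Finset.prod_pow_eq_pow_sum]
    refine Ideal.mul_mem_mul hb (Ideal.mul_mem_mul (Ideal.pow_mem_pow (htI f hf) d) ?_)
    exact Ideal.prod_mem_prod fun f' hf' =>
      Ideal.pow_mem_pow (htI f' (Finset.mem_of_mem_erase hf')) _
  · rw [← Finset.mul_prod_erase t _ hf, hd, pow_add, mul_assoc, map_mul, ← mul_assoc, map_pow, h,
      ← map_mul]

end Chart

/-! ### Regularity in codimension one and simple poles -/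

section Hartogs

variable {R L : Type*} [CommRing R] [IsDomain R] [IsNoetherianRing R] [Field L] [Algebra R L]
  [IsFractionRing R L]

/-- On a normal noetherian domain, a fraction is regular at `P` if it is regular at the
codimension one points specializing to `P`. -/
theorem exists_mul_eq_of_forall_isDiscreteValuationRing [IsIntegrallyClosed R] (P : Ideal R)
    [P.IsPrime] (x : L)
    (h : ∀ (q : Ideal R) [q.IsPrime], q ≤ P → IsDiscreteValuationRing (Localization.AtPrime q) →
      ∃ s ∉ q, ∃ a, x * algebraMap R L s = algebraMap R L a) :
    ∃ s ∉ P, ∃ a, x * algebraMap R L s = algebraMap R L a := by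
  by_contra! hcon
  -- `𝔞 y` is the ideal of denominators of `x y`. If `x` were not regular at `P`, then `𝔞 1 ≤ P`,
  -- and a maximal member among the `𝔞 y` inside `P` will be a prime of height one.
  let 𝔞 (y : R) : Ideal R := (Submodule.map (Algebra.linearMap R L) ⊤).comap
    (LinearMap.toSpanSingleton R L (x * algebraMap R L y))
  have h𝔞 : ∀ y s, s ∈ 𝔞 y ↔ ∃ a, x * algebraMap R L y * algebraMap R L s = algebraMap R L a := by
    intro y s
    simp only [𝔞, Submodule.mem_comap, Submodule.mem_map, LinearMap.toSpanSingleton_apply,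
      Algebra.smul_def, Algebra.linearMap_apply, Submodule.mem_top, true_and]
    exact exists_congr fun b => by rw [eq_comm, mul_comm]
  obtain ⟨_, ⟨y, rfl, hyP⟩, hmax⟩ := set_has_maximal_iff_noetherian.mpr ‹IsNoetherianRing R›
    {J | ∃ y, J = 𝔞 y ∧ J ≤ P} ⟨𝔞 1, 1, rfl, fun s hs => by
      by_contra hsP
      obtain ⟨a, ha⟩ := (h𝔞 1 s).mp hs
      exact hcon s hsP a (by simpa using ha)⟩
  have hle : ∀ c, 𝔞 y ≤ 𝔞 (c * y) := fun c s hs => by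
    obtain ⟨a, ha⟩ := (h𝔞 y s).mp hs
    refine (h𝔞 _ s).mpr ⟨c * a, ?_⟩
    rw [map_mul, map_mul, ← ha]
    ring
  have hmul : ∀ c s, s ∈ 𝔞 (c * y) ↔ s * c ∈ 𝔞 y := fun c s => by
    rw [h𝔞, h𝔞]
    exact exists_congr fun a => by rw [map_mul, map_mul]; ring_nf
  have hnotP : ∀ c ∉ P, 𝔞 (c * y) = 𝔞 y := fun c hc => by
    have h1 : 𝔞 (c * y) ≤ P := fun s hs =>
      (‹P.IsPrime›.mem_or_mem (hyP ((hmul c s).mp hs))).resolve_right hc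
    exact ((hle c).eq_of_not_lt (hmax _ ⟨_, rfl, h1⟩)).symm
  have hprime : (𝔞 y).IsPrime := by
    refine ⟨fun htop => ‹P.IsPrime›.ne_top (top_le_iff.mp (htop ▸ hyP)), fun {a b} hab => ?_⟩
    by_contra! hcon2
    obtain ⟨ha, hb⟩ := hcon2
    have h1 : ¬ 𝔞 (a * y) ≤ P := fun hP => by
      have := (hle a).eq_of_not_lt (hmax _ ⟨_, rfl, hP⟩)
      exact hb (this.ge ((hmul a b).mpr (by rwa [mul_comm])))
    obtain ⟨s, hs, hsP⟩ := SetLike.not_le_iff_exists.mp h1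
    rw [hmul, mul_comm, ← hmul, hnotP s hsP] at hs
    exact ha hs
  set q := 𝔞 y with hq
  set z := x * algebraMap R L y with hz
  have hinj : Function.Injective (algebraMap R L) := IsFractionRing.injective R L
  have hne : q ≠ ⊥ := by
    obtain ⟨a, s, hs, h⟩ := IsFractionRing.div_surjective (A := R) z
    refine fun hbot => nonZeroDivisors.ne_zero hs ((Submodule.mem_bot R).mp (hbot ▸ ?_))
    refine (h𝔞 _ s).mpr ⟨a, ?_⟩
    rw [← hz, ← h, div_mul_cancel₀]
    exact (map_ne_zero_iff _ hinj).mpr (nonZeroDivisors.ne_zero hs)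
  have hone : ∀ a, z ≠ algebraMap R L a := fun a ha =>
    hprime.ne_top ((Ideal.eq_top_iff_one _).mpr ((h𝔞 _ _).mpr ⟨a, by simpa using ha⟩))
  -- Either `z q ⊆ q`, so that `z` is integral and hence in `R`, which is excluded; or `z t = u`
  -- with `t ∈ q` and `u ∉ q`. In the second case `p u = (z p) t` for `p ∈ q`, so `t` generates the
  -- maximal ideal of the localization at `q`.
  by_cases hall : ∀ t ∈ q, ∃ u ∈ q, z * algebraMap R L t = algebraMap R L u
  · have hint : IsIntegral R z := by
      refine isIntegral_of_smul_mem_submodule (M := L)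
        (Submodule.map (Algebra.linearMap R L) q) ?_ ((IsNoetherian.noetherian q).map _) z ?_
      · obtain ⟨a, ha, h0⟩ := Submodule.exists_mem_ne_zero_of_ne_bot hne
        exact (Submodule.ne_bot_iff _).mpr ⟨_, ⟨a, ha, rfl⟩, (map_ne_zero_iff _ hinj).mpr h0⟩
      · rintro _ ⟨t, ht, rfl⟩
        obtain ⟨u, hu, h⟩ := hall t ht
        exact ⟨u, hu, h.symm⟩
    obtain ⟨a, ha⟩ := IsIntegrallyClosed.isIntegral_iff.mp hint
    exact hone a ha.symm
  · push Not at hall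
    obtain ⟨t, ht, hall⟩ := hall
    obtain ⟨u, hu⟩ := (h𝔞 y t).mp ht
    have huq : u ∉ q := fun h => hall u h hu
    have hdvr : IsDiscreteValuationRing (Localization.AtPrime q) := by
      have hfield : ¬ IsField (Localization.AtPrime q) := by
        obtain ⟨a, ha, h0⟩ := Submodule.exists_mem_ne_zero_of_ne_bot hne
        rw [IsLocalRing.isField_iff_maximalIdeal_eq]
        refine (Submodule.ne_bot_iff _).mpr ⟨algebraMap R _ a,
          (IsLocalization.AtPrime.to_map_mem_maximal_iff _ q a).mpr ha, ?_⟩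
        exact (map_ne_zero_iff _ (IsLocalization.injective _
          q.primeCompl_le_nonZeroDivisors)).mpr h0
      refine ((IsDiscreteValuationRing.TFAE (Localization.AtPrime q) hfield).out 4 0).mp ?_
      refine ⟨⟨algebraMap R _ t, le_antisymm ?_ ?_⟩⟩
      · rw [← Localization.AtPrime.map_eq_maximalIdeal, Ideal.map_le_iff_le_comap]
        intro p hp
        obtain ⟨w, hw⟩ := (h𝔞 y p).mp hp
        have hu' : IsUnit (algebraMap R (Localization.AtPrime q) u) :=
          IsLocalization.map_units _ (⟨u, huq⟩ : q.primeCompl)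
        have h1 : p * u = w * t := hinj (by rw [map_mul, map_mul, ← hu, ← hw]; ring)
        rw [Ideal.mem_comap, Ideal.submodule_span_eq]
        rw [← Ideal.mul_unit_mem_iff_mem _ hu', ← map_mul, h1, map_mul]
        exact Ideal.mul_mem_left _ _ (Ideal.mem_span_singleton_self _)
      · rw [Ideal.submodule_span_eq, Ideal.span_singleton_le_iff_mem]
        exact (IsLocalization.AtPrime.to_map_mem_maximal_iff _ q t).mpr ht
    obtain ⟨s, hs, a, ha⟩ := h q hyP hdvr
    refine hs ((h𝔞 y s).mpr ⟨y * a, ?_⟩)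
    rw [map_mul, ← ha]
    ring

-- Localize at `q`: a nonzero prime of a discrete valuation ring is the maximal ideal.
omit [IsNoetherianRing R] in
lemma eq_of_le_of_isDiscreteValuationRing {p q : Ideal R} [p.IsPrime] [q.IsPrime] (hp : p ≠ ⊥)
    (hpq : p ≤ q) (h : IsDiscreteValuationRing (Localization.AtPrime q)) : p = q := by
  have hdisj : Disjoint (q.primeCompl : Set R) (p : Set R) :=
    Set.disjoint_left.mpr fun a ha hap => ha (hpq hap)
  have hprime : (p.map (algebraMap R (Localization.AtPrime q))).IsPrime :=
    IsLocalization.isPrime_of_isPrime_disjoint q.primeCompl _ p ‹_› hdisj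
  obtain ⟨a, ha, h0⟩ := Submodule.exists_mem_ne_zero_of_ne_bot hp
  have hne : p.map (algebraMap R (Localization.AtPrime q)) ≠ ⊥ :=
    (Submodule.ne_bot_iff _).mpr ⟨_, Ideal.mem_map_of_mem _ ha, (map_ne_zero_iff _
      (IsLocalization.injective _ q.primeCompl_le_nonZeroDivisors)).mpr h0⟩
  have hmax := IsLocalRing.eq_maximalIdeal (hprime.isMaximal hne)
  rw [← IsLocalization.under_map_of_isPrime_disjoint q.primeCompl (Localization.AtPrime q)
    ‹p.IsPrime› hdisj, hmax, IsLocalization.AtPrime.under_maximalIdeal (Localization.AtPrime q) q]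

/-- A fraction whose only pole is the given prime divisor, and is simple there. -/
lemma exists_simple_pole {p : Ideal R} [p.IsPrime]
    (h : IsDiscreteValuationRing (Localization.AtPrime p)) :
    ∃ e : L, (∀ c ∈ p, ∃ a, e * algebraMap R L c = algebraMap R L a) ∧
      ∀ s ∉ p, ∀ a, e * algebraMap R L s ≠ algebraMap R L a := by
  classical
  obtain ⟨π, hπ⟩ := IsDiscreteValuationRing.exists_irreducible (Localization.AtPrime p)
  obtain ⟨⟨b, s₀⟩, hb⟩ := IsLocalization.surj p.primeCompl π
  have hinj : Function.Injective (algebraMap R L) := IsFractionRing.injective R L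
  have hinj' := IsLocalization.injective (Localization.AtPrime p) p.primeCompl_le_nonZeroDivisors
  have hu := IsLocalization.map_units (Localization.AtPrime p) s₀
  have hbp : b ∈ p := by
    rw [← IsLocalization.AtPrime.to_map_mem_maximal_iff (Localization.AtPrime p) p b, ← hb,
      hπ.maximalIdeal_eq]
    exact Ideal.mul_mem_right _ _ (Ideal.mem_span_singleton_self π)
  have hb0 : b ≠ 0 := by
    rintro rfl
    rw [map_zero] at hb
    exact hπ.ne_zero ((hu.mul_left_eq_zero).mp hb)
  have hdiv : ∀ c ∈ p, ∃ s ∉ p, ∃ a, s * c = b * a := by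
    intro c hc
    have h1 : algebraMap R (Localization.AtPrime p) c ∈ Ideal.span {algebraMap R _ b} := by
      rw [← hb, Ideal.span_singleton_mul_right_unit hu, ← hπ.maximalIdeal_eq]
      exact (IsLocalization.AtPrime.to_map_mem_maximal_iff _ p c).mpr hc
    obtain ⟨d, hd⟩ := Ideal.mem_span_singleton'.mp h1
    obtain ⟨⟨a, s⟩, ha⟩ := IsLocalization.surj p.primeCompl d
    refine ⟨s, s.2, a, hinj' ?_⟩
    rw [map_mul, map_mul, ← hd, ← ha]
    ring
  obtain ⟨t, ht⟩ := IsNoetherian.noetherian p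
  have htp : ∀ c ∈ t, c ∈ p := fun c hc => ht ▸ Ideal.subset_span hc
  choose! s hs a ha using fun c hc => hdiv c (htp c hc)
  have hsp : ∏ c ∈ t, s c ∉ p := fun hmem => by
    obtain ⟨c, hc, h⟩ := (Ideal.IsPrime.prod_mem_iff (hp := ‹p.IsPrime›)).mp hmem
    exact hs c hc h
  have hb0' : algebraMap R L b ≠ 0 := (map_ne_zero_iff _ hinj).mpr hb0
  have hle : ∀ c ∈ p, (∏ c ∈ t, s c) * c ∈ Ideal.span {b} := by
    intro c hc
    rw [← ht] at hc
    induction hc using Submodule.span_induction with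
    | mem c hc =>
      rw [← Finset.prod_erase_mul t _ hc, mul_assoc, ha c hc]
      exact Ideal.mul_mem_left _ _ (Ideal.mul_mem_right _ _ (Ideal.mem_span_singleton_self b))
    | zero => simp
    | add c d _ _ h1 h2 => rw [mul_add]; exact add_mem h1 h2
    | smul r c _ h1 => rw [smul_eq_mul, mul_left_comm]; exact Ideal.mul_mem_left _ _ h1
  -- Locally at `p` the element `b` generates `p`. The product of the denominators `s c ∉ p` of the
  -- finitely many generators lies outside `p` and multiplies all of `p` into `(b)`.
  refine ⟨algebraMap R L (∏ c ∈ t, s c) / algebraMap R L b, fun c hc => ?_, fun s' hs' a h => ?_⟩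
  · obtain ⟨a, ha⟩ := Ideal.mem_span_singleton'.mp (hle c hc)
    refine ⟨a, ?_⟩
    rw [div_mul_eq_mul_div, ← map_mul, ← ha, map_mul, mul_div_cancel_right₀ _ hb0']
  · rw [div_mul_eq_mul_div, div_eq_iff hb0', ← map_mul, ← map_mul] at h
    have := hinj h
    exact (‹p.IsPrime›.mem_or_mem (this ▸ p.mul_mem_left a hbp)).elim hsp hs'

end Hartogs

/-! ### Bases adapted to a filtration -/

section AdaptedBasis

variable {K V : Type*} [Field K] [AddCommGroup V] [Module K V]

/-- Induction on the length: an adapted set for the shifted filtration spans `F 1`. Extend it to a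
basis of `F 0`, raise the old jumps by one and give the new vectors jump `0`. -/
lemma exists_adapted_set (n : ℕ) : ∀ F : ℕ → Submodule K V, (∀ j < n, F (j + 1) ≤ F j) →
    ∃ (s : Set V) (v : V → ℕ), LinearIndepOn K id s ∧ (∀ x ∈ s, v x ≤ n) ∧
      ∀ j ≤ n, F j = Submodule.span K {x ∈ s | j ≤ v x} := by
  induction n with
  | zero =>
    intro F _
    obtain ⟨s, hs, -, hspan, hind⟩ := exists_linearIndepOn_id_extension
      (linearIndepOn_empty K (id : V → V)) (Set.empty_subset (F 0 : Set V))
    refine ⟨s, 0, hind, by simp, fun j hj => ?_⟩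
    obtain rfl : j = 0 := by omega
    simp only [zero_le, and_true, Set.ofPred_mem_eq]
    exact le_antisymm hspan (Submodule.span_le.mpr hs)
  | succ n ih =>
    classical
    intro F hF
    obtain ⟨s', v', hind', hv', hF'⟩ := ih (fun j => F (j + 1)) fun j hj => hF (j + 1) (by omega)
    have hs' : Submodule.span K s' = F 1 := by
      rw [hF' 0 (Nat.zero_le _)]
      simp
    have hs'0 : s' ⊆ F 0 := Submodule.subset_span.trans (hs'.trans_le (hF 0 (Nat.succ_pos n)))
    obtain ⟨s, hs, hss', hspan, hind⟩ := exists_linearIndepOn_id_extension hind' hs'0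
    refine ⟨s, fun x => if x ∈ s' then v' x + 1 else 0, hind, fun x _ => ?_, fun j hj => ?_⟩
    · dsimp only
      split_ifs with h
      · exact Nat.succ_le_succ (hv' x h)
      · exact Nat.zero_le _
    · cases j with
      | zero =>
        simp only [zero_le, and_true, Set.ofPred_mem_eq]
        exact le_antisymm hspan (Submodule.span_le.mpr hs)
      | succ j =>
        rw [hF' j (by omega)]
        congr 1
        ext x
        constructor
        · rintro ⟨hx, hj⟩
          exact ⟨hss' hx, by simpa [hx] using hj⟩
        · rintro ⟨hx, hj⟩
          have hx' : x ∈ s' := by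
            by_contra h
            simp [h] at hj
          exact ⟨hx', by simpa [hx'] using hj⟩

/-- A basis adapted to a decreasing filtration. -/
theorem exists_adapted_basis (n : ℕ) (F : ℕ → Submodule K V) (hF : ∀ j < n, F (j + 1) ≤ F j)
    [Module.Finite K (F 0)] :
    ∃ (b : Fin (Module.finrank K (F 0)) → V) (v : Fin (Module.finrank K (F 0)) → ℕ),
      LinearIndependent K b ∧ (∀ i, v i ≤ n) ∧
      (∀ j ≤ n, F j = Submodule.span K (b '' {i | j ≤ v i})) ∧
      ∑ j ∈ Finset.Icc 1 n, Module.finrank K (F j) = ∑ i, v i := by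
  obtain ⟨s, v, hind, hv, hs⟩ := exists_adapted_set n F hF
  have hs0 : F 0 = Submodule.span K s := by
    rw [hs 0 (Nat.zero_le n)]
    simp
  have hfin : s.Finite := by
    have : Module.Finite K (Submodule.span K s) := hs0 ▸ ‹_›
    have h : LinearIndependent K fun x : s => (⟨x, Submodule.subset_span x.2⟩ :
        Submodule.span K s) := .of_comp (Submodule.span K s).subtype hind
    exact h.finite
  have := hfin.fintype
  have hcard : Fintype.card s = Module.finrank K (F 0) := by
    rw [hs0, ← Set.toFinset_card]
    exact (finrank_span_set_eq_card hind).symm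
  let e : Fin (Module.finrank K (F 0)) ≃ s := (Fintype.equivFinOfCardEq hcard).symm
  have hb : LinearIndependent K fun i => (e i : V) :=
    LinearIndependent.comp hind e e.injective
  have hspan : ∀ j ≤ n, F j =
      Submodule.span K ((fun i => (e i : V)) '' {i | j ≤ v (e i)}) := fun j hj => by
    rw [hs j hj]
    congr 1
    ext x
    constructor
    · rintro ⟨hx, hj⟩
      exact ⟨e.symm ⟨x, hx⟩, by simpa using hj, by simp⟩
    · rintro ⟨i, hi, rfl⟩
      exact ⟨(e i).2, hi⟩
  refine ⟨fun i => e i, fun i => v (e i), hb, fun i => hv _ (e i).2, hspan, ?_⟩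
  -- `dim F j` counts the `i` with `j ≤ v i`; exchanging the two sums, each `i` is counted `v i`
  -- times.
  have hrank : ∀ j ∈ Finset.Icc 1 n, Module.finrank K (F j) =
      ∑ i, if j ≤ v (e i) then 1 else 0 := fun j hj => by
    rw [hspan j (Finset.mem_Icc.mp hj).2, Finset.sum_boole, Nat.cast_id]
    have h1 := finrank_span_eq_card (hb.comp (fun i : {i | j ≤ v (e i)} => i.1)
      Subtype.val_injective)
    rw [Set.range_comp, Subtype.range_coe] at h1
    rw [h1]
    exact Fintype.card_subtype _
  rw [Finset.sum_congr rfl hrank, Finset.sum_comm]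
  refine Finset.sum_congr rfl fun i _ => ?_
  rw [Finset.sum_boole, Nat.cast_id]
  have : (Finset.Icc 1 n).filter (fun j => j ≤ v (e i)) = Finset.Icc 1 (v (e i)) := by
    ext j
    have := hv _ (e i).2
    simp only [Finset.mem_filter, Finset.mem_Icc]
    omega
  rw [this, Nat.card_Icc, Nat.add_sub_cancel]

end AdaptedBasis

/-! ### Stalks and inverse images of ideal sheaves -/

section IdealSheaf

/-- Two affine neighbourhoods give the same extended ideal because both agree with a smaller affine
neighbourhood inside their intersection. -/
lemma stalkIdeal_eq {X : Scheme.{u}} (I : X.IdealSheafData) (U : X.affineOpens) {x : X}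
    (hx : x ∈ U.1) : stalkIdeal I x = (I.ideal U).map (X.presheaf.germ U.1 x hx).hom := by
  refine le_antisymm (iSup₂_le fun V hV => ?_) (le_iSup₂_of_le U hx le_rfl)
  obtain ⟨_, ⟨W, hW, rfl⟩, hxW, hWUV⟩ := X.isBasis_affineOpens.exists_subset_of_mem_open
    (show x ∈ ((U.1 ⊓ V.1 : X.Opens) : Set X) from ⟨hx, hV⟩) (U.1 ⊓ V.1).isOpen
  let W' : X.affineOpens := ⟨W, hW⟩
  have hU : W' ≤ U := fun y hy => (hWUV hy).1
  have hV' : W' ≤ V := fun y hy => (hWUV hy).2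
  rw [← X.presheaf.germ_res (homOfLE hV') x hxW, ← X.presheaf.germ_res (homOfLE hU) x hxW,
    CommRingCat.hom_comp, CommRingCat.hom_comp, ← Ideal.map_map, ← Ideal.map_map,
    I.map_ideal' (U := W') (V := V), I.map_ideal' (U := W') (V := U)]

lemma exists_affineOpens_mem {X : Scheme.{u}} (x : X) : ∃ U : X.affineOpens, x ∈ U.1 := by
  obtain ⟨_, ⟨U, hU, rfl⟩, hx, -⟩ :=
    X.isBasis_affineOpens.exists_subset_of_mem_open (Set.mem_univ x) isOpen_univ
  exact ⟨⟨U, hU⟩, hx⟩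

lemma stalkIdeal_mono {X : Scheme.{u}} {I J : X.IdealSheafData} (h : I ≤ J) (x : X) :
    stalkIdeal I x ≤ stalkIdeal J x :=
  iSup₂_mono fun U _ => Ideal.map_mono (h U)

lemma stalkIdeal_top {X : Scheme.{u}} (x : X) : stalkIdeal (⊤ : X.IdealSheafData) x = ⊤ := by
  obtain ⟨U, hU⟩ := exists_affineOpens_mem x
  rw [stalkIdeal_eq _ U hU, Scheme.IdealSheafData.ideal_top, Pi.top_apply, Ideal.map_top]

lemma stalkIdeal_bot {X : Scheme.{u}} (x : X) : stalkIdeal (⊥ : X.IdealSheafData) x = ⊥ := by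
  obtain ⟨U, hU⟩ := exists_affineOpens_mem x
  rw [stalkIdeal_eq _ U hU, Scheme.IdealSheafData.ideal_bot, Pi.bot_apply, Ideal.map_bot]

lemma stalkIdeal_mul {X : Scheme.{u}} (I J : X.IdealSheafData) (x : X) :
    stalkIdeal (I * J) x = stalkIdeal I x * stalkIdeal J x := by
  obtain ⟨U, hU⟩ := exists_affineOpens_mem x
  rw [stalkIdeal_eq _ U hU, stalkIdeal_eq _ U hU, stalkIdeal_eq _ U hU,
    Scheme.IdealSheafData.ideal_mul, Pi.mul_apply, Ideal.map_mul]

lemma stalkIdeal_add {X : Scheme.{u}} (I J : X.IdealSheafData) (x : X) :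
    stalkIdeal (I + J) x = stalkIdeal I x + stalkIdeal J x := by
  obtain ⟨U, hU⟩ := exists_affineOpens_mem x
  rw [stalkIdeal_eq _ U hU, stalkIdeal_eq _ U hU, stalkIdeal_eq _ U hU,
    Scheme.IdealSheafData.add_eq_sup, Scheme.IdealSheafData.ideal_sup, Pi.sup_apply, Ideal.map_sup]
  rfl

/-- Taking stalks, as a homomorphism of semirings. -/
def stalkIdealHom {X : Scheme.{u}} (x : X) :
    X.IdealSheafData →+* Ideal (X.presheaf.stalk x) where
  toFun I := stalkIdeal I x
  map_one' := (stalkIdeal_top x).trans Ideal.one_eq_top.symm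
  map_mul' I J := stalkIdeal_mul I J x
  map_zero' := stalkIdeal_bot x
  map_add' I J := stalkIdeal_add I J x

/-- Both sides are lower adjoints of the same operation: the direct image along an affine morphism
is contraction of ideals. -/
lemma ideal_comap_top_of_isAffine {X Y : Scheme.{u}} [IsAffine X] [IsAffine Y] (f : X ⟶ Y)
    (I : Y.IdealSheafData) : (I.comap f).ideal ⟨⊤, isAffineOpen_top X⟩ =
      (I.ideal ⟨⊤, isAffineOpen_top Y⟩).map f.appTop.hom := by
  have key : ∀ J : X.IdealSheafData, I.comap f ≤ J ↔
      (I.ideal ⟨⊤, isAffineOpen_top Y⟩).map f.appTop.hom ≤ J.ideal ⟨⊤, isAffineOpen_top X⟩ := by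
    intro J
    rw [← Scheme.IdealSheafData.le_map_iff_comap_le, Ideal.map_le_iff_le_comap]
    have h := Scheme.IdealSheafData.ideal_map_of_isAffineHom J f ⟨⊤, isAffineOpen_top Y⟩
    exact ⟨fun hle => (hle ⟨⊤, isAffineOpen_top Y⟩).trans h.le,
      fun hle => Scheme.IdealSheafData.le_of_isAffine (hle.trans h.ge)⟩
  refine le_antisymm ?_ ((key _).mp le_rfl)
  have h := (key (.ofIdealTop ((I.ideal ⟨⊤, isAffineOpen_top Y⟩).map f.appTop.hom))).mpr
    (by simp) ⟨⊤, isAffineOpen_top X⟩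
  simpa using h

lemma ideal_comap_ι {X : Scheme.{u}} (U : X.affineOpens) (I : X.IdealSheafData) :
    (I.comap U.1.ι).ideal ⟨⊤, isAffineOpen_top U.1.toScheme⟩ =
      (I.ideal U).map U.1.topIso.inv.hom := by
  rw [Scheme.IdealSheafData.ideal_comap_of_isOpenImmersion, Scheme.Opens.ι_appIso]
  exact (Ideal.comap_id _).trans (I.map_ideal' (U := ⟨U.1.ι ''ᵁ ⊤, _⟩) (V := U) _).symm

/-- Restricting `f` to a morphism from `V` to `U` reduces this to the case of affine schemes. -/
lemma ideal_comap {X Y : Scheme.{u}} (f : X ⟶ Y) (I : Y.IdealSheafData) (U : Y.affineOpens)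
    (V : X.affineOpens) (e : V.1 ≤ f ⁻¹ᵁ U.1) :
    (I.comap f).ideal V = (I.ideal U).map (f.appLE U.1 V.1 e).hom := by
  have h1 : (I.comap f).comap V.1.ι = (I.comap U.1.ι).comap (f.resLE U.1 V.1 e) := by
    rw [← Scheme.IdealSheafData.comap_comp, ← Scheme.IdealSheafData.comap_comp,
      Scheme.Hom.resLE_comp_ι]
  have h2 := congr_arg (fun J => J.ideal ⟨⊤, isAffineOpen_top V.1.toScheme⟩) h1
  simp only [ideal_comap_top_of_isAffine, ideal_comap_ι, Ideal.map_map,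
    ← CommRingCat.hom_comp] at h2
  have h3 : U.1.topIso.inv ≫ (f.resLE U.1 V.1 e).appTop = f.appLE U.1 V.1 e ≫ V.1.topIso.inv := by
    rw [Scheme.Hom.appTop, Scheme.Hom.resLE_app_top, Iso.inv_hom_id_assoc]
  rw [h3] at h2
  have h4 := congr_arg (fun J => Ideal.map V.1.topIso.hom.hom J) h2
  simpa only [Ideal.map_map, ← CommRingCat.hom_comp, Category.assoc, Iso.inv_hom_id,
    Category.comp_id, CommRingCat.hom_id, Ideal.map_id] using h4

lemma germ_stalkMap_eq_appLE {X Y : Scheme.{u}} (f : X ⟶ Y) (U : Y.Opens) (V : X.Opens)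
    (e : V ≤ f ⁻¹ᵁ U) (x : X) (hx : x ∈ V) (hfx : f x ∈ U) :
    f.appLE U V e ≫ X.presheaf.germ V x hx = Y.presheaf.germ U (f x) hfx ≫ f.stalkMap x := by
  rw [Scheme.Hom.germ_stalkMap]
  simp [Scheme.Hom.appLE]

lemma le_of_forall_stalkIdeal_le {X : Scheme.{u}} {I J : X.IdealSheafData}
    (h : ∀ x, stalkIdeal I x ≤ stalkIdeal J x) : I ≤ J := by
  intro U
  refine U.2.ideal_le_iff.mpr fun x hx => ?_
  rw [← stalkIdeal_eq I U hx, ← stalkIdeal_eq J U hx]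
  exact h x

lemma stalkIdeal_comap {X Y : Scheme.{u}} (f : X ⟶ Y) (I : Y.IdealSheafData) (x : X) :
    stalkIdeal (I.comap f) x = (stalkIdeal I (f x)).map (f.stalkMap x).hom := by
  obtain ⟨U, hU⟩ := exists_affineOpens_mem (f x)
  obtain ⟨_, ⟨V, hV, rfl⟩, hx, hVU⟩ := X.isBasis_affineOpens.exists_subset_of_mem_open
    (show x ∈ ((f ⁻¹ᵁ U.1 : X.Opens) : Set X) from hU) (f ⁻¹ᵁ U.1).isOpen
  rw [stalkIdeal_eq _ ⟨V, hV⟩ hx, stalkIdeal_eq _ U hU, ideal_comap f I U ⟨V, hV⟩ hVU,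
    Ideal.map_map, Ideal.map_map, ← CommRingCat.hom_comp, ← CommRingCat.hom_comp]
  congr 2
  exact germ_stalkMap_eq_appLE f U.1 V hVU x hx hU

lemma comap_mul {X Y : Scheme.{u}} (f : X ⟶ Y) (I J : Y.IdealSheafData) :
    (I * J).comap f = I.comap f * J.comap f := by
  have h : ∀ x, stalkIdeal ((I * J).comap f) x = stalkIdeal (I.comap f * J.comap f) x := fun x => by
    rw [stalkIdeal_mul, stalkIdeal_comap, stalkIdeal_comap, stalkIdeal_comap, stalkIdeal_mul,
      Ideal.map_mul]
  exact le_antisymm (le_of_forall_stalkIdeal_le fun x => (h x).le)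
    (le_of_forall_stalkIdeal_le fun x => (h x).ge)

/-- Inverse images of ideal sheaves, as a homomorphism of semirings. -/
def comapHom {X Y : Scheme.{u}} (f : X ⟶ Y) : Y.IdealSheafData →+* X.IdealSheafData where
  toFun I := I.comap f
  map_one' := Scheme.IdealSheafData.comap_top f
  map_mul' := comap_mul f
  map_zero' := Scheme.IdealSheafData.comap_bot f
  map_add' _ _ := Scheme.IdealSheafData.comap_sup _ _ _

end IdealSheaf

/-! ### Powers of the flag ideal -/

section Expansion

variable {X : Scheme.{u}}

lemma tilde_eq (M : ℕ) (I : ℕ → X.IdealSheafData) (r j : ℕ) : tilde M I r j =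
    ∑ a : Fin r → Fin (M + 1) with ∑ i, (a i : ℕ) = j, ∏ i, I (a i) := rfl

/-- Ideal sheaves form a semiring and inverse image is a semiring homomorphism, so the power expands
as a product of sums; the terms are then grouped by the total index. The bound `a i ≤ M` makes the
truncated exponents of `t` add up correctly. -/
lemma tExpansion_pow (M : ℕ) (I : ℕ → X.IdealSheafData) (r : ℕ) :
    tExpansion M I ^ r = tExpansion (M * r) (tilde M I r) := by
  have hprod : ∀ a : Fin r → Fin (M + 1),
      ∏ i, ((I (a i)).comap (Cyl.proj X) * tIdeal X ^ (M - a i)) =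
        (∏ i, I (a i)).comap (Cyl.proj X) * tIdeal X ^ (M * r - ∑ i, (a i : ℕ)) := by
    intro a
    rw [Finset.prod_mul_distrib, Finset.prod_pow_eq_pow_sum]
    congr 1
    · exact (map_prod (comapHom (Cyl.proj X)) _ _).symm
    · congr 1
      have h1 : ∑ i : Fin r, ((M - a i) + (a i : ℕ)) = M * r := by
        rw [Finset.sum_congr rfl fun i _ => Nat.sub_add_cancel (Nat.lt_succ_iff.mp (a i).2)]
        simp [mul_comm]
      rw [Finset.sum_add_distrib] at h1
      omega
  have hle : ∀ a : Fin r → Fin (M + 1), ∑ i, (a i : ℕ) < M * r + 1 := fun a => by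
    refine Nat.lt_succ_iff.mpr ((Finset.sum_le_card_nsmul _ _ M fun i _ =>
      Nat.lt_succ_iff.mp (a i).2).trans ?_)
    simp [mul_comm]
  calc tExpansion M I ^ r
      = ∏ _i : Fin r, ∑ j : Fin (M + 1), (I j).comap (Cyl.proj X) * tIdeal X ^ (M - j) := by
        rw [Finset.prod_const, Finset.card_univ, Fintype.card_fin, tExpansion, Finset.sum_range]
    _ = ∑ a : Fin r → Fin (M + 1),
          (∏ i, I (a i)).comap (Cyl.proj X) * tIdeal X ^ (M * r - ∑ i, (a i : ℕ)) := by
        rw [Finset.prod_univ_sum, Fintype.piFinset_univ]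
        exact Finset.sum_congr rfl fun a _ => hprod a
    _ = ∑ j ∈ Finset.range (M * r + 1), ∑ a : Fin r → Fin (M + 1) with ∑ i, (a i : ℕ) = j,
          (∏ i, I (a i)).comap (Cyl.proj X) * tIdeal X ^ (M * r - ∑ i, (a i : ℕ)) :=
        (Finset.sum_fiberwise_of_maps_to (fun a _ => Finset.mem_range.mpr (hle a)) _).symm
    _ = tExpansion (M * r) (tilde M I r) := by
        refine Finset.sum_congr rfl fun j _ => ?_
        rw [tilde_eq]
        change _ = comapHom (Cyl.proj X) _ * _
        rw [map_sum, Finset.sum_mul]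
        refine Finset.sum_congr rfl fun a ha => ?_
        rw [(Finset.mem_filter.mp ha).2]
        rfl

lemma IsFlag.anti_of_le {M : ℕ} {I : ℕ → X.IdealSheafData} (h : IsFlag M I) {i j : ℕ}
    (hij : i ≤ j) (hj : j ≤ M) : I j ≤ I i := by
  induction j, hij using Nat.le_induction with
  | base => exact le_rfl
  | succ j hij ih => exact (h.anti j (by omega)).trans (ih (by omega))

lemma tilde_zero {M : ℕ} {I : ℕ → X.IdealSheafData} (h : IsFlag M I) (r : ℕ) :
    tilde M I r 0 = ⊤ := by
  refine top_le_iff.mp ?_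
  have h1 : ∏ i : Fin r, I ((0 : Fin r → Fin (M + 1)) i) ≤ tilde M I r 0 :=
    Finset.single_le_sum (f := fun a : Fin r → Fin (M + 1) => ∏ i, I (a i))
      (fun _ _ => bot_le) (by simp)
  refine le_trans (le_of_eq ?_) h1
  rw [Finset.prod_eq_one, Scheme.IdealSheafData.one_eq_top]
  intro i _
  simp [h.zero]

/-- In a product of total index `j + 1` some index is positive; lowering it by one enlarges the
product. Beyond `M * r` the sum is empty, so the inclusion holds for every `j`. -/
lemma tilde_anti {M : ℕ} {I : ℕ → X.IdealSheafData} (h : IsFlag M I) (r j : ℕ) :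
    tilde M I r (j + 1) ≤ tilde M I r j := by
  rw [tilde_eq]
  refine Finset.sum_induction _ (fun J => J ≤ tilde M I r j)
    (fun a b ha hb => sup_le ha hb) bot_le fun a ha => ?_
  have ha := (Finset.mem_filter.mp ha).2
  obtain ⟨i, -, hi⟩ : ∃ i ∈ Finset.univ, (a i : ℕ) ≠ 0 := by
    by_contra! hcon
    rw [Finset.sum_eq_zero hcon] at ha
    omega
  have hlt : (a i : ℕ) - 1 < M + 1 := by omega
  let b : Fin r → Fin (M + 1) := Function.update a i ⟨a i - 1, hlt⟩
  have hb : ∑ i, (b i : ℕ) = j := by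
    have h1 := Finset.add_sum_erase Finset.univ (fun i => (a i : ℕ)) (Finset.mem_univ i)
    have h2 := Finset.add_sum_erase Finset.univ (fun i => (b i : ℕ)) (Finset.mem_univ i)
    have h3 : ∑ k ∈ Finset.univ.erase i, (b k : ℕ) = ∑ k ∈ Finset.univ.erase i, (a k : ℕ) :=
      Finset.sum_congr rfl fun k hk => by simp [b, Finset.ne_of_mem_erase hk]
    have h4 : (b i : ℕ) = a i - 1 := by simp [b]
    omega
  have h1 : ∏ i, I (b i) ≤ tilde M I r j :=
    Finset.single_le_sum (f := fun a : Fin r → Fin (M + 1) => ∏ i, I (a i))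
      (fun _ _ => bot_le) (by simpa using hb)
  refine le_trans (Finset.prod_le_prod' fun k _ => ?_) h1
  refine h.anti_of_le ?_ (Nat.lt_succ_iff.mp (a k).2)
  by_cases hk : k = i
  · subst hk
    simp [b]
  · simp [b, hk]

end Expansion

/-! ### Local rings inside the function field -/

section LocalRing

lemma exists_specializes_primeIdealOf_eq {X : Scheme.{u}} (U : X.affineOpens) {x : X} (hx : x ∈ U.1)
    (q : PrimeSpectrum Γ(X, U.1)) (hq : q ≤ U.2.primeIdealOf ⟨x, hx⟩) :
    ∃ (y : X) (hy : y ∈ U.1), y ⤳ x ∧ U.2.primeIdealOf ⟨y, hy⟩ = q := by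
  have hmem : U.2.fromSpec q ∈ U.1 := by
    have h : U.2.fromSpec q ∈ Set.range U.2.fromSpec := ⟨q, rfl⟩
    rwa [U.2.range_fromSpec] at h
  refine ⟨U.2.fromSpec q, hmem, ?_, ?_⟩
  · have h := ((PrimeSpectrum.le_iff_specializes q _).mp hq).map U.2.fromSpec.continuous
    have h2 := U.2.fromSpec_primeIdealOf ⟨x, hx⟩
    rw [h2] at h
    exact h
  · have hU : IsAffineOpen U.1 := U.2
    exact hU.fromSpec.isOpenEmbedding.injective (U.2.fromSpec_primeIdealOf ⟨_, hmem⟩)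

variable {X : Scheme.{u}} [IsIntegral X]

lemma mem_localRing_iff (U : X.affineOpens) [Nonempty U.1] {x : X} (hx : x ∈ U.1)
    {f : X.functionField} : f ∈ localRing X x ↔
      ∃ s ∉ (U.2.primeIdealOf ⟨x, hx⟩).asIdeal, ∃ a,
        f * algebraMap Γ(X, U.1) X.functionField s = algebraMap Γ(X, U.1) X.functionField a := by
  have : IsFractionRing Γ(X, U.1) X.functionField :=
    functionField_isFractionRing_of_isAffineOpen X U.1 U.2
  let := X.presheaf.algebra_section_stalk ⟨x, hx⟩
  have : IsScalarTower Γ(X, U.1) (X.presheaf.stalk x) X.functionField :=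
    functionField_isScalarTower X U.1 ⟨x, hx⟩
  have hloc : IsLocalization.AtPrime (X.presheaf.stalk x) (U.2.primeIdealOf ⟨x, hx⟩).asIdeal :=
    U.2.isLocalization_stalk ⟨x, hx⟩
  have hinj : Function.Injective (algebraMap Γ(X, U.1) X.functionField) :=
    IsFractionRing.injective _ _
  constructor
  · rintro ⟨b, rfl⟩
    obtain ⟨⟨a, s⟩, h⟩ := IsLocalization.surj (U.2.primeIdealOf ⟨x, hx⟩).asIdeal.primeCompl b
    refine ⟨s, s.2, a, ?_⟩
    rw [IsScalarTower.algebraMap_apply Γ(X, U.1) (X.presheaf.stalk x) X.functionField, ← map_mul, h,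
      ← IsScalarTower.algebraMap_apply]
  · rintro ⟨s, hs, a, h⟩
    refine ⟨IsLocalization.mk' _ a (⟨s, hs⟩ : (U.2.primeIdealOf ⟨x, hx⟩).asIdeal.primeCompl), ?_⟩
    have hs0 : algebraMap Γ(X, U.1) X.functionField s ≠ 0 :=
      (map_ne_zero_iff _ hinj).mpr fun h0 => hs (h0 ▸ zero_mem _)
    refine mul_right_cancel₀ hs0 ?_
    rw [h, IsScalarTower.algebraMap_apply Γ(X, U.1) (X.presheaf.stalk x) X.functionField,
      IsScalarTower.algebraMap_apply Γ(X, U.1) (X.presheaf.stalk x) X.functionField, ← map_mul]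
    congr 1
    exact IsLocalization.mk'_spec _ a (⟨s, hs⟩ : (U.2.primeIdealOf ⟨x, hx⟩).asIdeal.primeCompl)

lemma localRing_le_of_specializes {x y : X} (h : y ⤳ x) : localRing X x ≤ localRing X y := by
  rintro _ ⟨c, rfl⟩
  refine ⟨X.presheaf.stalkSpecializes h c, ?_⟩
  simp only [RingHom.algebraMap_toAlgebra]
  rw [← CommRingCat.comp_apply, TopCat.Presheaf.stalkSpecializes_comp]

/-- The local ring at a point of an affine open set, as a localization. -/
def stalkEquivLocalization (U : X.affineOpens) {x : X} (hx : x ∈ U.1) :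
    X.presheaf.stalk x ≃+* Localization.AtPrime (U.2.primeIdealOf ⟨x, hx⟩).asIdeal :=
  letI := X.presheaf.algebra_section_stalk ⟨x, hx⟩
  haveI : IsLocalization.AtPrime (X.presheaf.stalk x) (U.2.primeIdealOf ⟨x, hx⟩).asIdeal :=
    U.2.isLocalization_stalk ⟨x, hx⟩
  (IsLocalization.algEquiv (U.2.primeIdealOf ⟨x, hx⟩).asIdeal.primeCompl
    (X.presheaf.stalk x) (Localization.AtPrime (U.2.primeIdealOf ⟨x, hx⟩).asIdeal)).toRingEquiv

lemma isIntegrallyClosed_of_isNormal (hX : IsNormal X) (U : X.affineOpens) [Nonempty U.1] :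
    IsIntegrallyClosed Γ(X, U.1) := by
  have hU : IsAffineOpen U.1 := U.2
  refine IsIntegrallyClosed.of_localization_maximal fun p _ hp => ?_
  have hmem : U.2.fromSpec ⟨p, hp.isPrime⟩ ∈ U.1 := by
    have h : U.2.fromSpec ⟨p, hp.isPrime⟩ ∈ Set.range U.2.fromSpec := ⟨_, rfl⟩
    rwa [U.2.range_fromSpec] at h
  have h : U.2.primeIdealOf ⟨_, hmem⟩ = ⟨p, hp.isPrime⟩ :=
    hU.fromSpec.isOpenEmbedding.injective (U.2.fromSpec_primeIdealOf ⟨_, hmem⟩)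
  have h2 := IsIntegrallyClosed.of_equiv (stalkEquivLocalization U hmem) (h := hX _)
  rw [h] at h2
  exact h2

/-- On a normal locally noetherian scheme a rational function that is regular in codimension one
is regular. -/
theorem mem_localRing_of_forall [IsLocallyNoetherian X] (hX : IsNormal X) {x : X}
    {f : X.functionField} (h : ∀ y : X, y ⤳ x → IsDiscreteValuationRing (X.presheaf.stalk y) →
      f ∈ localRing X y) : f ∈ localRing X x := by
  obtain ⟨U, hx⟩ := exists_affineOpens_mem x
  have : Nonempty U.1 := ⟨⟨x, hx⟩⟩
  have : IsFractionRing Γ(X, U.1) X.functionField :=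
    functionField_isFractionRing_of_isAffineOpen X U.1 U.2
  have : IsNoetherianRing Γ(X, U.1) := IsLocallyNoetherian.component_noetherian U
  have := isIntegrallyClosed_of_isNormal hX U
  refine (mem_localRing_iff U hx).mpr
    (exists_mul_eq_of_forall_isDiscreteValuationRing _ f fun q hq hle hD => ?_)
  obtain ⟨y, hy, hyx, hqy⟩ := exists_specializes_primeIdealOf_eq U hx ⟨q, hq⟩ hle
  obtain rfl : (U.2.primeIdealOf ⟨y, hy⟩).asIdeal = q := congr_arg _ hqy
  refine (mem_localRing_iff U hy).mp (h y hyx ?_)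
  exact IsDiscreteValuationRing.RingEquivClass.isDiscreteValuationRing (stalkEquivLocalization U hy).symm

/-- `e` detects the single point `y`: it is regular at the other codimension one points through `x`,
and since its pole at `y` is simple, a regular function fails to cancel it only if it is a unit
there. -/
theorem exists_simple_pole_localRing [IsLocallyNoetherian X] {x y : X} (hyx : y ⤳ x)
    (hy : IsDiscreteValuationRing (X.presheaf.stalk y)) : ∃ e : X.functionField,
      e ∉ localRing X y ∧
      (∀ z, z ⤳ x → IsDiscreteValuationRing (X.presheaf.stalk z) → z ≠ y → e ∈ localRing X z) ∧
      ∀ u ∈ localRing X y, e * u ∉ localRing X y → u ≠ 0 ∧ u⁻¹ ∈ localRing X y := by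
  obtain ⟨U, hx⟩ := exists_affineOpens_mem x
  have : Nonempty U.1 := ⟨⟨x, hx⟩⟩
  have : IsFractionRing Γ(X, U.1) X.functionField :=
    functionField_isFractionRing_of_isAffineOpen X U.1 U.2
  have hinj : Function.Injective (algebraMap Γ(X, U.1) X.functionField) :=
    IsFractionRing.injective _ _
  have : IsNoetherianRing Γ(X, U.1) := IsLocallyNoetherian.component_noetherian U
  have hyU : y ∈ U.1 := hyx.mem_open U.1.isOpen hx
  have hD : IsDiscreteValuationRing (Localization.AtPrime (U.2.primeIdealOf ⟨y, hyU⟩).asIdeal) :=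
    IsDiscreteValuationRing.RingEquivClass.isDiscreteValuationRing (stalkEquivLocalization U hyU)
  obtain ⟨e, he, he'⟩ := exists_simple_pole (L := X.functionField) hD
  refine ⟨e, fun hmem => ?_, fun z hzx hz hne => ?_, fun u hu heu => ?_⟩
  · obtain ⟨s, hs, a, ha⟩ := (mem_localRing_iff U hyU).mp hmem
    exact he' s hs a ha
  · have hzU : z ∈ U.1 := hzx.mem_open U.1.isOpen hx
    have hDz : IsDiscreteValuationRing
        (Localization.AtPrime (U.2.primeIdealOf ⟨z, hzU⟩).asIdeal) :=
      IsDiscreteValuationRing.RingEquivClass.isDiscreteValuationRing (stalkEquivLocalization U hzU)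
    -- There are no inclusions between distinct primes of height one, so some element vanishing at
    -- `y` is a unit at `z`, and multiplying by it makes `e` regular.
    have hnle : ¬ (U.2.primeIdealOf ⟨y, hyU⟩).asIdeal ≤ (U.2.primeIdealOf ⟨z, hzU⟩).asIdeal := by
      intro hle
      have hbot : (U.2.primeIdealOf ⟨y, hyU⟩).asIdeal ≠ ⊥ := by
        intro h0
        refine hD.not_a_field' ?_
        rw [← Localization.AtPrime.map_eq_maximalIdeal]
        exact (congr_arg _ h0).trans Ideal.map_bot
      have h := eq_of_le_of_isDiscreteValuationRing hbot hle hDz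
      have h2 := congr_arg (U.2.fromSpec ·) (PrimeSpectrum.ext h)
      simp only [U.2.fromSpec_primeIdealOf] at h2
      exact hne h2.symm
    obtain ⟨c, hc, hc'⟩ := SetLike.not_le_iff_exists.mp hnle
    exact (mem_localRing_iff U hzU).mpr ⟨c, hc', he c hc⟩
  · obtain ⟨s, hs, c, hc⟩ := (mem_localRing_iff U hyU).mp hu
    by_cases hcp : c ∈ (U.2.primeIdealOf ⟨y, hyU⟩).asIdeal
    · refine absurd ((mem_localRing_iff U hyU).mpr ⟨s, hs, ?_⟩) heu
      obtain ⟨a, ha⟩ := he c hcp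
      exact ⟨a, by rw [mul_assoc, hc, ha]⟩
    · have hs0 : algebraMap Γ(X, U.1) X.functionField s ≠ 0 :=
        (map_ne_zero_iff _ hinj).mpr fun h0 => hs (h0 ▸ zero_mem _)
      have hc0 : algebraMap Γ(X, U.1) X.functionField c ≠ 0 :=
        (map_ne_zero_iff _ hinj).mpr fun h0 => hcp (h0 ▸ zero_mem _)
      have hu0 : u ≠ 0 := fun h0 => hc0 (by rw [← hc, h0, zero_mul])
      refine ⟨hu0, (mem_localRing_iff U hyU).mpr ⟨c, hcp, s, ?_⟩⟩
      rw [← hc, inv_mul_cancel_left₀ hu0]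

end LocalRing

/-! ### Multiples of the anticanonical divisor -/

section AntiCan

variable {K : Type u} [Field K] {X : Scheme.{u}} [X.Over (Spec (.of K))] [IsIntegral X] {n : ℕ}

lemma mem_span_singleton_iff_localRing {x : X} {f g : X.functionField} :
    f ∈ Submodule.span (X.presheaf.stalk x) {g} ↔ ∃ a ∈ localRing X x, f = a * g := by
  rw [Submodule.mem_span_singleton]
  constructor
  · rintro ⟨a, rfl⟩
    exact ⟨_, ⟨a, rfl⟩, Algebra.smul_def _ _⟩
  · rintro ⟨_, ⟨a, rfl⟩, rfl⟩
    exact ⟨a, Algebra.smul_def _ _⟩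

lemma pow_mem_antiCan {ω : RatForm K X n} {a : ℕ} {x : X} {f : X.functionField}
    (hf : f ∈ antiCan ω a x) (b : ℕ) : f ^ b ∈ antiCan ω (a * b) x := by
  intro y hyx hy g' hg'
  obtain ⟨c, hc, hgc⟩ := hf y hyx hy g' hg'
  exact ⟨c ^ b, pow_mem hc b, by rw [hgc, mul_pow, pow_mul]⟩

/-- If `a K_X` is principal at `x`, so is `a b K_X`. -/
theorem antiCan_mul_eq_span [IsLocallyNoetherian X] (hX : IsNormal X) {ω : RatForm K X n} {a : ℕ}
    {x : X} {g : X.functionField} (hg : g ≠ 0) (h : antiCan ω a x = Submodule.span _ {g}) (b : ℕ) :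
    antiCan ω (a * b) x = Submodule.span _ {g ^ b} := by
  have hgm : g ∈ antiCan ω a x := h ▸ Submodule.mem_span_singleton_self g
  refine le_antisymm (fun f hf => ?_) ((Submodule.span_singleton_le_iff_mem _ _).mpr ?_)
  · refine mem_span_singleton_iff_localRing.mpr
      ⟨f / g ^ b, mem_localRing_of_forall hX fun y hyx hy => ?_,
        (div_mul_cancel₀ _ (pow_ne_zero _ hg)).symm⟩
    -- The definition of `antiCan` imposes no condition at a point where `ω` has no order in the
    -- sense of `IsOrderOf`. That an order `g'` exists at `y`, and that `g` is a unit times `g' ^ a`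
    -- there, is extracted from the principality of `antiCan ω a x`: the function `e * g` must
    -- violate some condition, and this can happen only at `y`.
    obtain ⟨e, hey, hez, heu⟩ := exists_simple_pole_localRing hyx hy
    have heg : e * g ∉ antiCan ω a x := by
      intro hmem
      rw [h, mem_span_singleton_iff_localRing] at hmem
      obtain ⟨c, hc, hc'⟩ := hmem
      exact hey (mul_right_cancel₀ hg hc' ▸ localRing_le_of_specializes hyx hc)
    obtain ⟨z, hzx, hz, g', hg', hne⟩ : ∃ z, z ⤳ x ∧ IsDiscreteValuationRing (X.presheaf.stalk z) ∧
        ∃ g', IsOrderOf ω (localRing X z) g' ∧ ∀ c ∈ localRing X z, e * g ≠ c * g' ^ a := by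
      by_contra! hcon
      exact heg fun z hzx hz g' hg' => hcon z hzx hz g' hg'
    obtain ⟨u, hu, hgu⟩ := hgm z hzx hz g' hg'
    have heu' : e * u ∉ localRing X z := fun hmem => hne _ hmem (by rw [hgu, mul_assoc])
    obtain rfl : z = y := by
      by_contra hzy
      exact heu' (mul_mem (hez z hzx hz hzy) hu)
    obtain ⟨hu0, hu'⟩ := heu u hu heu'
    obtain ⟨c, hc, rfl⟩ := hf z hzx hz g' hg'
    have hg0 : g' ^ a ≠ 0 := fun h0 => hg (by rw [hgu, h0, mul_zero])
    have : c * g' ^ (a * b) / g ^ b = c * u⁻¹ ^ b := by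
      rw [hgu, pow_mul, mul_pow, inv_pow]
      have := pow_ne_zero b hg0
      have := pow_ne_zero b hu0
      field_simp
    rw [this]
    exact mul_mem hc (pow_mem hu' b)
  · exact pow_mem_antiCan hgm b

lemma IsQFano.isLocallyNoetherian {ω : RatForm K X n} (hX : IsQFano K X n ω) :
    IsLocallyNoetherian X :=
  have := hX.proper
  LocallyOfFiniteType.isLocallyNoetherian (X ↘ Spec (.of K))

lemma IsQFano.compactSpace {ω : RatForm K X n} (hX : IsQFano K X n ω) : CompactSpace X :=
  have := hX.proper
  QuasiCompact.compactSpace_of_compactSpace (X ↘ Spec (.of K))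

/-- A multiple of an ample divisor is generated on the members of an affine open cover by
single global sections. -/
theorem IsQFano.exists_generating_cover {ω : RatForm K X n} (hX : IsQFano K X n ω) :
    ∃ k₁ : ℕ, 0 < k₁ ∧ ∃ (ι : Type u) (_ : Finite ι) (U : ι → X.affineOpens)
      (f : ι → X.functionField), (∀ x, ∃ i, x ∈ (U i).1) ∧ (∀ i, f i ≠ 0) ∧
        ∀ i c, f i ^ c ∈ antiSections ω (k₁ * c) ∧
          ∀ y ∈ (U i).1, antiCan ω (k₁ * c) y = Submodule.span _ {f i ^ c} := by
  have := hX.isLocallyNoetherian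
  have := hX.compactSpace
  obtain ⟨m, hm, hcart, hample⟩ := hX.ample
  choose l hl f hf U hU hxU hgen using hample
  obtain ⟨t, ht⟩ := CompactSpace.elim_nhds_subcover (fun x => (U x : Set X))
    fun x => (U x).isOpen.mem_nhds (hxU x)
  -- A common multiple of the finitely many exponents: `f x ^ (L / l x)` is then a section of the
  -- same multiple `m * L` for every member of the cover.
  let L := ∏ x ∈ t, l x
  have hL : 0 < L := Finset.prod_pos fun x _ => hl x
  have hdvd : ∀ x : t, l x ∣ L := fun x => Finset.dvd_prod_of_mem l x.2
  -- A zero generator would contradict the fact that a power of the local equation `g ≠ 0` generates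
  -- the same stalk.
  have hfne : ∀ x, f x ≠ 0 := by
    intro x hx0
    obtain ⟨g, hg, hg'⟩ := hcart x
    have h1 := (antiCan_mul_eq_span hX.normal hg hg' (l x)).symm
    rw [mul_comm m, (hgen x x).mp (hxU x), hx0, Submodule.span_zero_singleton,
      Submodule.span_singleton_eq_bot] at h1
    exact pow_ne_zero _ hg h1
  have hkey : ∀ (x : t) (c : ℕ), m * L * c = l x * m * (L / l x * c) := by
    intro x c
    rw [← mul_assoc, mul_comm (l x) m, mul_assoc m (l x), Nat.mul_div_cancel' (hdvd x)]
  refine ⟨m * L, Nat.mul_pos hm hL, t, inferInstance, fun x => ⟨U x, hU x⟩,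
    fun x => f x ^ (L / l x), fun x => ?_, fun x => pow_ne_zero _ (hfne x), fun x c => ⟨?_, ?_⟩⟩
  · have hx : x ∈ ⋃ y ∈ t, (U y : Set X) := ht ▸ Set.mem_univ x
    obtain ⟨y, hy, hxy⟩ := Set.mem_iUnion₂.mp hx
    exact ⟨⟨y, hy⟩, hxy⟩
  · intro y
    rw [← pow_mul, hkey x c]
    exact pow_mem_antiCan (hf x y) _
  · intro y hy
    rw [← pow_mul, hkey x c]
    exact antiCan_mul_eq_span hX.normal (hfne x) ((hgen x y).mp hy) _

end AntiCan

/-! ### Centers of valuations on a proper variety -/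

section Center

variable {K : Type u} [Field K] {X : Scheme.{u}} [X.Over (Spec (.of K))] [IsIntegral X]

/-- This provides the commutative square to which the valuative criterion is applied. -/
lemma fromSpecStalk_genericPoint_over : X.fromSpecStalk (genericPoint X) ≫ (X ↘ Spec (.of K)) =
    Spec.map (CommRingCat.ofHom (algebraMap K X.functionField)) := by
  let φ : CommRingCat.of K ⟶ X.presheaf.stalk (genericPoint X) :=
    CommRingCat.ofHom (constStalk X (genericPoint X))
  change _ = Spec.map φ
  refine ext_of_isAffine ?_
  have h := Scheme.ΓSpecIso_naturality φ
  rw [← cancel_mono (Scheme.ΓSpecIso _).hom, h, Scheme.Hom.comp_appTop, Scheme.fromSpecStalk_appTop,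
    ← cancel_epi (Scheme.ΓSpecIso (.of K)).inv]
  ext c
  simp
  rfl

/-- A valuation of the function field of a proper variety has a center. -/
theorem exists_localRing_le [IsProper (X ↘ Spec (.of K))] (V : ValuationSubring X.functionField)
    (hV : ∀ c : K, algebraMap K X.functionField c ∈ V) : ∃ x, localRing X x ≤ V.toSubring := by
  let ψ : K →+* V := (algebraMap K X.functionField).codRestrict V.toSubring hV
  let S : ValuativeCommSq (X ↘ Spec (.of K)) :=
    { R := V
      K := X.functionField
      i₁ := X.fromSpecStalk (genericPoint X)
      i₂ := Spec.map (CommRingCat.ofHom ψ)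
      commSq := ⟨by rw [fromSpecStalk_genericPoint_over, ← Spec.map_comp]; rfl⟩ }
  have hex : ValuativeCriterion.Existence (X ↘ Spec (.of K)) := by
    have h : UniversallyClosed (X ↘ Spec (.of K)) := inferInstance
    rw [UniversallyClosed.eq_valuativeCriterion] at h
    exact h.1
  -- The center is the image of the closed point under the lift `l`.
  obtain ⟨⟨l, hl, -⟩⟩ := hex S
  let l' : Spec (.of V) ⟶ X := l
  have hloc : IsLocalRing (CommRingCat.of V) := inferInstanceAs (IsLocalRing V)
  let φ := Scheme.stalkClosedPointTo l'
  have hφ : Spec.map φ ≫ X.fromSpecStalk _ = l' := Scheme.Spec_stalkClosedPointTo_fromSpecStalk l'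
  refine ⟨l' (IsLocalRing.closedPoint V), ?_⟩
  let ι : CommRingCat.of V ⟶ X.functionField := CommRingCat.ofHom (algebraMap V X.functionField)
  have h1 : φ ≫ ι = X.presheaf.stalkSpecializes ((genericPoint_spec X).specializes trivial) := by
    refine Spec.map_injective ?_
    rw [← cancel_mono (X.fromSpecStalk _), Scheme.SpecMap_stalkSpecializes_fromSpecStalk,
      Spec.map_comp, Category.assoc, hφ]
    exact hl
  rintro _ ⟨a, rfl⟩
  have h2 := congr_arg (fun f => f.hom a) h1
  have h3 : algebraMap _ X.functionField a = (φ.hom a : X.functionField) := h2.symm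
  rw [h3]
  exact (φ.hom a : V).2

end Center
-- Coordinate rings as algebras over the ground field
section FiniteType

variable {K : Type u} [Field K] (X : Scheme.{u}) [X.Over (Spec (.of K))]

/-- The constant sections over an open set. -/
def constSection (U : X.Opens) : K →+* Γ(X, U) :=
  ((X ↘ Spec (.of K)).appLE ⊤ U le_top).hom.comp (Scheme.ΓSpecIso (.of K)).inv.hom

lemma germ_constSection (U : X.Opens) (x : X) (hx : x ∈ U) (c : K) :
    X.presheaf.germ U x hx (constSection X U c) = constStalk X x c := by
  simp only [constSection, constStalk, RingHom.comp_apply, Scheme.Hom.appLE, CommRingCat.hom_comp]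
  exact X.presheaf.germ_res_apply (homOfLE _) x hx _

lemma constSection_finiteType [LocallyOfFiniteType (X ↘ Spec (.of K))] (U : X.affineOpens) :
    (constSection (K := K) X U.1).FiniteType := by
  have h : ((X ↘ Spec (.of K)).appLE ⊤ U.1 le_top).hom.FiniteType :=
    LocallyOfFiniteType.finiteType_appLE _ (isAffineOpen_top _) U.2 _
  refine RingHom.FiniteType.comp h (RingHom.FiniteType.of_surjective _ ?_)
  exact (ConcreteCategory.bijective_of_isIso (Scheme.ΓSpecIso (.of K)).inv).2

instance sectionAlgebra (U : X.Opens) : Algebra K Γ(X, U) := (constSection X U).toAlgebra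

instance [IsIntegral X] (U : X.Opens) [Nonempty U] :
    IsScalarTower K Γ(X, U) X.functionField := by
  refine .of_algebraMap_eq fun c => ?_
  exact (germ_constSection X U (genericPoint X) _ c).symm

instance [LocallyOfFiniteType (X ↘ Spec (.of K))] (U : X.affineOpens) :
    Algebra.FiniteType K Γ(X, U.1) :=
  constSection_finiteType X U

instance [IsIntegral X] [LocallyOfFiniteType (X ↘ Spec (.of K))] :
    Algebra.EssFiniteType K X.functionField := by
  obtain ⟨U, hU⟩ := exists_affineOpens_mem (genericPoint X)
  have : Nonempty U.1 := ⟨⟨_, hU⟩⟩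
  have : IsFractionRing Γ(X, U.1) X.functionField :=
    functionField_isFractionRing_of_isAffineOpen X U.1 U.2
  have : Algebra.EssFiniteType Γ(X, U.1) X.functionField :=
    .of_isLocalization _ (nonZeroDivisors Γ(X, U.1))
  exact .comp K Γ(X, U.1) X.functionField

end FiniteType

/-! ### A valuative criterion for finite dimension -/

section Finite
open Polynomial

variable {K : Type u} [Field K]

/-- An element of a field that lies in all the valuation rings containing a ring is integral
over that ring. -/
lemma isIntegral_of_forall_valuationSubring {A L : Type*} [CommRing A] [Field L] [Algebra A L]
    {x : L} (h : ∀ V : ValuationSubring L, (∀ a : A, algebraMap A L a ∈ V) → x ∈ V) :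
    IsIntegral A x := by
  have h1 := iInf_valuationSubring_superset (s := Set.range (algebraMap A L))
  have h2 : x ∈ (⨅ V : {V : ValuationSubring L // Set.range (algebraMap A L) ⊆ V.toSubring},
      V.1.toSubring) := by
    rw [Subring.mem_iInf]
    exact fun V => h V.1 fun a => V.2 ⟨a, rfl⟩
  rw [h1] at h2
  have h3 : IsIntegral (Subring.closure (Set.range (algebraMap A L))) x := h2
  have h4 : Subring.closure (Set.range (algebraMap A L)) ≤ (algebraMap A L).range :=
    Subring.closure_le.mpr fun y hy => hy
  obtain ⟨p, hp, hpx⟩ := h3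
  have h5 : ∃ q : A[X], q.map (algebraMap A L) =
      p.map (algebraMap (Subring.closure (Set.range (algebraMap A L))) L) ∧ q.degree =
      (p.map (algebraMap (Subring.closure (Set.range (algebraMap A L))) L)).degree ∧ q.Monic := by
    refine lifts_and_degree_eq_and_monic ?_ (hp.map _)
    rw [lifts_iff_coeff_lifts]
    intro n
    rw [coeff_map]
    exact h4 (p.coeff n).2
  obtain ⟨q, hq, -, hqm⟩ := h5
  exact ⟨q, hqm, by rw [← Polynomial.eval_map, hq, Polynomial.eval_map]; exact hpx⟩

/-- Let `S` be a set of elements of a field `L` such that, for every valuation ring over `K`,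
each element of `S` is a multiple of one of finitely many elements of `L`. Then `S` spans a space
of finite dimension. -/
theorem finite_span_of_forall_valuationSubring [CharZero K] {L : Type u} [Field L] [Algebra K L]
    [Algebra.EssFiniteType K L] {ι : Type*} [Finite ι] (σ : ι → L) (V : Submodule K L)
    (hV : ∀ W : ValuationSubring L, (∀ c : K, algebraMap K L c ∈ W) → ∃ i, ∀ f ∈ V, ∃ a ∈ W,
      f = a * σ i) : Module.Finite K V := by
  -- The extra variable puts the elements of `V` in degree one over an algebra whose degree zero
  -- part is `K`, so that a finite module over `A` yields a finite-dimensional space.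
  let A := Algebra.adjoin K (Set.range fun i => (C (σ i) * X : L[X]))
  have : Algebra.FiniteType K A :=
    (Subalgebra.fg_iff_finiteType A).mp ⟨(Set.finite_range _).toFinset, by rw [Set.Finite.coe_toFinset]⟩
  have : Algebra.EssFiniteType K L[X] := .comp K L L[X]
  have hA : ∀ a : A, ∃ c : K, (a : L[X]).coeff 0 = algebraMap K L c := by
    have hle : A ≤ (⊥ : Subalgebra K L).comap ((aeval (0 : L)).restrictScalars K) := by
      refine Algebra.adjoin_le ?_
      rintro _ ⟨i, rfl⟩
      simp
    intro a
    obtain ⟨c, hc⟩ := hle a.2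
    refine ⟨c, ?_⟩
    rw [coeff_zero_eq_aeval_zero]
    exact hc.symm
  have hint : ∀ x ∈ (fun f : L => (C f * X : L[X])) '' V, IsIntegral A x := by
    rintro _ ⟨f, hf, rfl⟩
    let F := FractionRing L[X]
    have hinj : Function.Injective (algebraMap L[X] F) := IsFractionRing.injective _ _
    refine (isIntegral_algebraMap_iff (A := L[X]) (B := F) hinj).mp
      (isIntegral_of_forall_valuationSubring fun W hW => ?_)
    -- A valuation ring containing `A` restricts to one of `L` over `K`. There `f = a σ i`, so `f X
    -- = a (σ i X)` lies in `W`.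
    let W' : ValuationSubring L := W.comap ((algebraMap L[X] F).comp C)
    obtain ⟨i, hi⟩ := hV W' fun c => hW (algebraMap K A c)
    obtain ⟨a, ha, rfl⟩ := hi f hf
    have h1 : algebraMap L[X] F (C (σ i) * X) ∈ W :=
      hW ⟨C (σ i) * X, Algebra.subset_adjoin ⟨i, rfl⟩⟩
    have h2 := W.mul_mem _ _ ha h1
    change algebraMap L[X] F (C (a * σ i) * X) ∈ W
    rw [C_mul, mul_assoc, map_mul]
    exact h2
  obtain ⟨t, ht⟩ := fg_span_of_isIntegral K hint
  -- Without constant terms, the degree one coefficient of `a * g` is `a(0)` times that of `g`, and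
  -- `a(0) ∈ K` for `a ∈ A`.
  have h0 : ∀ g ∈ t, (g : L[X]).coeff 0 = 0 := by
    intro g hg
    have hg' : g ∈ Submodule.span A ((fun f : L => (C f * X : L[X])) '' V) :=
      ht ▸ Submodule.subset_span hg
    refine Submodule.span_induction (p := fun g _ => (g : L[X]).coeff 0 = 0) ?_ (by simp) ?_ ?_ hg'
    · rintro _ ⟨f, -, rfl⟩
      simp
    · intro x y _ _ hx hy
      rw [coeff_add, hx, hy, add_zero]
    · intro a x _ hx
      rw [Subalgebra.smul_def, smul_eq_mul, mul_coeff_zero, hx, mul_zero]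
  have hle : V ≤ Submodule.span K ((fun g : L[X] => g.coeff 1) '' t) := by
    intro f hf
    have hf' : (C f * X : L[X]) ∈ Submodule.span A (t : Set L[X]) :=
      ht ▸ Submodule.subset_span ⟨f, hf, rfl⟩
    obtain ⟨c, hc⟩ := (Submodule.mem_span_finset').mp hf'
    have h1 := congr_arg (fun g => coeff g 1) hc
    simp only [finsetSum_coeff, coeff_C_mul, coeff_X_one, mul_one, Subalgebra.smul_def,
      smul_eq_mul] at h1
    rw [← h1]
    refine Submodule.sum_mem _ fun g _ => ?_
    obtain ⟨b, hb⟩ := hA (c g)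
    have h2 : ((c g : L[X]) * g).coeff 1 = b • (g : L[X]).coeff 1 := by
      rw [mul_coeff_one, h0 g g.2, mul_zero, add_zero, hb, Algebra.smul_def]
    rw [h2]
    exact Submodule.smul_mem _ _ (Submodule.subset_span ⟨g, g.2, rfl⟩)
  have := FiniteDimensional.span_of_finite K ((Finset.finite_toSet t).image fun g => g.coeff 1)
  exact Submodule.finiteDimensional_of_le hle

end Finite

/-! ### Finite dimension of the space of sections -/

section AntiSections

variable {K : Type u} [Field K] [CharZero K] {X : Scheme.{u}} [X.Over (Spec (.of K))] [IsIntegral X]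
  {n : ℕ}

/-- If finitely many sections generate `𝒪_X(-k K_X)`, its space of sections has finite
dimension. -/
theorem finite_antiSections [IsProper (X ↘ Spec (.of K))] {ω : RatForm K X n} {k : ℕ} {ι : Type*}
    [Finite ι] (σ : ι → X.functionField)
    (hσ : ∀ x, ∃ i, antiCan ω k x = Submodule.span _ {σ i}) :
    Module.Finite K (antiSections ω k) := by
  refine finite_span_of_forall_valuationSubring σ _ fun W hW => ?_
  obtain ⟨x, hx⟩ := exists_localRing_le W hW
  obtain ⟨i, hi⟩ := hσ x
  refine ⟨i, fun f hf => ?_⟩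
  obtain ⟨a, ha, h⟩ := mem_span_singleton_iff_localRing.mp (hi ▸ hf x)
  exact ⟨a, hx ha, h⟩

end AntiSections

/-! ### Fractional stalks of ideal sheaves -/

section FracStalk

variable {X : Scheme.{u}} [IsIntegral X]

lemma fracStalk_mul (I J : X.IdealSheafData) (x : X) :
    fracStalk (I * J) x = fracStalk I x * fracStalk J x := by
  rw [fracStalk, stalkIdeal_mul]
  exact IsLocalization.coeSubmodule_mul _ _ _

lemma fracStalk_top (x : X) : fracStalk (⊤ : X.IdealSheafData) x = 1 := by
  rw [fracStalk, stalkIdeal_top]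
  exact IsLocalization.coeSubmodule_top _

lemma fracStalk_pow (I : X.IdealSheafData) (r : ℕ) (x : X) :
    fracStalk (I ^ r) x = fracStalk I x ^ r := by
  induction r with
  | zero => rw [pow_zero, pow_zero, Scheme.IdealSheafData.one_eq_top, fracStalk_top]
  | succ r ih => rw [pow_succ, pow_succ, fracStalk_mul, ih]

lemma fracStalk_mono {I J : X.IdealSheafData} (h : I ≤ J) (x : X) :
    fracStalk I x ≤ fracStalk J x :=
  Submodule.map_mono (stalkIdeal_mono h x)

end FracStalk

/-! ### Stalks of an affine spectrum -/

section SpecStalk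

/-- The homomorphism from a ring to the local ring of its spectrum at `P`. -/
def toSpecStalk (C : Type u) [CommRing C] (P : PrimeSpectrum C) :
    C →+* (Spec (.of C)).presheaf.stalk P :=
  ((Spec (.of C)).presheaf.germ ⊤ P (TopologicalSpace.Opens.mem_top P)).hom.comp
    (Scheme.ΓSpecIso (.of C)).inv.hom

variable {C : Type u} [CommRing C]

lemma toSpecStalk_isLocalization (P : PrimeSpectrum C) :
    letI := (toSpecStalk C P).toAlgebra
    IsLocalization.AtPrime ((Spec (.of C)).presheaf.stalk P) P.asIdeal :=
  StructureSheaf.IsLocalization.to_stalk C P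

lemma exists_toSpecStalk_mul_eq (P : PrimeSpectrum C) (z : (Spec (.of C)).presheaf.stalk P) :
    ∃ s ∉ P.asIdeal, ∃ c, toSpecStalk C P s * z = toSpecStalk C P c := by
  let := (toSpecStalk C P).toAlgebra
  have := toSpecStalk_isLocalization P
  obtain ⟨⟨c, s⟩, h⟩ := IsLocalization.surj P.asIdeal.primeCompl z
  exact ⟨s, s.2, c, (mul_comm _ _).trans h⟩

lemma toSpecStalk_injective [IsDomain C] (P : PrimeSpectrum C) :
    Function.Injective (toSpecStalk C P) := by
  let := (toSpecStalk C P).toAlgebra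
  have := toSpecStalk_isLocalization P
  exact IsLocalization.injective _ P.asIdeal.primeCompl_le_nonZeroDivisors

end SpecStalk

/-! ### Rational functions on a blowing up -/

section Blowup

variable {Y : Scheme.{u}}

lemma appLE_SpecMap_fromSpec {W : Y.Opens} (hW : IsAffineOpen W) {C : CommRingCat.{u}}
    (φ : Γ(Y, W) ⟶ C) (e : ⊤ ≤ (Spec.map φ ≫ hW.fromSpec) ⁻¹ᵁ W) :
    (Spec.map φ ≫ hW.fromSpec).appLE W ⊤ e = φ ≫ (Scheme.ΓSpecIso C).inv := by
  have h1 : hW.fromSpec.appLE W ⊤ hW.fromSpec_preimage_self.ge =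
      (Scheme.ΓSpecIso Γ(Y, W)).inv := by
    rw [Scheme.Hom.appLE, hW.fromSpec_app_self, Category.assoc, ← Functor.map_comp]
    exact (congr_arg _ ((Spec Γ(Y, W)).presheaf.map_id _)).trans (Category.comp_id _)
  have h2 : (Spec.map φ).appLE ⊤ ⊤ le_rfl = (Spec.map φ).appTop := Scheme.Hom.appLE_eq_app _
  rw [← Scheme.Hom.appLE_comp_appLE (Spec.map φ) hW.fromSpec W ⊤ ⊤
    hW.fromSpec_preimage_self.ge le_rfl, h1, h2, Scheme.ΓSpecIso_inv_naturality]

lemma stalkMap_mem_pow {Z : Scheme.{u}} (g : Z ⟶ Y) (J : Y.IdealSheafData) (r : ℕ) (z : Z)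
    {y : Y.presheaf.stalk (g z)} (hy : y ∈ stalkIdeal (J ^ r) (g z)) :
    g.stalkMap z y ∈ stalkIdeal (J.comap g) z ^ r := by
  have h3 := Ideal.mem_map_of_mem (g.stalkMap z).hom hy
  have h4 : (J ^ r).comap g = J.comap g ^ r := map_pow (comapHom g) _ _
  have h5 : stalkIdeal (J.comap g ^ r) z = stalkIdeal (J.comap g) z ^ r :=
    map_pow (stalkIdealHom z) _ _
  rw [← stalkIdeal_comap, h4, h5] at h3
  exact h3

/-- A rational function on `Y` that lies in `I ^ r 𝒪_B`, where `B` is the blowing up of `Y`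
along `I`, lies in `f ^ r R[I/f]` for each section `f` of `I` over an affine open set. -/
theorem IsBlowup.exists_mul_pow_eq [IsIntegral Y] {B : Scheme.{u}} [IsIntegral B] {p : B ⟶ Y}
    [IsDominant p] {I : Y.IdealSheafData} (hp : IsBlowup p I) (W : Y.affineOpens) [Nonempty W.1]
    {r : ℕ} {x : Y.functionField}
    (hx : ∀ b, p b ∈ W.1 → pullFun p x ∈ fracStalk (I.comap p) b ^ r) {f : Γ(Y, W.1)}
    (hf : f ∈ I.ideal W) : ∃ E, ∃ b ∈ I.ideal W ^ (E + r),
      x * algebraMap Γ(Y, W.1) Y.functionField f ^ E = algebraMap Γ(Y, W.1) Y.functionField b := by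
  have : IsFractionRing Γ(Y, W.1) Y.functionField :=
    functionField_isFractionRing_of_isAffineOpen Y W.1 W.2
  have hinj : Function.Injective (algebraMap Γ(Y, W.1) Y.functionField) :=
    IsFractionRing.injective _ _
  rcases eq_or_ne f 0 with rfl | hf0
  · exact ⟨1, 0, zero_mem _, by simp⟩
  have hf0' : algebraMap Γ(Y, W.1) Y.functionField f ≠ 0 := (map_ne_zero_iff _ hinj).mpr hf0
  let C := blowupChart Y.functionField (I.ideal W) hf
  let φ : Γ(Y, W.1) ⟶ CommRingCat.of C := CommRingCat.ofHom (algebraMap _ C)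
  suffices h : ∃ c : C, x = algebraMap C Y.functionField (algebraMap _ C f ^ r * c) by
    obtain ⟨⟨c, hc⟩, rfl⟩ := h
    obtain ⟨E, b, hb, hc'⟩ := id hc
    refine ⟨E, f ^ r * b, ?_, ?_⟩
    · rw [add_comm, pow_add]
      exact Ideal.mul_mem_mul (Ideal.pow_mem_pow hf r) hb
    · rw [map_mul, map_mul, map_pow, map_pow, mul_assoc]
      exact congr_arg _ hc'
  refine exists_eq_mul_of_forall_prime _ _ fun P hP => ?_
  have e : ⊤ ≤ (Spec.map φ ≫ W.2.fromSpec) ⁻¹ᵁ W.1 := fun z _ => by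
    have h : W.2.fromSpec (Spec.map φ z) ∈ Set.range W.2.fromSpec := ⟨_, rfl⟩
    rwa [W.2.range_fromSpec] at h
  have hq := appLE_SpecMap_fromSpec W.2 φ e
  generalize Spec.map φ ≫ W.2.fromSpec = q at e hq
  have htop : IsAffineOpen (⊤ : (Spec (.of C)).Opens) := isAffineOpen_top _
  have hinv : (I.comap q).ideal ⟨⊤, htop⟩ =
      Ideal.span {(Scheme.ΓSpecIso (.of C)).inv (algebraMap _ C f)} := by
    rw [ideal_comap q I W ⟨⊤, htop⟩ e, hq, CommRingCat.hom_comp, ← Ideal.map_map]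
    change Ideal.map _ (Ideal.map (algebraMap _ C) _) = _
    rw [map_blowupChart _ hf hf0', Ideal.map_span, Set.image_singleton]
  have hC0 : algebraMap _ C f ≠ 0 := fun h => hf0' (congr_arg (algebraMap C Y.functionField) h)
  -- The ideal becomes principal on the chart, so the chart maps to `B`. Only this morphism is
  -- needed; it is not identified with an open immersion.
  obtain ⟨g, hg, -⟩ := hp.existsUnique_lift _ q fun z => ⟨⟨⊤, htop⟩, trivial, _, by
    have hi := (ConcreteCategory.bijective_of_isIso (Scheme.ΓSpecIso (.of C)).inv).1
    exact mem_nonZeroDivisors_of_ne_zero ((map_ne_zero_iff _ hi).mpr hC0), hinv⟩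
  subst hg
  let z : Spec (.of C) := ⟨P, hP⟩
  have hz : p (g z) ∈ W.1 := e (x := z) trivial
  have hgerm : ∀ a : Γ(Y, W.1), g.stalkMap z (p.stalkMap (g z) (Y.presheaf.germ W.1 _ hz a)) =
      toSpecStalk C z (algebraMap _ C a) := by
    intro a
    have h1 := germ_stalkMap_eq_appLE (g ≫ p) W.1 ⊤ e z trivial hz
    rw [hq, Scheme.Hom.stalkMap_comp] at h1
    exact (congr_arg (fun k => k.hom a) h1).symm
  -- Dominance of `g` is not established, so rational functions cannot be pulled back along it.
  -- Writing `x = a / a'` turns membership in the fractional stalk into the identity `y a' = a` in a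
  -- local ring of `B`, which can be transported to the chart.
  obtain ⟨a, a', ha', rfl⟩ := IsFractionRing.div_surjective Γ(Y, W.1) x
  have ha0 : algebraMap Γ(Y, W.1) Y.functionField a' ≠ 0 :=
    (map_ne_zero_iff _ hinj).mpr (nonZeroDivisors.ne_zero ha')
  have hmem := hx (g z) hz
  rw [← fracStalk_pow] at hmem
  obtain ⟨y, hy, hyx⟩ := hmem
  have halg : ∀ c : Γ(Y, W.1), pullFun p (algebraMap Γ(Y, W.1) Y.functionField c) =
      algebraMap _ B.functionField (p.stalkMap (g z) (Y.presheaf.germ W.1 _ hz c)) := by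
    intro c
    rw [← pullFun_algebraMap]
    exact congr_arg _ (Scheme.algebraMap_germ_eq_germToFunctionField Y hz c).symm
  have hBinj : Function.Injective (algebraMap (B.presheaf.stalk (g z)) B.functionField) :=
    IsFractionRing.injective _ _
  have h1 : y * p.stalkMap (g z) (Y.presheaf.germ W.1 _ hz a') =
      p.stalkMap (g z) (Y.presheaf.germ W.1 _ hz a) := by
    refine hBinj ?_
    rw [map_mul, ← halg, ← halg]
    have hyx' : algebraMap _ B.functionField y = _ := hyx
    rw [hyx', ← map_mul, div_mul_cancel₀ _ ha0]
  have h2 := congr_arg (g.stalkMap z) h1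
  rw [map_mul, hgerm, hgerm] at h2
  have hst : stalkIdeal ((I.comap p).comap g) z =
      Ideal.span {toSpecStalk C z (algebraMap _ C f)} := by
    rw [← Scheme.IdealSheafData.comap_comp, stalkIdeal_eq _ ⟨⊤, htop⟩ trivial, hinv,
      Ideal.map_span, Set.image_singleton]
    rfl
  have hy2 : g.stalkMap z y ∈ Ideal.span {toSpecStalk C z (algebraMap _ C f ^ r)} := by
    have h3 := stalkMap_mem_pow g (I.comap p) r z hy
    rwa [hst, Ideal.span_singleton_pow, ← map_pow] at h3
  obtain ⟨y', hy'⟩ := Ideal.mem_span_singleton'.mp hy2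
  obtain ⟨s, hs, c, hc⟩ := exists_toSpecStalk_mul_eq z y'
  refine ⟨s, hs, c, ?_⟩
  have h5 : algebraMap _ C f ^ r * c * algebraMap _ C a' = s * algebraMap _ C a := by
    refine toSpecStalk_injective z ?_
    rw [map_mul _ s, ← h2, ← hy', map_mul, map_mul, ← hc]
    ring
  have h6 := congr_arg (algebraMap C Y.functionField) h5
  rw [map_mul, map_mul _ s] at h6
  have h7 : ∀ d : Γ(Y, W.1), algebraMap C Y.functionField (algebraMap _ C d) =
    algebraMap Γ(Y, W.1) Y.functionField d := fun _ => rfl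
  rw [h7, h7] at h6
  rw [← mul_div_assoc, div_eq_iff ha0, h6]

end Blowup

/-! ### Functions on the cylinder over an affine open set -/

section CylEval

open Polynomial

lemma affineSpace_eval₂Hom_bijective (n : Type u) (S : Scheme.{u}) [IsAffine S] :
    Function.Bijective (MvPolynomial.eval₂Hom (𝔸(n; S) ↘ S).appTop.hom (AffineSpace.coord S)) := by
  have h := AffineSpace.isoOfIsAffine_hom_appTop (n := n) S
  have h2 : CommRingCat.ofHom
      (MvPolynomial.eval₂Hom (𝔸(n; S) ↘ S).appTop.hom (AffineSpace.coord (n := n) S)) =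
      (Scheme.ΓSpecIso _).inv ≫ (AffineSpace.isoOfIsAffine n S).hom.appTop := by
    rw [h, Iso.inv_hom_id_assoc]
  have h3 : IsIso (CommRingCat.ofHom
      (MvPolynomial.eval₂Hom (𝔸(n; S) ↘ S).appTop.hom (AffineSpace.coord (n := n) S))) := by
    rw [h2]
    have : IsIso (AffineSpace.isoOfIsAffine n S).hom.appTop :=
      inferInstanceAs (IsIso (Scheme.Hom.app _ ⊤))
    exact IsIso.comp_isIso
  exact ConcreteCategory.bijective_of_isIso (CommRingCat.ofHom
    (MvPolynomial.eval₂Hom (𝔸(n; S) ↘ S).appTop.hom (AffineSpace.coord (n := n) S)))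

variable (X : Scheme.{u})

/-- The coordinate `t` over the preimage of an open set. -/
def cylT (U : X.Opens) : Γ(Cyl X, Cyl.proj X ⁻¹ᵁ U) :=
  (Cyl X).presheaf.map (homOfLE le_top).op (Cyl.t X)

/-- Polynomials in `t` as functions on the cylinder over an open set. -/
def cylEval (U : X.Opens) : Γ(X, U)[X] →+* Γ(Cyl X, Cyl.proj X ⁻¹ᵁ U) :=
  eval₂RingHom ((Cyl.proj X).app U).hom (cylT X U)

lemma opensRange_map_ι (U : X.Opens) : ∃ _ : IsOpenImmersion
    (AffineSpace.map PUnit.{u + 1} U.ι : 𝔸(PUnit.{u + 1}; U.toScheme) ⟶ Cyl X),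
    (AffineSpace.map PUnit.{u + 1} U.ι : 𝔸(PUnit.{u + 1}; U.toScheme) ⟶ Cyl X).opensRange =
      Cyl.proj X ⁻¹ᵁ U := by
  have h1 := AffineSpace.isPullback_map (n := PUnit.{u + 1}) U.ι
  have h2 := (isPullback_morphismRestrict (Cyl.proj X) U).flip
  let θ : 𝔸(PUnit.{u + 1}; U.toScheme) ≅ (Cyl.proj X ⁻¹ᵁ U).toScheme := h1.isoIsPullback _ _ h2
  have h3 : (AffineSpace.map PUnit.{u + 1} U.ι : 𝔸(PUnit.{u + 1}; U.toScheme) ⟶ Cyl X) =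
      θ.hom ≫ (Cyl.proj X ⁻¹ᵁ U).ι :=
    (h1.isoIsPullback_hom_fst _ _ h2).symm
  have h4 : ∀ ψ : 𝔸(PUnit.{u + 1}; U.toScheme) ⟶ Cyl X, ψ = θ.hom ≫ (Cyl.proj X ⁻¹ᵁ U).ι →
      ∃ _ : IsOpenImmersion ψ, ψ.opensRange = Cyl.proj X ⁻¹ᵁ U := by
    rintro _ rfl
    exact ⟨inferInstance, by rw [Scheme.Hom.opensRange_comp_of_isIso, Scheme.Opens.opensRange_ι]⟩
  exact h4 _ h3

/-- By base change the preimage of `U` is the affine line over `U`, whose functions are the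
polynomials in the coordinate. -/
theorem cylEval_bijective {U : X.Opens} (hU : IsAffineOpen U) :
    Function.Bijective (cylEval X U) := by
  have : IsAffine U.toScheme := hU
  let φ : 𝔸(PUnit.{u + 1}; U.toScheme) ⟶ Cyl X := AffineSpace.map PUnit.{u + 1} U.ι
  obtain ⟨_, hrange⟩ : ∃ _ : IsOpenImmersion φ, φ.opensRange = Cyl.proj X ⁻¹ᵁ U :=
    opensRange_map_ι X U
  have htop : φ ⁻¹ᵁ (Cyl.proj X ⁻¹ᵁ U) = ⊤ := by
    rw [← hrange]
    exact Scheme.Hom.preimage_opensRange φ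
  have hiso : IsIso (φ.appLE (Cyl.proj X ⁻¹ᵁ U) ⊤ htop.ge) := by
    have h1 : IsIso (φ.app (Cyl.proj X ⁻¹ᵁ U)) := φ.isIso_app _ hrange.ge
    have h2 : homOfLE htop.ge = eqToHom htop.symm := rfl
    rw [Scheme.Hom.appLE, h2]
    infer_instance
  have hbij := ConcreteCategory.bijective_of_isIso (φ.appLE (Cyl.proj X ⁻¹ᵁ U) ⊤ htop.ge)
  have hφ : φ ≫ Cyl.proj X = (𝔸(PUnit.{u + 1}; U.toScheme) ↘ U.toScheme) ≫ U.ι :=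
    AffineSpace.map_over U.ι
  have hproj : (Cyl.proj X).app U ≫ φ.appLE (Cyl.proj X ⁻¹ᵁ U) ⊤ htop.ge =
      U.topIso.inv ≫ (𝔸(PUnit.{u + 1}; U.toScheme) ↘ U.toScheme).appTop := by
    have h1 : ∀ (ψ : 𝔸(PUnit.{u + 1}; U.toScheme) ⟶ X) (e : ⊤ ≤ ψ ⁻¹ᵁ U),
        ψ = (𝔸(PUnit.{u + 1}; U.toScheme) ↘ U.toScheme) ≫ U.ι → ψ.appLE U ⊤ e =
          U.topIso.inv ≫ (𝔸(PUnit.{u + 1}; U.toScheme) ↘ U.toScheme).appTop := by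
      rintro _ e rfl
      rw [← Scheme.Hom.appLE_comp_appLE _ U.ι U ⊤ ⊤ (by simp) le_rfl]
      congr 1
      · simp only [Scheme.Hom.appLE, Scheme.Opens.topIso, Scheme.Opens.ι_app]
        exact (Functor.map_comp X.presheaf _ _).symm
      · exact Scheme.Hom.appLE_eq_app _
    exact (Scheme.Hom.comp_appLE φ (Cyl.proj X) U ⊤ htop.ge).symm.trans (h1 _ _ hφ)
  have ht : φ.appLE (Cyl.proj X ⁻¹ᵁ U) ⊤ htop.ge (cylT X U) = AffineSpace.coord U.toScheme ⟨⟩ := by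
    rw [← AffineSpace.map_appTop_coord U.ι]
    have h1 := Scheme.Hom.map_appLE φ htop.ge (homOfLE le_top).op
    refine (congr_arg (fun k => k.hom (Cyl.t X)) h1).trans ?_
    exact congr_arg (fun k => k.hom (Cyl.t X)) (Scheme.Hom.appLE_eq_app φ (U := ⊤))
  let e : Γ(X, U)[X] ≃+* MvPolynomial PUnit.{u + 1} Γ(U.toScheme, ⊤) :=
    (MvPolynomial.uniqueAlgEquiv Γ(X, U) PUnit.{u + 1}).symm.toRingEquiv.trans
      (MvPolynomial.mapEquiv _ U.topIso.symm.commRingCatIsoToRingEquiv)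
  have key : ((φ.appLE (Cyl.proj X ⁻¹ᵁ U) ⊤ htop.ge).hom.comp (cylEval X U)) =
      (MvPolynomial.eval₂Hom (𝔸(PUnit.{u + 1}; U.toScheme) ↘ U.toScheme).appTop.hom
        (AffineSpace.coord U.toScheme)).comp e.toRingHom := by
    refine Polynomial.ringHom_ext (fun a => ?_) ?_
    · simp only [cylEval, e, RingHom.comp_apply, coe_eval₂RingHom, eval₂_C]
      refine (congr_arg (fun k => k.hom a) hproj).trans ?_
      simp
      rfl
    · simpa [cylEval, e] using ht
  have h1 := ((affineSpace_eval₂Hom_bijective PUnit.{u + 1} U.toScheme).comp e.bijective)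
  have h2 : Function.Bijective (⇑(φ.appLE (Cyl.proj X ⁻¹ᵁ U) ⊤ htop.ge).hom ∘ ⇑(cylEval X U)) := by
    convert h1 using 1
    exact congr_arg DFunLike.coe key
  exact (hbij.of_comp_iff' _).mp h2

end CylEval

/-! ### Polynomials in `t` as rational functions on the cylinder -/

section CylFun
open Polynomial

lemma pullFun_comp {X Y Z : Scheme.{u}} [IsIntegral X] [IsIntegral Y] [IsIntegral Z] (f : Z ⟶ Y)
    (g : Y ⟶ X) [IsDominant f] [IsDominant g] (φ : X.functionField) :
    pullFun (f ≫ g) φ = pullFun f (pullFun g φ) := by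
  let z := genericPoint Z
  have h : ∀ a : X.presheaf.stalk (g (f z)), pullFun (f ≫ g) (algebraMap _ X.functionField a) =
      pullFun f (pullFun g (algebraMap _ X.functionField a)) := by
    intro a
    have h1 := pullFun_algebraMap (f ≫ g) z a
    have h2 : (f ≫ g).stalkMap z a = f.stalkMap z (g.stalkMap (f z) a) := by
      rw [Scheme.Hom.stalkMap_comp]
      rfl
    rw [pullFun_algebraMap, pullFun_algebraMap, ← h2]
    exact h1
  obtain ⟨a, b, -, rfl⟩ := IsFractionRing.div_surjective (X.presheaf.stalk (g (f z))) φ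
  rw [map_div₀, map_div₀, map_div₀, h, h]

lemma pullFun_germToFunctionField {X Y : Scheme.{u}} [IsIntegral X] [IsIntegral Y] (f : Y ⟶ X)
    [IsDominant f] (U : X.Opens) (V : Y.Opens) (e : V ≤ f ⁻¹ᵁ U) [Nonempty U] [Nonempty V]
    (a : Γ(X, U)) : pullFun f (algebraMap Γ(X, U) X.functionField a) =
      algebraMap Γ(Y, V) Y.functionField (f.appLE U V e a) := by
  obtain ⟨⟨y, hy⟩⟩ := ‹Nonempty V›
  have hfy : f y ∈ U := e hy
  have : Nonempty V := ⟨⟨y, hy⟩⟩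
  have h1 : algebraMap _ X.functionField (X.presheaf.germ U (f y) hfy a) =
      algebraMap Γ(X, U) X.functionField a := Scheme.algebraMap_germ_eq_germToFunctionField X hfy a
  have h2 : algebraMap _ Y.functionField (Y.presheaf.germ V y hy (f.appLE U V e a)) =
      algebraMap Γ(Y, V) Y.functionField (f.appLE U V e a) :=
    Scheme.algebraMap_germ_eq_germToFunctionField Y hy _
  rw [← h1, ← h2, pullFun_algebraMap]
  congr 1
  exact (congr_arg (fun k => k.hom a) (germ_stalkMap_eq_appLE f U V e y hy hfy)).symm

lemma nonempty_proj_preimage {X : Scheme.{u}} {U : X.Opens} [h : Nonempty U] :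
    Nonempty (Cyl.proj X ⁻¹ᵁ U) := by
  obtain ⟨⟨x, hx⟩⟩ := h
  obtain ⟨y, rfl⟩ := (Cyl.proj X).surjective x
  exact ⟨⟨y, hx⟩⟩

instance (X : Scheme.{u}) : IsAffineHom (Cyl.proj X) :=
  inferInstanceAs (IsAffineHom (𝔸(PUnit.{u + 1}; X) ↘ X))

/-- The cylinder over an affine open set. -/
abbrev cylOpen {X : Scheme.{u}} (U : X.affineOpens) : (Cyl X).affineOpens :=
  ⟨Cyl.proj X ⁻¹ᵁ U.1, U.2.preimage _⟩

variable (X : Scheme.{u}) [IsIntegral X]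

/-- Polynomials in `t` over the function field of `X` as rational functions on the cylinder. -/
def cylFun : X.functionField[X] →+* (Cyl X).functionField :=
  eval₂RingHom (pullFun (Cyl.proj X)) (tFun X)

lemma cylFun_C (a : X.functionField) : cylFun X (C a) = pullFun (Cyl.proj X) a := eval₂_C _ _

lemma cylFun_X : cylFun X Polynomial.X = tFun X := eval₂_X _ _

lemma algebraMap_cylEval (U : X.Opens) [Nonempty U] [Nonempty (Cyl.proj X ⁻¹ᵁ U)] (p : Γ(X, U)[X]) :
    algebraMap Γ(Cyl X, Cyl.proj X ⁻¹ᵁ U) (Cyl X).functionField (cylEval X U p) =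
      cylFun X (p.map (algebraMap Γ(X, U) X.functionField)) := by
  have h : (algebraMap Γ(Cyl X, Cyl.proj X ⁻¹ᵁ U) (Cyl X).functionField).comp (cylEval X U) =
      (cylFun X).comp (mapRingHom (algebraMap Γ(X, U) X.functionField)) := by
    refine Polynomial.ringHom_ext (fun a => ?_) ?_
    · simp only [RingHom.comp_apply, coe_mapRingHom, map_C, cylFun_C, cylEval, coe_eval₂RingHom,
        eval₂_C]
      rw [pullFun_germToFunctionField (Cyl.proj X) U (Cyl.proj X ⁻¹ᵁ U) le_rfl,
        Scheme.Hom.appLE_eq_app]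
    · simp only [RingHom.comp_apply, coe_mapRingHom, map_X, cylFun_X, cylEval, coe_eval₂RingHom,
        eval₂_X]
      exact (Cyl X).presheaf.germ_res_apply _ _ _ _
  exact congr_arg (fun k => k p) h

/-- Clear denominators over an affine chart, where the polynomial description of functions applies.
This transcendence of `t` is what makes the polynomials found on different charts coincide. -/
lemma cylFun_injective : Function.Injective (cylFun X) := by
  rw [injective_iff_map_eq_zero]
  intro p hp
  obtain ⟨U, hU⟩ := exists_affineOpens_mem (genericPoint X)
  have : Nonempty U.1 := ⟨⟨_, hU⟩⟩
  have : Nonempty (Cyl.proj X ⁻¹ᵁ U.1) := nonempty_proj_preimage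
  have : IsFractionRing Γ(X, U.1) X.functionField :=
    functionField_isFractionRing_of_isAffineOpen X U.1 U.2
  obtain ⟨b, hb, h⟩ := IsLocalization.integerNormalization_spec (nonZeroDivisors Γ(X, U.1)) p
  set q := IsLocalization.integerNormalization (nonZeroDivisors Γ(X, U.1)) p
  have h1 : cylFun X (q.map (algebraMap Γ(X, U.1) X.functionField)) = 0 := by
    rw [h, ← IsScalarTower.algebraMap_smul X.functionField, smul_eq_C_mul, map_mul, hp, mul_zero]
  rw [← algebraMap_cylEval] at h1
  have h2 : q = 0 := by
    refine (cylEval_bijective X U.2).1 ?_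
    rw [map_zero]
    exact Scheme.germToFunctionField_injective (Cyl X) _ (h1.trans (map_zero _).symm)
  exact (IsLocalization.integerNormalization_eq_zero_iff le_rfl p).mp h2

/-- The sections of the expansion are polynomials in `t` with coefficients in the ideals. -/
lemma exists_cylEval_eq_of_mem_tExpansion {X : Scheme.{u}} (N : ℕ) {J : ℕ → X.IdealSheafData}
    (hJ : Antitone J) (U : X.affineOpens) {b : Γ(Cyl X, Cyl.proj X ⁻¹ᵁ U.1)}
    (hb : b ∈ (tExpansion N J).ideal (cylOpen U)) :
    ∃ q : Γ(X, U.1)[X], b = cylEval X U.1 q ∧ ∀ i, q.coeff i ∈ (J (N - i)).ideal U := by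
  -- Stability under multiplication uses that `J` is decreasing: the coefficient of `t^i` in a
  -- product involves only coefficients of degree at most `i`, which lie in smaller ideals.
  let S : Ideal Γ(Cyl X, Cyl.proj X ⁻¹ᵁ U.1) :=
    { carrier := {b | ∃ q : Γ(X, U.1)[X], b = cylEval X U.1 q ∧
        ∀ i, q.coeff i ∈ (J (N - i)).ideal U}
      add_mem' := by
        rintro _ _ ⟨q, rfl, hq⟩ ⟨q', rfl, hq'⟩
        refine ⟨q + q', (map_add _ _ _).symm, fun i => ?_⟩
        rw [coeff_add]
        exact add_mem (hq i) (hq' i)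
      zero_mem' := ⟨0, (map_zero _).symm, fun i => by simp⟩
      smul_mem' := by
        rintro c _ ⟨q, rfl, hq⟩
        obtain ⟨p, rfl⟩ := (cylEval_bijective X U.2).2 c
        refine ⟨p * q, (map_mul _ _ _).symm, fun i => ?_⟩
        rw [coeff_mul]
        refine sum_mem fun x hx => Ideal.mul_mem_left _ _ ?_
        have : x.2 ≤ i := by
          have := Finset.HasAntidiagonal.mem_antidiagonal.mp hx
          omega
        exact hJ (show N - i ≤ N - x.2 by omega) U (hq x.2) }
  suffices h : (tExpansion N J).ideal (cylOpen U) ≤ S from h hb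
  refine Finset.sum_induction _ (fun I : (Cyl X).IdealSheafData => I.ideal (cylOpen U) ≤ S)
    (fun A B hA hB => sup_le hA hB) bot_le
    fun j hj => ?_
  have hj' := Finset.mem_range.mp hj
  have ht : (tIdeal X).ideal (cylOpen U) = Ideal.span {cylT X U.1} := by
    change Ideal.map _ (Ideal.span {Cyl.t X}) = _
    rw [Ideal.map_span, Set.image_singleton]
    rfl
  have hc : ((J j).comap (Cyl.proj X)).ideal (cylOpen U) =
      Ideal.span ((Cyl.proj X).app U.1 '' ((J j).ideal U : Set Γ(X, U.1))) := by
    have h := ideal_comap (Cyl.proj X) (J j) U (cylOpen U) le_rfl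
    rw [h]
    exact congr_arg (fun k : Γ(X, U.1) ⟶ Γ(Cyl X, Cyl.proj X ⁻¹ᵁ U.1) =>
      Ideal.map k.hom ((J j).ideal U)) (Scheme.Hom.appLE_eq_app _)
  have hmul : ((J j).comap (Cyl.proj X) * tIdeal X ^ (N - j)).ideal (cylOpen U) =
      Ideal.span ((Cyl.proj X).app U.1 '' ((J j).ideal U : Set Γ(X, U.1))) *
        Ideal.span {cylT X U.1} ^ (N - j) := by
    rw [← hc, ← ht]
    rfl
  rw [hmul, Ideal.span_singleton_pow, Ideal.span_mul_span']
  refine Ideal.span_le.mpr ?_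
  rintro _ ⟨_, ⟨a, ha, rfl⟩, _, rfl, rfl⟩
  refine ⟨C a * Polynomial.X ^ (N - j), ?_, fun i => ?_⟩
  · rw [map_mul, map_pow]
    simp only [cylEval, coe_eval₂RingHom, eval₂_C, eval₂_X]
  · rw [coeff_C_mul_X_pow]
    split_ifs with h
    · have : N - i = j := by omega
      rw [this]
      exact ha
    · exact zero_mem _

end CylFun

/-! ### Sections over the blowing up -/

section Sections
open Polynomial

section

variable {X : Scheme.{u}} {M : ℕ} {I : ℕ → X.IdealSheafData}

lemma IsFlag.tilde_antitone (h : IsFlag M I) (r : ℕ) : Antitone (tilde M I r) :=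
  antitone_nat_of_succ_le (tilde_anti h r)

lemma cylT_pow_mem_ideal (h : IsFlag M I) (U : X.affineOpens) :
    cylT X U.1 ^ M ∈ (tExpansion M I).ideal (cylOpen U) := by
  have h0 : (I 0).comap (Cyl.proj X) * tIdeal X ^ (M - 0) = tIdeal X ^ M := by
    rw [h.zero, Scheme.IdealSheafData.comap_top, Scheme.IdealSheafData.top_mul, Nat.sub_zero]
  have hle : tIdeal X ^ M ≤ tExpansion M I := by
    rw [← h0, tExpansion]
    exact Finset.single_le_sum (f := fun j => (I j).comap (Cyl.proj X) * tIdeal X ^ (M - j))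
      (fun _ _ => bot_le) (Finset.mem_range.2 (Nat.succ_pos M))
  refine hle (cylOpen U) ?_
  rw [Scheme.IdealSheafData.ideal_pow, Pi.pow_apply]
  exact Ideal.pow_mem_pow (Ideal.mem_map_of_mem _ (Ideal.mem_span_singleton_self _)) M

lemma cylT_ne_zero (U : X.affineOpens) [Nonempty U.1] : cylT X U.1 ≠ 0 := by
  intro h
  have h1 : cylEval X U.1 Polynomial.X = cylEval X U.1 0 := by
    rw [map_zero, ← h]
    exact eval₂_X _ _
  exact X_ne_zero ((cylEval_bijective X U.2).1 h1)

end

variable {K : Type u} [Field K] {X : Scheme.{u}} [X.Over (Spec (.of K))] [IsIntegral X]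
  {n M : ℕ} {I : ℕ → X.IdealSheafData}

lemma ideal_tExpansion_ne_bot (h : IsFlag M I) (U : X.affineOpens) [Nonempty U.1] :
    (tExpansion M I).ideal (cylOpen U) ≠ ⊥ := by
  have : Nonempty (Cyl.proj X ⁻¹ᵁ U.1) := nonempty_proj_preimage
  have : IsDomain Γ(Cyl X, Cyl.proj X ⁻¹ᵁ U.1) := inferInstance
  intro hbot
  have h1 := cylT_pow_mem_ideal h U
  rw [hbot] at h1
  exact pow_ne_zero M (cylT_ne_zero U) h1

instance [LocallyOfFiniteType (X ↘ Spec (.of K))] :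
    LocallyOfFiniteType (Cyl X ↘ Spec (.of K)) :=
  have : LocallyOfFiniteType (Cyl.proj X) :=
    inferInstanceAs (LocallyOfFiniteType (𝔸(PUnit.{u + 1}; X) ↘ X))
  inferInstanceAs (LocallyOfFiniteType (Cyl.proj X ≫ X ↘ Spec (.of K)))

/-- The powers of a flag ideal are eventually Ratliff-Rush closed. -/
lemma exists_forall_isPowMultiplier_tExpansion [CharZero K]
    [LocallyOfFiniteType (X ↘ Spec (.of K))] (h : IsFlag M I) (U : X.affineOpens) [Nonempty U.1]
    [Nonempty (cylOpen U).1] :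
    ∃ r₀, ∀ r ≥ r₀, ∀ x : (Cyl X).functionField,
      IsPowMultiplier ((tExpansion M I).ideal (cylOpen U)) r x →
      ∃ b ∈ (tExpansion M I).ideal (cylOpen U) ^ r, x = algebraMap _ (Cyl X).functionField b := by
  have : IsFractionRing Γ(Cyl X, (cylOpen U).1) (Cyl X).functionField :=
    functionField_isFractionRing_of_isAffineOpen (Cyl X) _ (cylOpen U).2
  have : Algebra.FiniteType K Γ(Cyl X, (cylOpen U).1) :=
    constSection_finiteType (Cyl X) (cylOpen U)
  exact exists_forall_isPowMultiplier K (ideal_tExpansion_ne_bot h U)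

lemma mem_bundleStalk_iff {ω : RatForm K X n} {𝓘 : (Cyl X).IdealSheafData} {B : Scheme.{u}}
    [IsIntegral B] {p : B ⟶ Cyl X} [IsDominant p] {k r : ℕ} {b : B} {g : X.functionField}
    (hg : antiCan ω k ((p ≫ Cyl.proj X) b) = Submodule.span _ {g}) {φ : B.functionField} :
    φ ∈ bundleStalk ω 𝓘 p k r b ↔ ∃ y ∈ fracStalk (𝓘.comap p) b ^ r,
      pullFun (p ≫ Cyl.proj X) g * y = φ := by
  have h : Submodule.span (B.presheaf.stalk b) (pullFun (p ≫ Cyl.proj X) ''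
      (antiCan ω k ((p ≫ Cyl.proj X) b))) = Submodule.span _ {pullFun (p ≫ Cyl.proj X) g} := by
    refine le_antisymm (Submodule.span_le.mpr ?_) (Submodule.span_mono ?_)
    · rintro _ ⟨f, hf, rfl⟩
      rw [hg] at hf
      obtain ⟨a, rfl⟩ := Submodule.mem_span_singleton.mp hf
      rw [Algebra.smul_def, map_mul, pullFun_algebraMap, ← Algebra.smul_def]
      exact Submodule.smul_mem _ _ (Submodule.mem_span_singleton_self _)
    · rw [Set.singleton_subset_iff]
      exact ⟨g, hg ▸ Submodule.mem_span_singleton_self g, rfl⟩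
  rw [bundleStalk, h, Submodule.mem_span_singleton_mul]

/-- Sections over the blowing up, in terms of polynomials in `t` over an affine open set. -/
theorem FlagBlowup.exists_polynomial_of_mem_sections (T : FlagBlowup M I)
    [IsLocallyNoetherian (Cyl X)] {ω : RatForm K X n} {k r : ℕ} (U : X.affineOpens) [Nonempty U.1]
    [Nonempty (cylOpen U).1] {g : X.functionField} (hg0 : g ≠ 0)
    (hg : ∀ y ∈ U.1, antiCan ω k y = Submodule.span _ {g})
    (hr : ∀ x : (Cyl X).functionField, IsPowMultiplier ((tExpansion M I).ideal (cylOpen U)) r x →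
      ∃ b ∈ (tExpansion M I).ideal (cylOpen U) ^ r, x = algebraMap _ (Cyl X).functionField b)
    {f : (Cyl X).functionField} (hf : f ∈ T.sections ω k r) :
    ∃ q : Γ(X, U.1)[X], f = cylFun X (C g * q.map (algebraMap Γ(X, U.1) X.functionField)) ∧
      ∀ i, q.coeff i ∈ (tilde M I r (M * r - i)).ideal U := by
  have hg0' : pullFun (Cyl.proj X) g ≠ 0 := (map_ne_zero_iff _ (RingHom.injective _)).mpr hg0
  have : IsNoetherianRing Γ(Cyl X, (cylOpen U).1) :=
    IsLocallyNoetherian.component_noetherian (cylOpen U)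
  -- Dividing by the generator `g` trivializes the line bundle, leaving a rational function that
  -- lies in the `r`-th power of the ideal on `B`.
  obtain ⟨b, hb, hfb⟩ := hr (f / pullFun (Cyl.proj X) g)
    (isPowMultiplier_of_forall (IsNoetherian.noetherian _) fun a ha =>
      T.isBlowup.exists_mul_pow_eq (cylOpen U) (fun b hb => by
        obtain ⟨y, hy, h⟩ := (mem_bundleStalk_iff (hg _ hb)).mp (hf b)
        rw [map_div₀, ← h, ← pullFun_comp, mul_div_cancel_left₀]
        · exact hy
        · exact (map_ne_zero_iff _ (RingHom.injective _)).mpr hg0) ha)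
  have h1 : (tExpansion M I).ideal (cylOpen U) ^ r =
      (tExpansion (M * r) (tilde M I r)).ideal (cylOpen U) := by
    rw [← tExpansion_pow, Scheme.IdealSheafData.ideal_pow, Pi.pow_apply]
  rw [h1] at hb
  obtain ⟨q, rfl, hq⟩ := exists_cylEval_eq_of_mem_tExpansion (M * r)
    (T.isFlag.tilde_antitone r) U hb
  refine ⟨q, ?_, hq⟩
  have : Nonempty (Cyl.proj X ⁻¹ᵁ U.1) := nonempty_proj_preimage
  rw [map_mul, cylFun_C, ← algebraMap_cylEval]
  exact ((div_eq_iff hg0').mp hfb).trans (mul_comm _ _)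

/-- The exponent `i` may exceed `N - j`, as divisibility by `t^(N-j)` is enough; this covers the
degrees beyond `N`, where the index is truncated to `j = 0`. -/
lemma mul_t_pow_mem_stalkIdeal {X : Scheme.{u}} {N j i : ℕ} {J : ℕ → X.IdealSheafData} (hj : j ≤ N)
    (hi : N - j ≤ i) {B : Scheme.{u}} (p : B ⟶ Cyl X) (b : B)
    {v : X.presheaf.stalk ((p ≫ Cyl.proj X) b)} (hv : v ∈ stalkIdeal (J j) ((p ≫ Cyl.proj X) b)) :
    (p ≫ Cyl.proj X).stalkMap b v * p.stalkMap b
      ((Cyl X).presheaf.germ ⊤ (p b) (TopologicalSpace.Opens.mem_top _) (Cyl.t X)) ^ i ∈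
        stalkIdeal ((tExpansion N J).comap p) b := by
  have hle : (J j).comap (p ≫ Cyl.proj X) * (tIdeal X).comap p ^ (N - j) ≤
      (tExpansion N J).comap p := by
    have h1 : (J j).comap (Cyl.proj X) * tIdeal X ^ (N - j) ≤ tExpansion N J :=
      Finset.single_le_sum (f := fun j => (J j).comap (Cyl.proj X) * tIdeal X ^ (N - j))
        (fun _ _ => bot_le) (Finset.mem_range.2 (Nat.lt_succ_of_le hj))
    have h2 : ((J j).comap (Cyl.proj X) * tIdeal X ^ (N - j)).comap p =
        (J j).comap (p ≫ Cyl.proj X) * (tIdeal X).comap p ^ (N - j) := by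
      rw [comap_mul, Scheme.IdealSheafData.comap_comp]
      congr 1
      exact map_pow (comapHom p) _ _
    rw [← h2]
    exact Scheme.IdealSheafData.comap_mono _ h1
  refine stalkIdeal_mono hle b ?_
  have h3 : stalkIdeal ((tIdeal X).comap p ^ (N - j)) b =
      stalkIdeal ((tIdeal X).comap p) b ^ (N - j) :=
    map_pow (stalkIdealHom b) _ _
  rw [stalkIdeal_mul, h3]
  refine Ideal.mul_mem_mul ?_ (Ideal.pow_le_pow_right hi (Ideal.pow_mem_pow ?_ i))
  · rw [stalkIdeal_comap]
    exact Ideal.mem_map_of_mem _ hv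
  · rw [stalkIdeal_comap]
    refine Ideal.mem_map_of_mem _ ?_
    obtain ⟨U, hU⟩ := exists_affineOpens_mem (p b)
    rw [stalkIdeal_eq _ U hU, ← (Cyl X).presheaf.germ_res_apply (homOfLE le_top) (p b) hU]
    exact Ideal.mem_map_of_mem _ (Ideal.mem_map_of_mem _ (Ideal.mem_span_singleton_self _))

/-- The sections over the blowing up are the polynomials in `t` with coefficients in the members
of the filtration. -/
theorem FlagBlowup.mem_sections_iff (T : FlagBlowup M I) [IsLocallyNoetherian (Cyl X)]
    {ω : RatForm K X n} {k r : ℕ}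
    (h : ∀ x : X, ∃ (U : X.affineOpens) (g : X.functionField), x ∈ U.1 ∧ g ≠ 0 ∧
      (∀ y ∈ U.1, antiCan ω k y = Submodule.span _ {g}) ∧
      ∀ [Nonempty (cylOpen U).1], ∀ x : (Cyl X).functionField,
        IsPowMultiplier ((tExpansion M I).ideal (cylOpen U)) r x →
        ∃ b ∈ (tExpansion M I).ideal (cylOpen U) ^ r, x = algebraMap _ (Cyl X).functionField b)
    {f : (Cyl X).functionField} : f ∈ T.sections ω k r ↔
      ∃ q : X.functionField[X], f = cylFun X q ∧ ∀ i, q.coeff i ∈ filt ω k M I r (M * r - i) := by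
  constructor
  · intro hf
    have key : ∀ x : X, ∃ q : X.functionField[X], f = cylFun X q ∧ ∀ i,
        q.coeff i ∈ antiCan ω k x * fracStalk (tilde M I r (M * r - i)) x := by
      intro x
      obtain ⟨U, g, hx, hg0, hg, hr⟩ := h x
      have : Nonempty U.1 := ⟨⟨x, hx⟩⟩
      have : Nonempty (cylOpen U).1 := nonempty_proj_preimage
      obtain ⟨q, hq, hqi⟩ := T.exists_polynomial_of_mem_sections U hg0 hg hr hf
      refine ⟨_, hq, fun i => ?_⟩
      rw [coeff_C_mul, coeff_map]
      refine Submodule.mul_mem_mul ?_ ?_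
      · rw [hg x hx]
        exact Submodule.mem_span_singleton_self g
      · refine ⟨X.presheaf.germ U.1 x hx (q.coeff i), ?_,
          Scheme.algebraMap_germ_eq_germToFunctionField X hx _⟩
        rw [stalkIdeal_eq _ U hx]
        exact Ideal.mem_map_of_mem _ (hqi i)
    -- The polynomial found at one point is the one found at every other, so its coefficients
    -- satisfy all the stalk conditions.
    obtain ⟨q, rfl, -⟩ := key (genericPoint X)
    refine ⟨q, rfl, fun i x => ?_⟩
    obtain ⟨q', hq', hqi⟩ := key x
    rw [cylFun_injective X hq']
    exact hqi i
  · rintro ⟨q, rfl, hq⟩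
    have hsum : cylFun X q = ∑ i ∈ q.support, pullFun (Cyl.proj X) (q.coeff i) * tFun X ^ i := by
      rw [cylFun, coe_eval₂RingHom, eval₂_eq_sum, Polynomial.sum]
    rw [hsum]
    refine Submodule.sum_mem _ fun i _ b => ?_
    rw [map_mul, map_pow, ← pullFun_comp]
    have ht : pullFun T.p (tFun X) = algebraMap (T.B.presheaf.stalk b) T.B.functionField
        (T.p.stalkMap b ((Cyl X).presheaf.germ ⊤ (T.p b)
          (TopologicalSpace.Opens.mem_top _) (Cyl.t X))) := by
      rw [← pullFun_algebraMap]
      have : Nonempty (⊤ : (Cyl X).Opens) := ⟨⟨T.p b, trivial⟩⟩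
      exact congr_arg _ (Scheme.algebraMap_germ_eq_germToFunctionField (Cyl X)
        (TopologicalSpace.Opens.mem_top (T.p b)) (Cyl.t X)).symm
    refine Submodule.mul_induction_on (hq i ((T.p ≫ Cyl.proj X) b)) (fun u hu v hv => ?_)
      fun u v hu hv => ?_
    · obtain ⟨v, hv, rfl⟩ := hv
      rw [map_mul, mul_assoc]
      refine Submodule.mul_mem_mul (Submodule.subset_span ⟨u, hu, rfl⟩) ?_
      rw [← fracStalk_pow, ← show (tExpansion M I ^ r).comap T.p = (tExpansion M I).comap T.p ^ r from
        map_pow (comapHom T.p) _ _, tExpansion_pow]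
      refine ⟨_, mul_t_pow_mem_stalkIdeal (N := M * r) (j := M * r - i) (i := i) (by omega) (by omega)
        T.p b hv, ?_⟩
      rw [Algebra.linearMap_apply, map_mul, map_pow, ← ht]
      congr 1
      exact (pullFun_algebraMap _ _ _).symm
    · rw [map_add, add_mul]
      exact Submodule.add_mem _ hu hv

end Sections

/-! ### The Rees-type module of a filtration modulo `t` -/

section PolyFilt
open Polynomial

variable {K L : Type*} [Field K] [Field L] [Algebra K L]

/-- The polynomials whose coefficient at `t ^ i` lies in the member `F (n - i)` of a filtration. -/
def polyFilt (n : ℕ) (F : ℕ → Submodule K L) : Submodule K L[X] where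
  -- The subtraction is truncated: from degree `n` on, the condition is membership in `F 0`.
  carrier := {q | ∀ i, q.coeff i ∈ F (n - i)}
  add_mem' hp hq i := by
    rw [coeff_add]
    exact add_mem (hp i) (hq i)
  zero_mem' i := by simp
  smul_mem' c q hq i := by
    rw [coeff_smul]
    exact Submodule.smul_mem _ _ (hq i)

variable {n N : ℕ} {F : ℕ → Submodule K L} (β : Module.Basis (Fin N) K (F 0)) (v : Fin N → ℕ)

/-- The basis `β` is adapted to the filtration `F`, and `v` records the jumps. -/
structure IsAdapted (n : ℕ) : Prop where
  le : ∀ i, v i ≤ n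
  mem_iff : ∀ j ≤ n, ∀ x : F 0, (x : L) ∈ F j ↔ ∀ i, v i < j → β.repr x i = 0

theorem exists_isAdapted (n : ℕ) (F : ℕ → Submodule K L) (hF : ∀ j < n, F (j + 1) ≤ F j)
    [Module.Finite K (F 0)] {N : ℕ} (hN : N = Module.finrank K (F 0)) :
    ∃ (β : Module.Basis (Fin N) K (F 0)) (v : Fin N → ℕ), IsAdapted β v n ∧
      ∑ j ∈ Finset.Icc 1 n, Module.finrank K (F j) = ∑ i, v i := by
  subst hN
  obtain ⟨b, v, hb, hv, hspan, hsum⟩ := exists_adapted_basis n F hF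
  have h0 : F 0 = Submodule.span K (Set.range b) :=
    (hspan 0 (Nat.zero_le n)).trans (by simp)
  have hb0 : ∀ i, b i ∈ F 0 := fun i => h0 ▸ Submodule.subset_span ⟨i, rfl⟩
  let b' : Fin (Module.finrank K (F 0)) → F 0 := fun i => ⟨b i, hb0 i⟩
  have hb' : LinearIndependent K b' := LinearIndependent.of_comp (F 0).subtype hb
  have himage : ∀ s : Set (Fin (Module.finrank K (F 0))),
      (Submodule.span K (b' '' s)).map (F 0).subtype = Submodule.span K (b '' s) := fun s => by
    rw [Submodule.map_span, ← Set.image_comp]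
    rfl
  have hmem : ∀ (s : Set (Fin (Module.finrank K (F 0)))) (x : F 0),
      (x : L) ∈ Submodule.span K (b '' s) ↔ x ∈ Submodule.span K (b' '' s) := fun s x => by
    rw [← himage s]
    exact (F 0).injective_subtype.mem_set_image (s := (Submodule.span K (b' '' s) : Set (F 0)))
  let β : Module.Basis _ K (F 0) := Module.Basis.mk hb' fun x _ => by
    rw [← Set.image_univ, ← hmem, Set.image_univ]
    exact h0.le x.2
  have hβ : (β : _ → F 0) = b' := Module.Basis.coe_mk _ _
  refine ⟨β, v, ⟨hv, fun j hj x => ?_⟩, hsum⟩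
  rw [hspan j hj, hmem, ← hβ, β.mem_span_image]
  constructor
  · intro h i hi
    by_contra h0
    exact hi.not_ge (h (Finsupp.mem_support_iff.mpr h0))
  · intro h i hi
    by_contra h0
    exact Finsupp.mem_support_iff.mp hi (h i (not_le.mp h0))

variable {β v}

variable (β v) in
/-- The leading coordinates of a polynomial with coefficients in the members of a filtration. -/
def leadingCoords (n : ℕ) (hF : ∀ j, F j ≤ F 0) : polyFilt n F →ₗ[K] (Fin N → K) where
  -- Modulo `t`, an adapted basis vector `β j` survives in degree `n - v j` only: in lower degrees
  -- it is not allowed, in higher degrees it is a multiple of `t`.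
  toFun q j := β.repr ⟨(q : L[X]).coeff (n - v j), hF _ (q.2 _)⟩ j
  map_add' q q' := by
    ext j
    rw [Pi.add_apply, ← Finsupp.add_apply, ← map_add]
    congr 3
  map_smul' c q := by
    ext j
    rw [RingHom.id_apply, Pi.smul_apply, ← Finsupp.smul_apply, ← map_smul]
    congr 3

lemma IsAdapted.self_mem (h : IsAdapted β v n) (j : Fin N) : (β j : L) ∈ F (v j) := by
  rw [h.mem_iff _ (h.le j)]
  intro i hi
  rw [β.repr_self, Finsupp.single_eq_of_ne]
  rintro rfl
  exact lt_irrefl _ hi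

lemma IsAdapted.monomial_mem (h : IsAdapted β v n) (j : Fin N) :
    (monomial (n - v j) (β j : L) : L[X]) ∈ polyFilt n F := by
  intro i
  rw [coeff_monomial]
  split_ifs with hi
  · rw [← hi, Nat.sub_sub_self (h.le j)]
    exact h.self_mem j
  · exact zero_mem _

lemma IsAdapted.leadingCoords_monomial (h : IsAdapted β v n) (hF : ∀ j, F j ≤ F 0) (j : Fin N) :
    leadingCoords β v n hF ⟨_, h.monomial_mem j⟩ = Pi.single j 1 := by
  ext i
  change β.repr ⟨(monomial (n - v j) (β j : L)).coeff (n - v i), _⟩ i = _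
  by_cases hij : i = j
  · subst hij
    have h1 : (⟨(monomial (n - v i) (β i : L)).coeff (n - v i), hF _ (h.monomial_mem i _)⟩ : F 0) =
        β i := Subtype.ext (coeff_monomial_same _ _)
    rw [h1, β.repr_self, Finsupp.single_eq_same, Pi.single_eq_same]
  · rw [Pi.single_eq_of_ne hij]
    by_cases hv : n - v j = n - v i
    · have h1 : (⟨(monomial (n - v j) (β j : L)).coeff (n - v i), hF _ (h.monomial_mem j _)⟩ : F 0) =
          β j := Subtype.ext ((congr_arg _ hv.symm).trans (coeff_monomial_same _ _))
      rw [h1, β.repr_self, Finsupp.single_eq_of_ne hij]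
    · have h1 : (⟨(monomial (n - v j) (β j : L)).coeff (n - v i), hF _ (h.monomial_mem j _)⟩ : F 0) =
          0 := Subtype.ext (coeff_monomial_of_ne _ (Ne.symm hv))
      rw [h1, map_zero, Finsupp.zero_apply]

lemma IsAdapted.leadingCoords_surjective (h : IsAdapted β v n) (hF : ∀ j, F j ≤ F 0) :
    Function.Surjective (leadingCoords β v n hF) := by
  intro c
  refine ⟨∑ j, c j • ⟨_, h.monomial_mem j⟩, ?_⟩
  simp only [map_sum, map_smul, h.leadingCoords_monomial hF]
  ext i
  simp [Finset.sum_apply, Pi.single_apply]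

/-- The leading coordinates vanish exactly on the multiples of `t`. -/
lemma IsAdapted.leadingCoords_eq_zero_iff (h : IsAdapted β v n) (hF : ∀ j, F j ≤ F 0)
    (q : polyFilt n F) : leadingCoords β v n hF q = 0 ↔ ∃ p ∈ polyFilt n F, (q : L[X]) = X * p := by
  constructor
  · intro hq
    have hq' : ∀ j, β.repr ⟨(q : L[X]).coeff (n - v j), hF _ (q.2 _)⟩ j = 0 := fun j =>
      congr_fun hq j
    -- Here `m = n - i + 1`, one step deeper than required: coordinates with `v j < n - i` vanish
    -- because `q` is in the module, those with `v j = n - i` because its leading coordinates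
    -- vanish. This extra step makes the quotient by `t` a member again.
    have hmem : ∀ i ≤ n, ∀ m ≤ n, n - i < m → m ≤ n - i + 1 → (q : L[X]).coeff i ∈ F m := by
      intro i hin m hm h1 h2
      have h3 := (h.mem_iff (n - i) (by omega) ⟨_, hF _ (q.2 i)⟩).mp (q.2 i)
      refine (h.mem_iff m hm ⟨_, hF _ (q.2 i)⟩).mpr fun j hj => ?_
      by_cases hj' : v j < n - i
      · exact h3 j hj'
      · have h7 := h.le j
        have h4 : n - v j = i := by omega
        have h5 := hq' j
        simp only [h4] at h5
        exact h5
    have h0 : (q : L[X]).coeff 0 = 0 := by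
      have h3 := (h.mem_iff n le_rfl ⟨_, hF _ (q.2 0)⟩).mp (q.2 0)
      have h4 : (⟨_, hF _ (q.2 0)⟩ : F 0) = 0 := by
        refine β.repr.map_eq_zero_iff.mp (Finsupp.ext fun j => ?_)
        rcases (h.le j).lt_or_eq with hj | hj
        · exact h3 j hj
        · have h5 := hq' j
          have h6 : n - v j = 0 := by omega
          simp only [h6] at h5
          exact h5
      exact congr_arg Subtype.val h4
    refine ⟨(q : L[X]).divX, fun i => ?_, ?_⟩
    · rw [coeff_divX]
      by_cases hi : i < n
      · exact hmem (i + 1) (by omega) (n - i) (by omega) (by omega) (by omega)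
      · have := q.2 (i + 1)
        rwa [show n - (i + 1) = n - i by omega] at this
    · conv_lhs => rw [← X_mul_divX_add (q : L[X]), h0, C_0, add_zero]
  · rintro ⟨p, hp, hqp⟩
    ext j
    change β.repr ⟨(q : L[X]).coeff (n - v j), _⟩ j = 0
    have hj := h.le j
    rcases hj.lt_or_eq with hlt | heq
    · obtain ⟨d, hd⟩ : ∃ d, n - v j = d + 1 := ⟨n - v j - 1, by omega⟩
      have h1 : (q : L[X]).coeff (n - v j) ∈ F (v j + 1) := by
        rw [hqp, hd, coeff_X_mul]
        have := hp d
        rwa [show n - d = v j + 1 by omega] at this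
      exact (h.mem_iff (v j + 1) hlt ⟨_, hF _ (q.2 _)⟩).mp h1 j (Nat.lt_succ_self _)
    · have h1 : (⟨(q : L[X]).coeff (n - v j), hF _ (q.2 _)⟩ : F 0) = 0 :=
        Subtype.ext (by
          change (q : L[X]).coeff (n - v j) = 0
          rw [hqp, heq, Nat.sub_self]
          simp)
      rw [h1, map_zero, Finsupp.zero_apply]

end PolyFilt

/-! ### The action of the torus and the total weight -/

section Weights
open Polynomial

variable {K : Type u} [Field K]

lemma stalkMap_constStalk {X Y : Scheme.{u}} [X.Over (Spec (.of K))] (f : Y ⟶ X)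
    {g : Y ⟶ Spec (.of K)} (h : f ≫ X ↘ Spec (.of K) = g) (y : Y) (c : K) :
    f.stalkMap y (constStalk X (f y) c) =
      Y.presheaf.germ ⊤ y (TopologicalSpace.Opens.mem_top y)
        (g.appTop ((Scheme.ΓSpecIso (.of K)).inv c)) := by
  subst h
  rw [Scheme.Hom.comp_appTop]
  exact Scheme.Hom.germ_stalkMap_apply f ⊤ y (TopologicalSpace.Opens.mem_top _)
    ((X ↘ Spec (.of K)).appTop ((Scheme.ΓSpecIso (.of K)).inv c))

lemma pullFun_algebraMap_const {X Y : Scheme.{u}} [IsIntegral X] [IsIntegral Y]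
    [X.Over (Spec (.of K))] [Y.Over (Spec (.of K))] (f : Y ⟶ X) [IsDominant f]
    (h : f ≫ X ↘ Spec (.of K) = Y ↘ Spec (.of K)) (c : K) :
    pullFun f (algebraMap K X.functionField c) = algebraMap K Y.functionField c := by
  rw [← algebraMap_constStalk X (f (genericPoint Y)), pullFun_algebraMap,
    stalkMap_constStalk f h, ← algebraMap_constStalk Y (genericPoint Y)]
  rfl

variable {X : Scheme.{u}} [X.Over (Spec (.of K))] [IsIntegral X]

variable (K X) in
/-- Evaluation of polynomials over the function field of `X` at `t`, as a `K`-linear map. -/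
def cylLinearMap : X.functionField[X] →ₗ[K] (Cyl X).functionField where
  toFun := cylFun X
  map_add' := map_add _
  map_smul' c q := by
    rw [RingHom.id_apply, Algebra.smul_def, Algebra.smul_def, map_mul,
      ← pullFun_algebraMap_const (Cyl.proj X) rfl, ← cylFun_C]
    rfl

lemma rot_pullFun_proj (a : Kˣ) (b : X.functionField) :
    rot a (pullFun (Cyl.proj X) b) = pullFun (Cyl.proj X) b := by
  have key : ∀ (g : Cyl X ⟶ X) [IsDominant g], g = Cyl.proj X →
      pullFun g b = pullFun (Cyl.proj X) b := by
    rintro g _ rfl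
    rfl
  rw [rot, ← pullFun_comp]
  exact key _ (Cyl.act_proj X a⁻¹)

lemma rot_tFun (a : Kˣ) :
    rot a (tFun X) = algebraMap K (Cyl X).functionField ((a⁻¹ : Kˣ) : K) * tFun X := by
  have : Nonempty (⊤ : (Cyl X).Opens) := ⟨⟨genericPoint (Cyl X), trivial⟩⟩
  have h := pullFun_germToFunctionField (Cyl.act X a⁻¹) ⊤ ⊤ le_rfl (Cyl.t X)
  have h2 : (Cyl.act X a⁻¹).appLE ⊤ ⊤ le_rfl (Cyl.t X) =
      Cyl.const X ((a⁻¹ : Kˣ) : K) * Cyl.t X := by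
    rw [← Cyl.act_t]
    exact congr_arg (fun g => g.hom (Cyl.t X)) (Scheme.Hom.app_eq_appLE (Cyl.act X a⁻¹)).symm
  rw [h2, map_mul] at h
  exact h

lemma rot_cylFun_monomial (a : Kˣ) (d : ℕ) (b : X.functionField) :
    rot a (cylFun X (monomial d b)) =
      ((a ^ (-(d : ℤ)) : Kˣ) : K) • cylFun X (monomial d b) := by
  rw [← C_mul_X_pow_eq_monomial, map_mul, map_pow, cylFun_C, cylFun_X, map_mul, map_pow,
    rot_pullFun_proj, rot_tFun, Algebra.smul_def, mul_pow, ← map_pow, zpow_neg, zpow_natCast,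
    ← inv_pow, Units.val_pow_eq_pow_val]
  ring

/-- The total weight of the `t`-filtered module attached to a filtration with an adapted basis. -/
theorem hasTotalWeight_of_isAdapted {H : Submodule K (Cyl X).functionField} {n N : ℕ}
    {F : ℕ → Submodule K X.functionField} {β : Module.Basis (Fin N) K (F 0)} {v : Fin N → ℕ}
    (h : IsAdapted β v n) (hF : ∀ j, F j ≤ F 0)
    (hH : ∀ f, f ∈ H ↔ ∃ q : X.functionField[X], f = cylFun X q ∧ ∀ i, q.coeff i ∈ F (n - i)) :
    HasTotalWeight H (∑ i, (v i : ℤ) - N * n) := by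
  have hmap : H = (polyFilt n F).map (cylLinearMap K X) := by
    ext f
    rw [hH]
    exact ⟨fun ⟨q, hq, hi⟩ => ⟨q, hi, hq.symm⟩, fun ⟨q, hi, hq⟩ => ⟨q, hq.symm, hi⟩⟩
  subst hmap
  have hinj : Function.Injective (cylLinearMap K X) := cylFun_injective X
  set H := (polyFilt n F).map (cylLinearMap K X)
  let φ : polyFilt n F ≃ₗ[K] H := Submodule.equivMapOfInjective _ hinj _
  have hφ : ∀ q, (φ q : (Cyl X).functionField) = cylFun X q := fun q => rfl
  let ψ : H →ₗ[K] (Fin N → K) := leadingCoords β v n hF ∘ₗ φ.symm.toLinearMap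
  have hψ : Function.Surjective ψ := (h.leadingCoords_surjective hF).comp φ.symm.surjective
  have hker : (tMul H).submoduleOf H = LinearMap.ker ψ := by
    ext f
    obtain ⟨q, rfl⟩ := φ.surjective f
    have h1 : ψ (φ q) = leadingCoords β v n hF q := by simp [ψ]
    rw [LinearMap.mem_ker, h1, h.leadingCoords_eq_zero_iff, Submodule.submoduleOf, Submodule.mem_comap]
    constructor
    · rintro ⟨_, ⟨p, hp, rfl⟩, hpq⟩
      refine ⟨p, hp, cylFun_injective X ?_⟩
      rw [map_mul, cylFun_X]
      exact hpq.symm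
    · rintro ⟨p, hp, hpq⟩
      refine ⟨cylFun X p, ⟨p, hp, rfl⟩, ?_⟩
      rw [Submodule.subtype_apply, hφ, hpq, map_mul, cylFun_X]
      rfl
  let e := Module.Basis.ofEquivFun
    ((Submodule.quotEquivOfEq _ _ hker).trans (ψ.quotKerEquivOfSurjective hψ))
  -- The eigenvectors are the classes of `β j t^(n - v j)`. Functions from `X` are invariant and `t`
  -- has weight `-1`, so the monomials themselves are eigenvectors.
  refine ⟨N, e, fun j => -((n - v j : ℕ) : ℤ), fun j => ⟨φ ⟨_, h.monomial_mem j⟩, ?_, fun a => ?_⟩, ?_⟩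
  · rw [Module.Basis.coe_ofEquivFun, LinearEquiv.eq_symm_apply]
    change ψ (φ _) = _
    rw [← h.leadingCoords_monomial hF]
    simp [ψ]
  · rw [hφ, rot_cylFun_monomial, sub_self]
    exact zero_mem _
  · have h1 : ∀ j, -((n - v j : ℕ) : ℤ) = v j - n := fun j => by
      rw [Nat.cast_sub (h.le j)]
      ring
    simp [h1]

end Weights

/-! ### The filtration on sections -/

section Filtration

variable {K : Type u} [Field K] {X : Scheme.{u}} [X.Over (Spec (.of K))] [IsIntegral X]
variable {n k M r : ℕ} {ω : RatForm K X n} {I : ℕ → X.IdealSheafData}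

lemma filt_antitone (h : IsFlag M I) : Antitone (filt ω k M I r) := fun _ _ hij _ hf x =>
  mul_le_mul_right (fracStalk_mono (h.tilde_antitone r hij) x) _ (hf x)

lemma filt_zero (h : IsFlag M I) : filt ω k M I r 0 = antiSections ω k := by
  unfold filt antiSections
  congr 1
  ext1 x
  rw [tilde_zero h, fracStalk_top, mul_one]

end Filtration

/-! ### The determinant divisor -/

section Determinant

variable {K : Type u} [Field K] {X : Scheme.{u}} [X.Over (Spec (.of K))]

variable (K X) in
/-- The inclusion of the ground field in the local rings of `X ^ N`. -/
def powConst (N : ℕ) (z : PowVar K X N) : K →+* (PowVar K X N).presheaf.stalk z :=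
  (((PowVar K X N).presheaf.germ ⊤ z (TopologicalSpace.Opens.mem_top z)).hom.comp
    (WidePullback.base fun _ : Fin N => X ↘ Spec (.of K)).appTop.hom).comp
      (Scheme.ΓSpecIso (.of K)).inv.hom

lemma stalkMap_proj_constStalk {N : ℕ} (i : Fin N) (z : PowVar K X N) (c : K) :
    (PowVar.proj K X N i).stalkMap z (constStalk X (PowVar.proj K X N i z) c) =
      powConst K X N z c :=
  stalkMap_constStalk _ (WidePullback.π_arrow (fun _ : Fin N => X ↘ Spec (.of K)) i) z c

variable {M r N : ℕ} {I : ℕ → X.IdealSheafData}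

lemma prod_stalkMap_mem_prodSum {z : PowVar K X N} (a : Fin N → ℕ) (ha : ∀ i, a i ≤ M * r)
    (c : ∀ i, X.presheaf.stalk (PowVar.proj K X N i z))
    (hc : ∀ i, c i ∈ stalkIdeal (tilde M I r (a i)) (PowVar.proj K X N i z)) :
    ∏ i, (PowVar.proj K X N i).stalkMap z (c i) ∈ stalkIdeal (prodSum K N M I r (∑ i, a i)) z := by
  have hle : ∏ i, (tilde M I r (a i)).comap (PowVar.proj K X N i) ≤
      prodSum K N M I r (∑ i, a i) :=
    Finset.single_le_sum (f := fun b : Fin N → Fin (M * r + 1) =>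
      ∏ i, (tilde M I r (b i)).comap (PowVar.proj K X N i)) (fun _ _ => bot_le)
      (a := fun i => ⟨a i, Nat.lt_succ_of_le (ha i)⟩) (by simp)
  refine stalkIdeal_mono hle z ?_
  have h : stalkIdeal (∏ i, (tilde M I r (a i)).comap (PowVar.proj K X N i)) z =
      ∏ i, stalkIdeal ((tilde M I r (a i)).comap (PowVar.proj K X N i)) z :=
    map_prod (stalkIdealHom z) _ _
  rw [h]
  refine Ideal.prod_mem_prod fun i _ => ?_
  rw [stalkIdeal_comap]
  exact Ideal.mem_map_of_mem _ (hc i)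

variable [IsIntegral X] {n k : ℕ} {ω : RatForm K X n}

/-- The determinant of a space of sections lies in the product ideal sheaf whose index is the
total jump of a filtration by subsheaves. -/
theorem detIdeal_le_of_isAdapted {β : Module.Basis (Fin N) K (filt ω k M I r 0)} {v : Fin N → ℕ}
    (h : IsAdapted β v (M * r)) (h0 : filt ω k M I r 0 = antiSections ω k)
    (σ : Module.Basis (Fin N) K (antiSections ω k)) (z : PowVar K X N) :
    detIdeal ω k σ z ≤ stalkIdeal (prodSum K N M I r (∑ i, v i)) z := by
  refine Ideal.span_le.mpr ?_
  rintro _ ⟨g, c, hg, hc, rfl⟩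
  have hβ : ∀ i j, ∃ a ∈ stalkIdeal (tilde M I r (v j)) (PowVar.proj K X N i z),
      (β j : X.functionField) = algebraMap _ X.functionField a * g i := by
    intro i j
    have h1 : (β j : X.functionField) ∈ antiCan ω k (PowVar.proj K X N i z) *
        fracStalk (tilde M I r (v j)) (PowVar.proj K X N i z) := h.self_mem j _
    rw [(hg i).2, Submodule.mem_span_singleton_mul] at h1
    obtain ⟨_, ⟨a, ha, rfl⟩, h2⟩ := h1
    exact ⟨a, ha, by rw [← h2, mul_comm, Algebra.linearMap_apply]⟩
  choose c' hc' hβc using hβ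
  -- The change of basis contributes a factor `det A`; for an inclusion of ideals it need not be a
  -- unit.
  let A : Matrix (Fin N) (Fin N) K := Matrix.of fun l j => β.repr ⟨σ j, h0.ge (σ j).2⟩ l
  have hσ : ∀ j, (σ j : X.functionField) = ∑ l, A l j • (β l : X.functionField) := fun j => by
    have h1 := congr_arg Subtype.val (β.sum_repr ⟨σ j, h0.ge (σ j).2⟩)
    rw [Submodule.coe_sum] at h1
    exact h1.symm
  -- The comparison is made in the local rings of `X`, which embed in the function field, and only
  -- then pulled back; no function field of `X^N` is involved.
  have hcc : ∀ i j, c i j = ∑ l, c' i l * constStalk X (PowVar.proj K X N i z) (A l j) := by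
    intro i j
    apply IsFractionRing.injective (X.presheaf.stalk (PowVar.proj K X N i z)) X.functionField
    apply mul_right_cancel₀ (hg i).1
    rw [← hc, hσ, map_sum, Finset.sum_mul]
    refine Finset.sum_congr rfl fun l _ => ?_
    rw [map_mul, algebraMap_constStalk, Algebra.smul_def, hβc i l]
    ring
  have hmat : (Matrix.of fun i j => (PowVar.proj K X N i).stalkMap z (c i j)) =
      (Matrix.of fun i j => (PowVar.proj K X N i).stalkMap z (c' i j)) *
        A.map (powConst K X N z) := by
    ext i j
    rw [Matrix.mul_apply, Matrix.of_apply, hcc, map_sum]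
    refine Finset.sum_congr rfl fun l _ => ?_
    rw [map_mul, stalkMap_proj_constStalk]
    rfl
  rw [hmat, Matrix.det_mul]
  refine Ideal.mul_mem_right _ _ ?_
  rw [← Matrix.det_transpose, Matrix.det_apply']
  refine Ideal.sum_mem _ fun π _ => Ideal.mul_mem_left _ _ ?_
  -- The Leibniz term of `π` has indices `v (π i)`, whose sum is the same for every permutation.
  rw [← Equiv.sum_comp π v]
  exact prod_stalkMap_mem_prodSum (fun i => v (π i)) (fun i => h.le _) (fun i => c' i (π i))
    fun i => hc' i (π i)

end Determinant

end FlagIdeal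

end

/-! ### Choice of `k₀` and assembly -/

open FlagIdeal in
theorem lemma4p1 {K : Type u} [Field K] [IsAlgClosed K] [CharZero K]
    (X : Scheme.{u}) [X.Over (Spec (.of K))] [IsIntegral X]
    (n : ℕ) (ω : RatForm K X n) (hX : IsQFano K X n ω)
    (M : ℕ) (I : ℕ → X.IdealSheafData) (T : FlagBlowup M I)
    (s : ℚ) (hT : T.IsSemiTestConfiguration ω s) :
    ∃ k₀ : ℕ, 0 < k₀ ∧ ∀ k : ℕ, 0 < k → k₀ ∣ k → ∀ N : ℕ,
      N = Module.finrank K (antiSections ω k) →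
      IsCartier ω k ∧ IsGloballyGenerated ω k ∧ Module.Finite K (antiSections ω k) ∧
      ∃ r : ℕ, (r : ℚ) = k * s ∧
        tExpansion M I ^ r = tExpansion (M * r) (tilde M I r) ∧
        filt ω k M I r 0 = antiSections ω k ∧
        (∀ j < M * r, filt ω k M I r (j + 1) ≤ filt ω k M I r j) ∧
        ∃ m : ℕ, m = ∑ j ∈ Finset.Icc 1 (M * r), Module.finrank K (filt ω k M I r j) ∧
          (∃ w : ℤ, HasTotalWeight (T.sections ω k r) w ∧ (m : ℤ) = N * M * r + w) ∧
          ∀ (σ : Module.Basis (Fin N) K (antiSections ω k)) (z : PowVar K X N),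
            detIdeal ω k σ z ≤ stalkIdeal (prodSum K N M I r m) z := by
  have := hX.proper
  have : IsLocallyNoetherian (Cyl X) :=
    LocallyOfFiniteType.isLocallyNoetherian (Cyl X ↘ Spec (.of K))
  obtain ⟨k₁, hk₁, ι, _, U, f, hcov, hf0, hf⟩ := hX.exists_generating_cover
  have hpow : ∀ i, ∃ r₀, ∀ r ≥ r₀, ∀ [Nonempty (cylOpen (U i)).1] (x : (Cyl X).functionField),
      IsPowMultiplier ((tExpansion M I).ideal (cylOpen (U i))) r x →
      ∃ b ∈ (tExpansion M I).ideal (cylOpen (U i)) ^ r,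
        x = algebraMap _ (Cyl X).functionField b := by
    intro i
    -- The cover may have empty members, which impose no bound.
    by_cases h : Nonempty (cylOpen (U i)).1
    · obtain ⟨⟨y, hy⟩⟩ := id h
      have : Nonempty (U i).1 := ⟨⟨_, hy⟩⟩
      obtain ⟨r₀, hr₀⟩ := exists_forall_isPowMultiplier_tExpansion (K := K) T.isFlag (U i)
      exact ⟨r₀, fun r hr _ => hr₀ r hr⟩
    · exact ⟨0, fun _ _ h' => absurd h' h⟩
  choose r₀ hr₀ using hpow
  obtain ⟨R, hR⟩ := Set.finite_range r₀ |>.bddAbove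
  have hs : 0 < s.num := Rat.num_pos.mpr hT.s_pos
  -- `k₁` provides generation by sections, `s.den` makes `k s` an integer, and `R + 1` forces `k s ≥
  -- R`, the common bound for the charts; adding one keeps `k₀` positive.
  refine ⟨k₁ * (s.den * (R + 1)), by positivity, ?_⟩
  rintro _ hk ⟨c, rfl⟩ N hN
  have hc : 0 < c := pos_of_mul_pos_right hk (Nat.zero_le _)
  rw [mul_assoc k₁] at hN ⊢
  set d := s.den * (R + 1) * c with hd
  have hgen : ∀ x : X, ∃ i, antiCan ω (k₁ * d) x = Submodule.span _ {f i ^ d} := fun x => by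
    obtain ⟨i, hi⟩ := hcov x
    exact ⟨i, (hf i d).2 x hi⟩
  have hfin : Module.Finite K (antiSections ω (k₁ * d)) := finite_antiSections _ hgen
  have hanti := filt_antitone (ω := ω) (k := k₁ * d) (r := k₁ * (R + 1) * c * s.num.toNat) T.isFlag
  have hzero := filt_zero (ω := ω) (k := k₁ * d) (r := k₁ * (R + 1) * c * s.num.toNat) T.isFlag
  set r := k₁ * (R + 1) * c * s.num.toNat with hr
  have hrR : R ≤ r := by
    have h1 : 0 < k₁ * (c * s.num.toNat) := by
      have : 0 < s.num.toNat := by omega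
      positivity
    calc R ≤ R + 1 := Nat.le_succ R
      _ ≤ (R + 1) * (k₁ * (c * s.num.toNat)) := Nat.le_mul_of_pos_right _ h1
      _ = r := by rw [hr]; ring
  have hrs : (r : ℚ) = ((k₁ * d : ℕ) : ℚ) * s := by
    have h1 : ((s.num.toNat : ℕ) : ℚ) = s * s.den := by
      rw [Rat.mul_den_eq_num, ← Int.cast_natCast, Int.toNat_of_nonneg hs.le]
    rw [hr, hd]
    push_cast
    rw [h1]
    ring
  have hfin0 : Module.Finite K (filt ω (k₁ * d) M I r 0) := hzero ▸ hfin
  obtain ⟨β, v, hβ, hsum⟩ := exists_isAdapted (M * r) (filt ω (k₁ * d) M I r)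
    (fun j _ => hanti j.le_succ) (hN.trans (by rw [hzero]))
  refine ⟨fun x => ?_, fun x => ?_, hfin, r, hrs, tExpansion_pow M I r, hzero,
    fun j _ => hanti j.le_succ, ∑ i, v i, hsum.symm, ⟨_, hasTotalWeight_of_isAdapted hβ
      (fun j => hanti j.zero_le) fun q => T.mem_sections_iff fun x => ?_, ?_⟩,
    detIdeal_le_of_isAdapted hβ hzero⟩
  · obtain ⟨i, hi⟩ := hgen x
    exact ⟨_, pow_ne_zero _ (hf0 i), hi⟩
  · obtain ⟨i, hi⟩ := hgen x
    exact ⟨_, (hf i d).1, hi⟩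
  · obtain ⟨i, hi⟩ := hcov x
    exact ⟨U i, f i ^ d, hi, pow_ne_zero _ (hf0 i), (hf i d).2,
      fun x => hr₀ i r ((hR ⟨i, rfl⟩).trans hrR) x⟩
  · push_cast
    ring
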